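/- **Setting.** Let $f:\mathbb{R}\to[0,\infty)$ be a continuous probability density with distribution $F$, and call $F$ *well-behaved* if 1. $f(-x)=f(x)$ for all $x$, $f$ is strictly decreasing on $[0,\infty)$, and $F$ has finite variance; 2. for every $x\neq 0$, $f$ and $g=f'/f$ are differentiable at $x$, and $|g'(x)|\le c_1$ for a constant $c_1>0$; 3. there are constants $Q,c_3>0$ with $1-F(x)\le c_3e^{-|x|}$ for $x>Q$ and $F(x)\le c_3e^{-|x|}$ for $x<-Q$. In state $\theta\in\mathbb{R}$ a sender sees $n$ anecdotes $x_i=\theta+\varepsilon_i$ with $\varepsilon_i\sim F$ i.i.d., and side information of one of two kinds: either an independent signal $y=\theta+\gamma$ with $\gamma\sim G$, for an arbitrary probability distribution $G$ on $\mathbb{R}$ (the case $\gamma=0$ is "foresight"), or a diffuse signal, which carries no information ("no foresight"). With a diffuse (constant-density) prior on $\theta$, her posterior mean is $$\theta_S(\vec x,y)=\frac{\int\theta\prod_i f(x_i-\theta)\,d\mu_y(\theta)}{\int\prod_i f(x_i-\theta)\,d\mu_y(\theta)},$$ where $\mu_y$ is the law of $y-\gamma$ for $\gamma\sim G$, respectively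 Lebesgue measure if the side signal is diffuse. A communication scheme is a measurable map $\pi$ with $\pi(\vec x,y)\in\{x_1,\dots,x_n\}$ for all $(\vec x,y)$ (not depending on $y$ if the side signal is diffuse); it is translation invariant if $\pi(\vec x+t,y+t)=\pi(\vec x,y)+t$ for all $t\in\mathbb{R}$, and then its bias is $\beta(\pi)=\mathbb{E}[\pi(\vec x,y)-\theta]$ (the same in every state $\theta$) and its signaling loss is $\mathbb{E}\big[(\pi(\vec x,y)-\theta_S(\vec x,y)-\beta(\pi))^2\big]$. A targeting scheme with offset $r$ always sends an anecdote closest to $\theta_S(\vec x,y)+r$. **Proposition.** Let $F$ be well-behaved, and fix the kind of side information. (0) If the side signal is diffuse or $G$ is symmetric about $0$, then for every $n\ge1$ there is a translation-invariant targeting scheme with offset $0$ that breaks ties symmetrically, i.e. $\pi(-\vec x,-y)=-\pi(\vec x,y)$, and every such scheme has bias $0$. (a) Every translation-invariant targeting scheme with offset $0$ and bias $0$ has signaling loss $$\frac{1}{2n^2f(0)^2}+o\!\left(\frac1{n^2}\right)\qquad(n\to\infty).$$ (b) Every translation-invariant communication scheme with bias $\delta$ has signaling loss at least $$\frac{1}{2n^2f(\delta)^2}-o\!\left(\frac1{n^2}\right)\qquad(n\to\infty).$$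 In (a) and (b) the $o(1/n^2)$ terms depend only on $F$, on the side information and $n$, and not on the scheme or on $\theta$; the one in (b) is uniform over $\delta$ in bounded sets. -/

import Mathlib

open MeasureTheory

noncomputable section

namespace Anecdotes

/-- The noise distribution `F` on the real line with density `f`. -/
def noiseLaw (f : ℝ → ℝ) : Measure ℝ :=
  volume.withDensity (fun x => ENNReal.ofReal (f x))

/-- The logarithmic derivative `g = f' / f` of the density. -/
def score (f : ℝ → ℝ) (x : ℝ) : ℝ := deriv f x / f x

/-- `f` is the density of a well-behaved noise distribution: strictly single-peaked and symmetric
(about `0`) with finite variance, with a bounded derivative of the logarithmic derivative, and with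
exponential tails. The peak `0` is exempt from the differentiability requirements, so that the
Laplace density is included. Strict monotonicity and `0 ≤ f` make `f` positive everywhere. -/
structure WellBehaved (f : ℝ → ℝ) : Prop where
  continuous : Continuous f
  nonneg : ∀ x, 0 ≤ f x
  integral_eq_one : ∫ x, f x = 1
  symmetric : ∀ x, f (-x) = f x
  single_peaked : StrictAntiOn f (Set.Ici 0)
  finite_variance : Integrable (fun x => x ^ 2 * f x)
  score_deriv_bound : ∃ c₁ : ℝ, 0 < c₁ ∧ ∀ x : ℝ, x ≠ 0 →
    DifferentiableAt ℝ f x ∧ DifferentiableAt ℝ (score f) x ∧ |deriv (score f) x| ≤ c₁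
  exponential_tails : ∃ Q c₃ : ℝ, 0 < Q ∧ 0 < c₃ ∧
    (∀ x, Q < x → 1 - ProbabilityTheory.cdf (noiseLaw f) x ≤ c₃ * Real.exp (-|x|)) ∧
    (∀ x, x < -Q → ProbabilityTheory.cdf (noiseLaw f) x ≤ c₃ * Real.exp (-|x|))

/-- The sender's side information. Either she observes a signal `y = θ + γ` with `γ ∼ G` for a
probability distribution `G` (foresight is the case where `G` is the point mass at `0`), or the side
signal is diffuse, that is, it carries no information about `θ` (no foresight). -/
inductive SideInfo where
  | diffuse : SideInfo
  | signal (G : ProbabilityMeasure ℝ) : SideInfo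

namespace SideInfo

/-- The law of `γ = y - θ`. In the diffuse case there is no side signal; the value given there is a
placeholder, which neither the posterior mean nor a communication scheme can read. -/
def law : SideInfo → Measure ℝ
  | diffuse => Measure.dirac 0
  | signal G => (G : Measure ℝ)

/-- The sender's belief about the state `θ` given `y` alone, under a diffuse prior on `θ`: the law
of `y - γ`, or Lebesgue measure (an improper distribution) if the side signal is diffuse. -/
def belief : SideInfo → ℝ → Measure ℝ
  | diffuse, _ => volume
  | signal G, y => (G : Measure ℝ).map (fun γ => y - γ)

/-- The distribution of the side signal's noise is symmetric about `0`. -/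
def IsSymmetric : SideInfo → Prop
  | diffuse => True
  | signal G => (G : Measure ℝ).map (fun γ => -γ) = (G : Measure ℝ)

end SideInfo

/-- The sender's posterior mean `θ_S(x, y)` of the state, by Bayes' rule. -/
def posteriorMean (f : ℝ → ℝ) (S : SideInfo) {n : ℕ} (x : Fin n → ℝ) (y : ℝ) : ℝ :=
  (∫ θ, θ * ∏ i, f (x i - θ) ∂S.belief y) / ∫ θ, ∏ i, f (x i - θ) ∂S.belief y

/-- A communication scheme: it selects one of the anecdotes, as a measurable function of the
anecdotes and of the side signal; it cannot use a side signal that is diffuse. -/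
structure IsScheme (S : SideInfo) {n : ℕ} (π : (Fin n → ℝ) → ℝ → ℝ) : Prop where
  measurable : Measurable (fun p : (Fin n → ℝ) × ℝ => π p.1 p.2)
  selects : ∀ x y, ∃ i, π x y = x i
  ignores_diffuse : S = SideInfo.diffuse → ∀ x y y', π x y = π x y'

/-- Translation invariance of a communication scheme. -/
def TranslationInvariant {n : ℕ} (π : (Fin n → ℝ) → ℝ → ℝ) : Prop :=
  ∀ (x : Fin n → ℝ) (y t : ℝ), π (fun i => x i + t) (y + t) = π x y + t

/-- Equivariance under the reflection of the line. -/
def ReflectionInvariant {n : ℕ} (π : (Fin n → ℝ) → ℝ → ℝ) : Prop :=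
  ∀ (x : Fin n → ℝ) (y : ℝ), π (fun i => -x i) (-y) = -π x y

/-- `π` is a targeting scheme with offset `r`: the anecdote sent is a closest one to
`θ_S(x, y) + r`. Ties may be broken in any way. -/
def IsTargeting (f : ℝ → ℝ) (S : SideInfo) (r : ℝ) {n : ℕ} (π : (Fin n → ℝ) → ℝ → ℝ) : Prop :=
  ∀ (x : Fin n → ℝ) (y : ℝ) (i : Fin n),
    |π x y - (posteriorMean f S x y + r)| ≤ |x i - (posteriorMean f S x y + r)|

/-- The joint law of the noise terms `(ε₁, …, εₙ)` and `γ`. -/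
def noise (f : ℝ → ℝ) (S : SideInfo) (n : ℕ) : Measure ((Fin n → ℝ) × ℝ) :=
  (Measure.pi fun _ : Fin n => noiseLaw f).prod S.law

/-- The scheme `π` has bias `δ`: in every state `θ`, `E[π(x, y) - θ] = δ`, where `xᵢ = θ + εᵢ` and
`y = θ + γ`. -/
def HasBias (f : ℝ → ℝ) (S : SideInfo) {n : ℕ} (π : (Fin n → ℝ) → ℝ → ℝ) (δ : ℝ) : Prop :=
  ∀ θ : ℝ,
    Integrable (fun p => π (fun i => θ + p.1 i) (θ + p.2) - θ) (noise f S n) ∧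
      ∫ p, (π (fun i => θ + p.1 i) (θ + p.2) - θ) ∂noise f S n = δ

/-- The signaling loss `E[(π(x, y) - (θ_S(x, y) + δ))²]` of a scheme `π` with bias `δ` in the
state `θ`, where `xᵢ = θ + εᵢ` and `y = θ + γ`. -/
def signalingLoss (f : ℝ → ℝ) (S : SideInfo) {n : ℕ} (π : (Fin n → ℝ) → ℝ → ℝ) (δ θ : ℝ) : ℝ :=
  ∫ p, (π (fun i => θ + p.1 i) (θ + p.2) -
    (posteriorMean f S (fun i => θ + p.1 i) (θ + p.2) + δ)) ^ 2 ∂noise f S n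

end Anecdotes

end

open MeasureTheory

noncomputable section

namespace Anecdotes

/-! ### The density -/

/-! By translation invariance the state may be taken to be 0. Call posterior mean plus δ the target,
and call its distance to the nearest anecdote the gap. Every scheme sends some anecdote, so its loss
is at least the mean square gap; targeting with offset 0 attains this for δ = 0. The target is close
to δ, where the anecdotes look like a Poisson process of intensity n f(δ). Were the target
independent of them, the gap would be nearly exponential with rate 2 n f(δ), and its second moment
would be 1/(2 n² f(δ)²). The difficulty is that the target depends on the anecdotes and fluctuates
on a scale far coarser than 1/n.

The dependence is local only to a negligible degree. Log-densities are Lipschitz with a constant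
growing linearly, so moving the anecdotes of a short window to its centre changes the log-likelihood
of θ by at most τ(1 + |θ|) with τ small. The posterior mean then moves by O(τ u), where u bounds the
posterior spread (`abs_posteriorMean_sub_le`), and with suitable scales this is much less than 1/n.
Up to this error, the target near a window is a function of the anecdotes outside it and of how many
lie inside. Given these data the inside anecdotes are independent draws from the conditional law, so
redrawing them preserves the joint law (`measurePreserving_resample_pi`), and the chance of a gap
larger than t is (1 - q)^m with the count m concentrated by Chernoff. Integrating over the centre of
the window (`measure_le_of_windows`, `le_measure_of_windows`) makes this global without any
regularity of the law of the target.

The spread is controlled for arbitrary side information by Bayes' rule itself: the anecdotes centred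
at a posterior draw have at most the law of the anecdotes centred at the truth
(`lintegral_posterior_shift_le`). The sample mean is therefore close both to the truth and to the
draw, which gives exponential moments on the scale 1/√n (`lintegral_post_exp_le`).

These give two-sided exponential bounds on the gap (`eventually_gapEvent_bounds`), and the
layer-cake formula turns them into the truncated second moment. A uniform fourth moment removes the
truncation in the upper bound. Bias 0 under symmetric tie-breaking is the reflection invariance of
the noise. -/

theorem integrable_exp_neg_mul_abs {b : ℝ} (hb : 0 < b) :
    Integrable fun x : ℝ => Real.exp (-(b * |x|)) := by
  rw [← integrableOn_univ, ← Set.Iic_union_Ioi (a := (0 : ℝ)), integrableOn_union]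
  constructor
  · refine (integrableOn_exp_mul_Iic hb 0).congr_fun (fun x hx => ?_) measurableSet_Iic
    simp only [abs_of_nonpos (Set.mem_Iic.1 hx)]; congr 1; ring
  · refine (integrableOn_exp_mul_Ioi (neg_lt_zero.2 hb) 0).congr_fun (fun x hx => ?_)
      measurableSet_Ioi
    simp only [abs_of_pos (Set.mem_Ioi.1 hx)]; congr 1; ring

theorem exp_le_one_add_add_sq (z : ℝ) : Real.exp z ≤ 1 + z + z ^ 2 * Real.exp |z| := by
  have h1 : Real.exp z - 1 ≤ z * Real.exp z := by
    have h := Real.add_one_le_exp (-z)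
    have h2 : Real.exp (-z) * Real.exp z = 1 := by rw [← Real.exp_add]; simp
    nlinarith [Real.exp_pos z]
  have h3 := Real.add_one_le_exp z
  rcases le_total 0 z with hz | hz
  · rw [abs_of_nonneg hz]; nlinarith
  · have h4 : 1 ≤ Real.exp |z| := Real.one_le_exp (abs_nonneg z)
    nlinarith [sq_nonneg z]

namespace WellBehaved

variable {f : ℝ → ℝ} (hf : WellBehaved f)
include hf

theorem apply_abs (x : ℝ) : f |x| = f x := by
  rcases abs_choice x with h | h <;> rw [h]
  exact hf.symmetric x

theorem pos (x : ℝ) : 0 < f x := by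
  rw [← hf.apply_abs x]
  have h : f (|x| + 1) < f |x| :=
    hf.single_peaked (Set.mem_Ici.2 (abs_nonneg x)) (Set.mem_Ici.2 (by positivity)) (by linarith)
  exact (hf.nonneg _).trans_lt h

theorem antitone_abs {x y : ℝ} (h : |x| ≤ |y|) : f y ≤ f x := by
  rw [← hf.apply_abs x, ← hf.apply_abs y]
  exact hf.single_peaked.antitoneOn (Set.mem_Ici.2 (abs_nonneg x)) (Set.mem_Ici.2 (abs_nonneg y)) h

theorem le_zero (x : ℝ) : f x ≤ f 0 := hf.antitone_abs (by simp)

theorem integrable : Integrable f := by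
  by_contra h
  have := hf.integral_eq_one
  rw [integral_undef h] at this
  exact zero_ne_one this

theorem lintegral_eq_one : ∫⁻ x, ENNReal.ofReal (f x) = 1 := by
  rw [← ofReal_integral_eq_lintegral_ofReal hf.integrable (ae_of_all _ hf.nonneg),
    hf.integral_eq_one, ENNReal.ofReal_one]

theorem isProbabilityMeasure : IsProbabilityMeasure (noiseLaw f) :=
  ⟨by rw [noiseLaw, withDensity_apply _ MeasurableSet.univ, setLIntegral_univ, hf.lintegral_eq_one]⟩

theorem noiseLaw_real {s : Set ℝ} (hs : MeasurableSet s) : (noiseLaw f).real s = ∫ x in s, f x := by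
  rw [Measure.real, noiseLaw, withDensity_apply _ hs,
    ← ofReal_integral_eq_lintegral_ofReal hf.integrable.integrableOn (ae_of_all _ hf.nonneg),
    ENNReal.toReal_ofReal (integral_nonneg hf.nonneg)]

theorem integral_noiseLaw (φ : ℝ → ℝ) : ∫ x, φ x ∂noiseLaw f = ∫ x, φ x * f x := by
  rw [noiseLaw, integral_withDensity_eq_integral_toReal_smul
    hf.continuous.measurable.ennreal_ofReal (by simp)]
  refine integral_congr_ae (ae_of_all _ fun x => ?_)
  simp [ENNReal.toReal_ofReal (hf.nonneg x), mul_comm]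

theorem integrable_noiseLaw_iff {φ : ℝ → ℝ} :
    Integrable φ (noiseLaw f) ↔ Integrable fun x => φ x * f x := by
  rw [noiseLaw, integrable_withDensity_iff hf.continuous.measurable.ennreal_ofReal (by simp)]
  simp [ENNReal.toReal_ofReal (hf.nonneg _)]

/-- The density has exponential tails. -/
theorem exists_le_exp : ∃ C : ℝ, 0 < C ∧ ∀ x, f x ≤ C * Real.exp (-|x|) := by
  have := hf.isProbabilityMeasure
  obtain ⟨Q, c, hQ, hc, h, -⟩ := hf.exponential_tails
  -- The first summand comes from evaluating the tail at `x - 1`; the second covers `x ≤ Q + 1`,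
  -- where `f ≤ f 0` suffices.
  refine ⟨c * Real.exp 1 + f 0 * Real.exp (Q + 1), by have := hf.pos 0; positivity, fun x => ?_⟩
  have key : ∀ x : ℝ, 0 ≤ x → f x ≤ (c * Real.exp 1 + f 0 * Real.exp (Q + 1)) * Real.exp (-x) := by
    intro x hx
    have h0 := hf.pos 0
    rcases le_or_gt x (Q + 1) with hxQ | hxQ
    · have h1 : 1 ≤ Real.exp (Q + 1) * Real.exp (-x) := by
        rw [← Real.exp_add]; exact Real.one_le_exp (by linarith)
      have h2 := hf.le_zero x
      have h3 : 0 ≤ c * Real.exp 1 * Real.exp (-x) := by positivity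
      nlinarith
    · have h1 := h (x - 1) (by linarith)
      rw [ProbabilityTheory.cdf_eq_real] at h1
      -- As `f` decreases on the half-line, its value at `x` is at most the mass of the unit
      -- interval ending at `x`, hence at most the tail beyond `x - 1`.
      have h2 : f x ≤ 1 - (noiseLaw f).real (Set.Iic (x - 1)) := by
        rw [← probReal_compl_eq_one_sub measurableSet_Iic]
        have h3 : (noiseLaw f).real (Set.Ioc (x - 1) x) ≤
            (noiseLaw f).real (Set.Iic (x - 1))ᶜ := by
          refine measureReal_mono fun z hz => ?_
          simpa using hz.1
        refine le_trans ?_ h3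
        rw [hf.noiseLaw_real measurableSet_Ioc]
        have h4 := setIntegral_mono_on (f := fun _ => f x) (g := f) (μ := volume)
          (s := Set.Ioc (x - 1) x) (by simp) hf.integrable.integrableOn measurableSet_Ioc
          (fun z hz => hf.antitone_abs (by
            rw [abs_of_nonneg hx, abs_of_nonneg (by linarith [hz.1])]; exact hz.2))
        simpa using h4
      rw [abs_of_nonneg (by linarith)] at h1
      have h3 : Real.exp (-(x - 1)) = Real.exp 1 * Real.exp (-x) := by
        rw [← Real.exp_add]; congr 1; ring
      have h4 : 0 ≤ f 0 * Real.exp (Q + 1) * Real.exp (-x) := by positivity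
      rw [h3] at h1
      nlinarith
  rw [← hf.apply_abs x]
  exact key _ (abs_nonneg x)

theorem integrable_of_le {φ : ℝ → ℝ} (hφ : Measurable φ) {K a : ℝ} (ha : a < 1)
    (h : ∀ x, |φ x| ≤ K * Real.exp (a * |x|)) : Integrable φ (noiseLaw f) := by
  rw [hf.integrable_noiseLaw_iff]
  obtain ⟨C, hC, hfC⟩ := hf.exists_le_exp
  have hexp : Integrable fun x : ℝ => Real.exp (-((1 - a) * |x|)) :=
    integrable_exp_neg_mul_abs (sub_pos.2 ha)
  refine (hexp.const_mul (K * C)).mono' (hφ.mul hf.continuous.measurable).aestronglyMeasurable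
    (ae_of_all _ fun x => ?_)
  rw [Real.norm_eq_abs, abs_mul, abs_of_nonneg (hf.nonneg x)]
  calc |φ x| * f x ≤ (K * Real.exp (a * |x|)) * (C * Real.exp (-|x|)) :=
        mul_le_mul (h x) (hfC x) (hf.nonneg x) ((abs_nonneg _).trans (h x))
    _ = K * C * Real.exp (-((1 - a) * |x|)) := by
        rw [show -((1 - a) * |x|) = a * |x| + -|x| by ring, Real.exp_add]; ring

theorem integral_id_eq_zero : ∫ x, x ∂noiseLaw f = 0 := by
  rw [hf.integral_noiseLaw]
  have h := integral_neg_eq_self (fun x => x * f x) volume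
  simp only [hf.symmetric, neg_mul, integral_neg] at h
  linarith

theorem integrable_exp_mul {l : ℝ} (hl : |l| ≤ 1 / 2) :
    Integrable (fun x => Real.exp (l * x)) (noiseLaw f) :=
  hf.integrable_of_le (by fun_prop) (K := 1) (a := 1 / 2) (by norm_num) fun x => by
    rw [Real.abs_exp, one_mul, Real.exp_le_exp]
    refine (le_abs_self _).trans ?_
    rw [abs_mul]
    exact mul_le_mul_of_nonneg_right hl (abs_nonneg x)

/-- Symmetry kills the linear term of the exponential, and the remainder is at most l² x²
exp(|x|/2), integrable because the tails decay at rate 1. -/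
theorem exists_mgf_le : ∃ K : ℝ, 0 ≤ K ∧ ∀ l : ℝ, |l| ≤ 1 / 2 →
    ∫ x, Real.exp (l * x) ∂noiseLaw f ≤ Real.exp (K * l ^ 2) := by
  have := hf.isProbabilityMeasure
  have hint : Integrable (fun x : ℝ => x ^ 2 * Real.exp (|x| / 2)) (noiseLaw f) :=
    hf.integrable_of_le (by fun_prop) (K := 32) (a := 3 / 4) (by norm_num) fun x => by
      have h := Real.quadratic_le_exp_of_nonneg (x := |x| / 4) (by positivity)
      have h2 : x ^ 2 ≤ 32 * Real.exp (|x| / 4) := by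
        have := abs_nonneg x
        rw [← sq_abs]; nlinarith
      rw [abs_of_nonneg (by positivity), show 3 / 4 * |x| = |x| / 4 + |x| / 2 by ring, Real.exp_add,
        ← mul_assoc]
      exact mul_le_mul_of_nonneg_right h2 (Real.exp_pos _).le
  have hid : Integrable (fun x : ℝ => x) (noiseLaw f) :=
    hf.integrable_of_le measurable_id (K := 2) (a := 1 / 2) (by norm_num) fun x => by
      have := Real.add_one_le_exp (1 / 2 * |x|)
      linarith
  refine ⟨∫ x, x ^ 2 * Real.exp (|x| / 2) ∂noiseLaw f,
    integral_nonneg fun x => by positivity, fun l hl => ?_⟩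
  have h1 : ∫ x, Real.exp (l * x) ∂noiseLaw f ≤
      ∫ x, (1 + l * x + l ^ 2 * (x ^ 2 * Real.exp (|x| / 2))) ∂noiseLaw f := by
    refine integral_mono (hf.integrable_exp_mul hl)
      (((integrable_const _).add (hid.const_mul l)).add (hint.const_mul _)) fun x => ?_
    refine (exp_le_one_add_add_sq (l * x)).trans ?_
    have h2 : Real.exp |l * x| ≤ Real.exp (|x| / 2) := by
      rw [Real.exp_le_exp, abs_mul]
      nlinarith [abs_nonneg x]
    have h3 : (l * x) ^ 2 * Real.exp |l * x| ≤ (l * x) ^ 2 * Real.exp (|x| / 2) :=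
      mul_le_mul_of_nonneg_left h2 (sq_nonneg _)
    linarith [mul_pow l x 2]
  have hlin : Integrable (fun x : ℝ => 1 + l * x) (noiseLaw f) :=
    (integrable_const _).add (hid.const_mul l)
  rw [integral_add hlin (hint.const_mul _), integral_add (integrable_const _) (hid.const_mul l),
    integral_const_mul, integral_const_mul,
    hf.integral_id_eq_zero] at h1
  simp only [integral_const, probReal_univ, smul_eq_mul, mul_one, mul_zero, add_zero] at h1
  refine h1.trans ?_
  rw [add_comm, mul_comm]
  exact Real.add_one_le_exp _

/-- The logarithm of the density is locally Lipschitz, with a constant that grows linearly. -/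
theorem exists_log_lipschitz : ∃ B : ℝ, 0 < B ∧ ∀ a b : ℝ,
    |Real.log (f a) - Real.log (f b)| ≤ B * (1 + max |a| |b|) * |a - b| := by
  obtain ⟨c, hc, h⟩ := hf.score_deriv_bound
  -- A score with bounded derivative on the half-line grows at most linearly.
  have hscore : ∀ x : ℝ, 0 < x → |score f x| ≤ (|score f 1| + c) * (1 + x) := by
    intro x hx
    have h1 := (convex_Ioi (0 : ℝ)).norm_image_sub_le_of_norm_deriv_le (f := score f) (C := c)
      (fun y hy => (h y (ne_of_gt hy)).2.1) (fun y hy => (h y (ne_of_gt hy)).2.2)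
      (Set.mem_Ioi.2 one_pos) (Set.mem_Ioi.2 hx)
    rw [Real.norm_eq_abs, Real.norm_eq_abs] at h1
    have h2 : |score f x| ≤ |score f 1| + |score f x - score f 1| := by
      have := abs_add_le (score f 1) (score f x - score f 1)
      simpa using this
    have h3 : |x - 1| ≤ 1 + x := by rw [abs_le]; constructor <;> linarith
    nlinarith [abs_nonneg (score f 1)]
  -- The mean value theorem needs differentiability only in the interior, so a kink of `f` at 0 does
  -- no harm as long as both points are nonnegative. The general case follows since `f` is even.
  have key : ∀ a b : ℝ, 0 ≤ b → b < a → |Real.log (f a) - Real.log (f b)| ≤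
      (|score f 1| + c) * (1 + a) * (a - b) := by
    intro a b hb hab
    obtain ⟨x, hx, hd⟩ := exists_deriv_eq_slope (fun x => Real.log (f x)) hab
      (fun x _ => (hf.continuous.continuousAt.log (hf.pos x).ne').continuousWithinAt)
      (fun x hx => ((h x (hb.trans_lt hx.1).ne').1.log (hf.pos x).ne').differentiableWithinAt)
    have hx0 : 0 < x := hb.trans_lt hx.1
    rw [deriv.log (h x hx0.ne').1 (hf.pos x).ne', eq_div_iff (sub_pos.2 hab).ne'] at hd
    rw [← hd, abs_mul, abs_of_pos (sub_pos.2 hab)]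
    refine mul_le_mul_of_nonneg_right ((hscore x hx0).trans ?_) (sub_pos.2 hab).le
    exact mul_le_mul_of_nonneg_left (by linarith [hx.2]) (by positivity)
  refine ⟨|score f 1| + c, by positivity, fun a b => ?_⟩
  have hle : ∀ a b : ℝ, |b| < |a| → |Real.log (f a) - Real.log (f b)| ≤
      (|score f 1| + c) * (1 + max |a| |b|) * |a - b| := by
    intro a b hab
    have h1 := key |a| |b| (abs_nonneg b) hab
    rw [hf.apply_abs, hf.apply_abs] at h1
    rw [max_eq_left hab.le]
    exact h1.trans (mul_le_mul_of_nonneg_left (abs_sub_abs_le_abs_sub a b) (by positivity))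
  rcases lt_trichotomy |a| |b| with hab | hab | hab
  · rw [abs_sub_comm, max_comm, abs_sub_comm a b]
    exact hle b a hab
  · rw [← hf.apply_abs a, hab, hf.apply_abs b, sub_self, abs_zero]
    positivity
  · exact hle a b hab

end WellBehaved

/-! ### The posterior -/

namespace SideInfo

/-- The law of `γ`, or Lebesgue measure if the side signal is diffuse. -/
def base : SideInfo → Measure ℝ
  | diffuse => volume
  | signal G => (G : Measure ℝ)

instance (S : SideInfo) : SFinite S.base := by
  cases S <;> simp only [base] <;> infer_instance

instance (S : SideInfo) : IsProbabilityMeasure S.law := by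
  cases S <;> simp only [law] <;> infer_instance

/-- Lebesgue measure is invariant under γ ↦ y - γ, so both kinds of side information become images
of a base measure not depending on y. From here on one proof serves both; with a diffuse signal y is
a dummy. -/
theorem belief_eq_map (S : SideInfo) (y : ℝ) : S.belief y = S.base.map (fun γ => y - γ) := by
  cases S with
  | diffuse => exact ((Measure.measurePreserving_sub_left volume y).map_eq).symm
  | signal G => rfl

theorem integral_belief (S : SideInfo) (y : ℝ) (φ : ℝ → ℝ) :
    ∫ θ, φ θ ∂S.belief y = ∫ γ, φ (y - γ) ∂S.base := by
  rw [belief_eq_map]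
  exact (MeasurableEquiv.subLeft y).measurableEmbedding.integral_map φ

theorem lintegral_belief (S : SideInfo) (y : ℝ) (φ : ℝ → ENNReal) :
    ∫⁻ θ, φ θ ∂S.belief y = ∫⁻ γ, φ (y - γ) ∂S.base := by
  rw [belief_eq_map]
  exact (MeasurableEquiv.subLeft y).measurableEmbedding.lintegral_map φ

theorem belief_ne_zero (S : SideInfo) (y : ℝ) : S.belief y ≠ 0 := by
  rw [belief_eq_map, Ne, Measure.map_eq_zero_iff (by fun_prop)]
  cases S with
  | diffuse => exact NeZero.ne (volume : Measure ℝ)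
  | signal G => exact IsProbabilityMeasure.ne_zero (G : Measure ℝ)

theorem integrable_exp_belief (S : SideInfo) (y : ℝ) {b : ℝ} (hb : 0 < b) :
    Integrable (fun θ : ℝ => Real.exp (-(b * |θ|))) (S.belief y) := by
  cases S with
  | diffuse => exact integrable_exp_neg_mul_abs hb
  | signal G =>
    have : IsProbabilityMeasure ((signal G).belief y) :=
      Measure.isProbabilityMeasure_map (by fun_prop)
    refine (integrable_const (1 : ℝ)).mono' (by fun_prop) (ae_of_all _ fun θ => ?_)
    rw [Real.norm_eq_abs, Real.abs_exp, Real.exp_le_one_iff, neg_nonpos]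
    positivity

theorem map_neg_base {S : SideInfo} (hS : S.IsSymmetric) : S.base.map (fun γ => -γ) = S.base := by
  cases S with
  | diffuse => exact (Measure.measurePreserving_neg volume).map_eq
  | signal G => exact hS

theorem map_neg_law {S : SideInfo} (hS : S.IsSymmetric) : S.law.map (fun γ => -γ) = S.law := by
  cases S with
  | diffuse => simp [law, Measure.map_dirac' measurable_neg]
  | signal G => exact hS

end SideInfo

/-- The likelihood of the state `θ` given the anecdotes `x`. -/
def likelihood (f : ℝ → ℝ) {n : ℕ} (x : Fin n → ℝ) (θ : ℝ) : ℝ := ∏ i, f (x i - θ)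

/-- The posterior expectation of `φ θ` given `x` and `y`. -/
def post (f : ℝ → ℝ) (S : SideInfo) {n : ℕ} (x : Fin n → ℝ) (y : ℝ) (φ : ℝ → ℝ) : ℝ :=
  (∫ θ, φ θ * likelihood f x θ ∂S.belief y) / ∫ θ, likelihood f x θ ∂S.belief y

theorem posteriorMean_eq_post (f : ℝ → ℝ) (S : SideInfo) {n : ℕ} (x : Fin n → ℝ) (y : ℝ) :
    posteriorMean f S x y = post f S x y fun θ => θ := rfl

theorem likelihood_add (f : ℝ → ℝ) {n : ℕ} (x : Fin n → ℝ) (t θ : ℝ) :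
    likelihood f (fun i => x i + t) θ = likelihood f x (θ - t) := by
  unfold likelihood
  refine Finset.prod_congr rfl fun i _ => ?_
  congr 1; ring

theorem post_add (f : ℝ → ℝ) (S : SideInfo) {n : ℕ} (x : Fin n → ℝ) (y t : ℝ) (φ : ℝ → ℝ) :
    post f S (fun i => x i + t) (y + t) φ = post f S x y fun θ => φ (θ + t) := by
  simp only [post, S.integral_belief, likelihood_add]
  simp only [show ∀ γ, y + t - γ = y - γ + t by intro γ; ring, add_sub_cancel_right]

theorem measurable_likelihood {f : ℝ → ℝ} (hf : Measurable f) (n : ℕ) :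
    Measurable fun p : (Fin n → ℝ) × ℝ => likelihood f p.1 p.2 := by
  unfold likelihood
  exact Finset.measurable_prod _ fun i _ => hf.comp (by fun_prop)

theorem measurable_post {f : ℝ → ℝ} (hf : Measurable f) (S : SideInfo) (n : ℕ) {φ : ℝ → ℝ}
    (hφ : Measurable φ) : Measurable fun p : (Fin n → ℝ) × ℝ => post f S p.1 p.2 φ := by
  simp only [post, S.integral_belief]
  have h1 : Measurable fun q : ((Fin n → ℝ) × ℝ) × ℝ => likelihood f q.1.1 (q.1.2 - q.2) :=
    (measurable_likelihood hf n).comp (by fun_prop : Measurable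
      fun q : ((Fin n → ℝ) × ℝ) × ℝ => (q.1.1, q.1.2 - q.2))
  have h2 : Measurable fun q : ((Fin n → ℝ) × ℝ) × ℝ => φ (q.1.2 - q.2) := hφ.comp (by fun_prop)
  exact ((h2.mul h1).stronglyMeasurable.integral_prod_right' (ν := S.base)).measurable.div
    (h1.stronglyMeasurable.integral_prod_right' (ν := S.base)).measurable

section Posterior

variable {f : ℝ → ℝ} (hf : WellBehaved f) (S : SideInfo) {n : ℕ}
include hf

theorem likelihood_pos (x : Fin n → ℝ) (θ : ℝ) : 0 < likelihood f x θ :=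
  Finset.prod_pos fun _ _ => hf.pos _

theorem continuous_likelihood (x : Fin n → ℝ) : Continuous (likelihood f x) :=
  continuous_finsetProd _ fun _ _ => hf.continuous.comp (by fun_prop)

theorem exists_likelihood_le (x : Fin n → ℝ) :
    ∃ K : ℝ, 0 ≤ K ∧ ∀ θ, likelihood f x θ ≤ K * Real.exp (-(n * |θ|)) := by
  obtain ⟨C, hC, h⟩ := hf.exists_le_exp
  refine ⟨∏ i, C * Real.exp |x i|, by positivity, fun θ => ?_⟩
  have h1 : Real.exp (-(n * |θ|)) = ∏ _i : Fin n, Real.exp (-|θ|) := by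
    rw [Finset.prod_const, Finset.card_univ, Fintype.card_fin, ← Real.exp_nat_mul]
    congr 1; ring
  rw [h1, ← Finset.prod_mul_distrib]
  refine Finset.prod_le_prod (fun _ _ => hf.nonneg _) fun i _ => (h _).trans ?_
  rw [mul_assoc, ← Real.exp_add]
  refine mul_le_mul_of_nonneg_left (Real.exp_le_exp.2 ?_) hC.le
  have := abs_sub_abs_le_abs_sub θ (x i)
  rw [abs_sub_comm] at this
  linarith

/-- Each of the n factors contributes a decay exp(-|θ|), so posterior moments of exponential rate
below n exist. -/
theorem integrable_mul_likelihood (x : Fin n → ℝ) (y : ℝ) {φ : ℝ → ℝ} (hφ : Measurable φ) {K k : ℝ}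
    (hk : k < n) (h : ∀ θ, |φ θ| ≤ K * Real.exp (k * |θ|)) :
    Integrable (fun θ => φ θ * likelihood f x θ) (S.belief y) := by
  obtain ⟨C, hC, hp⟩ := exists_likelihood_le hf x
  refine ((S.integrable_exp_belief y (sub_pos.2 hk)).const_mul (K * C)).mono'
    (hφ.mul (continuous_likelihood hf x).measurable).aestronglyMeasurable
    (ae_of_all _ fun θ => ?_)
  rw [Real.norm_eq_abs, abs_mul, abs_of_pos (likelihood_pos hf x θ)]
  calc |φ θ| * likelihood f x θ ≤ (K * Real.exp (k * |θ|)) * (C * Real.exp (-(n * |θ|))) :=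
        mul_le_mul (h θ) (hp θ) (likelihood_pos hf x θ).le ((abs_nonneg _).trans (h θ))
    _ = K * C * Real.exp (-((n - k) * |θ|)) := by
        rw [show -((n - k) * |θ|) = k * |θ| + -(n * |θ|) by ring, Real.exp_add]; ring

theorem integral_likelihood_nonneg (x : Fin n → ℝ) (y : ℝ) :
    0 ≤ ∫ θ, likelihood f x θ ∂S.belief y :=
  integral_nonneg fun θ => (likelihood_pos hf x θ).le

theorem integrable_likelihood (hn : 0 < n) (x : Fin n → ℝ) (y : ℝ) :
    Integrable (likelihood f x) (S.belief y) := by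
  have := integrable_mul_likelihood hf S x y (φ := fun _ => 1) measurable_const (K := 1) (k := 0)
    (by exact_mod_cast hn) (by simp)
  simpa using this

theorem integral_likelihood_pos (hn : 0 < n) (x : Fin n → ℝ) (y : ℝ) :
    0 < ∫ θ, likelihood f x θ ∂S.belief y := by
  rw [integral_pos_iff_support_of_nonneg (fun θ => (likelihood_pos hf x θ).le)
    (integrable_likelihood hf S hn x y)]
  have h : Function.support (likelihood f x) = Set.univ :=
    Set.eq_univ_of_forall fun θ => (likelihood_pos hf x θ).ne'
  rw [h]
  exact Measure.measure_univ_pos.2 (S.belief_ne_zero y)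

theorem post_const (hn : 0 < n) (x : Fin n → ℝ) (y a : ℝ) : post f S x y (fun _ => a) = a := by
  rw [post, integral_const_mul, mul_div_assoc, div_self (integral_likelihood_pos hf S hn x y).ne',
    mul_one]

theorem post_nonneg (x : Fin n → ℝ) (y : ℝ) {φ : ℝ → ℝ} (h : ∀ θ, 0 ≤ φ θ) :
    0 ≤ post f S x y φ :=
  div_nonneg (integral_nonneg fun θ => mul_nonneg (h θ) (likelihood_pos hf x θ).le)
    (integral_likelihood_nonneg hf S x y)

theorem post_mono (x : Fin n → ℝ) (y : ℝ) {φ ψ : ℝ → ℝ}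
    (hφ : Integrable (fun θ => φ θ * likelihood f x θ) (S.belief y))
    (hψ : Integrable (fun θ => ψ θ * likelihood f x θ) (S.belief y)) (h : ∀ θ, φ θ ≤ ψ θ) :
    post f S x y φ ≤ post f S x y ψ :=
  div_le_div_of_nonneg_right
    (integral_mono hφ hψ fun θ => mul_le_mul_of_nonneg_right (h θ) (likelihood_pos hf x θ).le)
    (integral_likelihood_nonneg hf S x y)

omit hf in
theorem post_add_fun (x : Fin n → ℝ) (y : ℝ) {φ ψ : ℝ → ℝ}
    (hφ : Integrable (fun θ => φ θ * likelihood f x θ) (S.belief y))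
    (hψ : Integrable (fun θ => ψ θ * likelihood f x θ) (S.belief y)) :
    post f S x y (fun θ => φ θ + ψ θ) = post f S x y φ + post f S x y ψ := by
  simp only [post, add_mul]
  rw [integral_add hφ hψ, add_div]

omit hf in
theorem post_const_mul (x : Fin n → ℝ) (y a : ℝ) (φ : ℝ → ℝ) :
    post f S x y (fun θ => a * φ θ) = a * post f S x y φ := by
  simp only [post, mul_assoc]
  rw [integral_const_mul, mul_div_assoc]

theorem integrable_exp_likelihood (x : Fin n → ℝ) (y : ℝ) {k : ℝ} (hk : k < n) :
    Integrable (fun θ => Real.exp (k * |θ|) * likelihood f x θ) (S.belief y) :=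
  integrable_mul_likelihood hf S x y (by fun_prop) (K := 1) hk (by simp)

theorem integrable_abs_mul_exp_likelihood (hn : 2 < n) (x : Fin n → ℝ) (y : ℝ) :
    Integrable (fun θ => |θ| * Real.exp |θ| * likelihood f x θ) (S.belief y) :=
  integrable_mul_likelihood hf S x y (by fun_prop) (K := 1) (k := 2) (by exact_mod_cast hn)
    fun θ => by
      rw [abs_of_nonneg (by positivity), one_mul, two_mul, Real.exp_add]
      have := Real.add_one_le_exp |θ|
      exact mul_le_mul_of_nonneg_right (by linarith) (Real.exp_pos _).le

theorem integrable_id_likelihood (hn : 0 < n) (x : Fin n → ℝ) (y : ℝ) :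
    Integrable (fun θ => θ * likelihood f x θ) (S.belief y) :=
  integrable_mul_likelihood hf S x y measurable_id (K := 2) (k := 1 / 2)
    (lt_of_lt_of_le (by norm_num) (Nat.one_le_cast.2 hn)) fun θ => by
      have := Real.add_one_le_exp (1 / 2 * |θ|)
      linarith

theorem integrable_abs_likelihood (hn : 0 < n) (x : Fin n → ℝ) (y : ℝ) :
    Integrable (fun θ => |θ| * likelihood f x θ) (S.belief y) := by
  refine (integrable_id_likelihood hf S hn x y).abs.congr (ae_of_all _ fun θ => ?_)
  simp only [abs_mul, abs_of_pos (likelihood_pos hf x θ)]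

theorem abs_posteriorMean_le_post_abs (x : Fin n → ℝ) (y : ℝ) :
    |posteriorMean f S x y| ≤ post f S x y fun θ => |θ| := by
  rw [posteriorMean_eq_post, post, post, abs_div,
    abs_of_nonneg (integral_likelihood_nonneg hf S x y)]
  refine div_le_div_of_nonneg_right ?_ (integral_likelihood_nonneg hf S x y)
  refine abs_integral_le_integral_abs.trans_eq (integral_congr_ae (ae_of_all _ fun θ => ?_))
  simp only [abs_mul, abs_of_pos (likelihood_pos hf x θ)]

/-- Jensen's inequality, from the tangent line to exp at a = |posterior mean|: the posterior
expectation of |θ| - a is nonnegative. -/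
theorem exp_abs_posteriorMean_le (hn : 2 < n) (x : Fin n → ℝ) (y : ℝ) :
    Real.exp |posteriorMean f S x y| ≤ post f S x y fun θ => Real.exp (1 * |θ|) := by
  have hn0 : 0 < n := by omega
  have hn1 : (1 : ℝ) < n := by exact_mod_cast (by omega : 1 < n)
  set a := |posteriorMean f S x y| with ha
  have h1 := abs_posteriorMean_le_post_abs hf S x y
  have hi1 := (integrable_abs_likelihood hf S hn0 x y)
  have hi2 : Integrable (fun θ => (1 - a) * likelihood f x θ) (S.belief y) :=
    (integrable_likelihood hf S hn0 x y).const_mul _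
  have h2 : post f S x y (fun θ => Real.exp a * (|θ| + (1 - a))) ≤
      post f S x y fun θ => Real.exp (1 * |θ|) := by
    refine post_mono hf S x y ?_ (integrable_exp_likelihood hf S x y hn1) fun θ => ?_
    · refine ((hi1.add hi2).const_mul (Real.exp a)).congr (ae_of_all _ fun θ => ?_)
      simp only [Pi.add_apply]; ring
    · have h3 := Real.add_one_le_exp (|θ| - a)
      have h4 : Real.exp (1 * |θ|) = Real.exp a * Real.exp (|θ| - a) := by
        rw [← Real.exp_add]; congr 1; ring
      rw [h4]
      exact mul_le_mul_of_nonneg_left (by linarith) (Real.exp_pos _).le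
  rw [post_const_mul, post_add_fun S x y hi1 hi2, post_const hf S hn0] at h2
  refine le_trans ?_ h2
  exact le_mul_of_one_le_right (Real.exp_pos _).le (by linarith)

/-- The spread of the posterior around the true state `0`. -/
theorem abs_posteriorMean_le (hn : 2 < n) (x : Fin n → ℝ) (y : ℝ) :
    |posteriorMean f S x y| ≤ post f S x y fun θ => |θ| * Real.exp |θ| :=
  (abs_posteriorMean_le_post_abs hf S x y).trans <|
    post_mono hf S x y (integrable_abs_likelihood hf S (by omega) x y)
      (integrable_abs_mul_exp_likelihood hf S hn x y) fun θ =>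
        le_mul_of_one_le_right (abs_nonneg _) (Real.one_le_exp (abs_nonneg _))

/-- Split at |θ| = a. Above it, |θ| exp |θ| ≤ exp(2|θ|) ≤ exp(-(k-2)a) exp(k|θ|), so a high
exponential moment makes the far part of the spread negligible. -/
theorem post_abs_mul_exp_le (hn : 2 < n) (x : Fin n → ℝ) (y : ℝ) {a k : ℝ} (ha : 0 ≤ a)
    (hk : 2 ≤ k) (hkn : k < n) :
    (post f S x y fun θ => |θ| * Real.exp |θ|) ≤
      a * Real.exp a + Real.exp (-((k - 2) * a)) * post f S x y fun θ => Real.exp (k * |θ|) := by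
  have hn0 : 0 < n := by omega
  have hi1 : Integrable (fun θ => (a * Real.exp a) * likelihood f x θ) (S.belief y) :=
    (integrable_likelihood hf S hn0 x y).const_mul _
  have hi2 : Integrable (fun θ => (Real.exp (-((k - 2) * a)) * Real.exp (k * |θ|)) *
      likelihood f x θ) (S.belief y) := by
    simp only [mul_assoc]
    exact (integrable_exp_likelihood hf S x y hkn).const_mul _
  rw [← post_const_mul, ← post_const hf S hn0 x y (a * Real.exp a), ← post_add_fun S x y hi1 hi2]
  refine post_mono hf S x y (integrable_abs_mul_exp_likelihood hf S hn x y) ?_ fun θ => ?_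
  · refine (hi1.add hi2).congr (ae_of_all _ fun θ => ?_)
    simp only [Pi.add_apply]; ring
  · rcases le_or_gt |θ| a with h | h
    · have h1 : |θ| * Real.exp |θ| ≤ a * Real.exp a :=
        mul_le_mul h (Real.exp_le_exp.2 h) (Real.exp_pos _).le ha
      have h2 : 0 < Real.exp (-((k - 2) * a)) * Real.exp (k * |θ|) := by positivity
      linarith
    · have h1 := Real.add_one_le_exp |θ|
      have h2 : |θ| * Real.exp |θ| ≤ Real.exp |θ| * Real.exp |θ| :=
        mul_le_mul_of_nonneg_right (by linarith) (Real.exp_pos _).le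
      have h3 : Real.exp |θ| * Real.exp |θ| ≤ Real.exp (-((k - 2) * a)) * Real.exp (k * |θ|) := by
        rw [← Real.exp_add, ← Real.exp_add, Real.exp_le_exp]
        nlinarith
      have h4 : 0 ≤ a * Real.exp a := by positivity
      linarith

end Posterior

theorem posteriorMean_add {f : ℝ → ℝ} (hf : WellBehaved f) (S : SideInfo) {n : ℕ} (hn : 0 < n)
    (x : Fin n → ℝ) (y t : ℝ) :
    posteriorMean f S (fun i => x i + t) (y + t) = posteriorMean f S x y + t := by
  simp only [posteriorMean_eq_post]
  rw [post_add, post_add_fun S x y (integrable_id_likelihood hf S hn x y)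
    ((integrable_likelihood hf S hn x y).const_mul t), post_const hf S hn]

theorem posteriorMean_neg {f : ℝ → ℝ} (hf : WellBehaved f) {S : SideInfo} (hS : S.IsSymmetric)
    {n : ℕ} (x : Fin n → ℝ) (y : ℝ) :
    posteriorMean f S (fun i => -x i) (-y) = -posteriorMean f S x y := by
  have hint : ∀ φ : ℝ → ℝ, ∫ γ, φ (-γ) ∂S.base = ∫ γ, φ γ ∂S.base := fun φ => by
    conv_rhs => rw [← S.map_neg_base hS]
    exact ((MeasurableEquiv.neg ℝ).measurableEmbedding.integral_map φ).symm
  have hlik : ∀ θ, likelihood f (fun i => -x i) (-θ) = likelihood f x θ := fun θ => by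
    unfold likelihood
    refine Finset.prod_congr rfl fun i _ => ?_
    rw [← hf.symmetric]
    congr 1; ring
  simp only [posteriorMean_eq_post, post, S.integral_belief]
  rw [← hint fun γ => (-y - γ) * likelihood f (fun i => -x i) (-y - γ),
    ← hint fun γ => likelihood f (fun i => -x i) (-y - γ)]
  simp only [show ∀ γ : ℝ, -y - -γ = -(y - γ) by intro γ; ring, hlik, neg_mul, integral_neg,
    neg_div]

/-! ### Sensitivity of the posterior mean to the anecdotes -/

/-- Follows from |exp l - 1| ≤ |l| exp |l|, where both 1 + t and exp |l| are at most 2 exp(t/2). The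
factor exp t is the reason why the spread below weights |θ| by exp |θ|. -/
theorem abs_exp_sub_one_le {τ l t : ℝ} (hτ : τ ≤ 1 / 16) (ht : 0 ≤ t)
    (hl : |l| ≤ τ * (1 + t)) : |Real.exp l - 1| ≤ 4 * τ * Real.exp t := by
  have hτ0 : 0 ≤ τ := by
    by_contra h
    have := (abs_nonneg l).trans hl
    nlinarith
  have h1 : |Real.exp l - 1| ≤ |l| * Real.exp |l| := by
    have h2 := Real.add_one_le_exp l
    have h3 := Real.add_one_le_exp (-l)
    have h4 : Real.exp (-l) * Real.exp l = 1 := by rw [← Real.exp_add]; simp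
    have h5 := Real.exp_pos l
    rw [abs_le]
    rcases abs_cases l with ⟨h, h'⟩ | ⟨h, h'⟩ <;> rw [h]
    · constructor <;> nlinarith
    · have := Real.one_le_exp (x := -l) (by linarith)
      constructor <;> nlinarith
  have h2 : Real.exp |l| ≤ 2 * Real.exp (t / 2) := by
    have h3 : Real.exp |l| ≤ Real.exp (1 / 16 + t / 2) := Real.exp_le_exp.2 (by nlinarith)
    rw [Real.exp_add] at h3
    have h4 : Real.exp (1 / 16) ≤ 2 := by
      have := Real.exp_bound_div_one_sub_of_interval (x := 1 / 16) (by norm_num) (by norm_num)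
      norm_num at this ⊢
      linarith
    nlinarith [Real.exp_pos (t / 2)]
  have h3 : 1 + t ≤ 2 * Real.exp (t / 2) := by
    have := Real.add_one_le_exp (t / 2)
    linarith
  have h4 : Real.exp t = Real.exp (t / 2) * Real.exp (t / 2) := by
    rw [← Real.exp_add]; congr 1; ring
  calc |Real.exp l - 1| ≤ |l| * Real.exp |l| := h1
    _ ≤ (τ * (2 * Real.exp (t / 2))) * (2 * Real.exp (t / 2)) := by
        refine mul_le_mul (hl.trans (mul_le_mul_of_nonneg_left h3 hτ0)) h2 (Real.exp_pos _).le ?_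
        positivity
    _ = 4 * τ * Real.exp t := by rw [h4]; ring

section Sensitivity

variable {f : ℝ → ℝ} (hf : WellBehaved f) (S : SideInfo) {n : ℕ}
include hf

/-- The likelihood ratio is within 4τ exp |θ| of 1. Relative to the old normalization, the
normalization changes by at most 8τ and the first moment by 4τu; since the old mean is at most u,
the numerator of the difference is at most 12τu, and dividing by a normalization at least half the
old one doubles this. What matters is the product τu: the mean moves by a small fraction of the
spread, not merely by τ. -/
theorem abs_posteriorMean_sub_le (hn : 2 < n) (x x' : Fin n → ℝ) (y : ℝ) {τ u : ℝ}
    (hτ : τ ≤ 1 / 16) (hu : u ≤ 1)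
    (hl : ∀ θ, |Real.log (likelihood f x' θ) - Real.log (likelihood f x θ)| ≤ τ * (1 + |θ|))
    (hpost : (post f S x y fun θ => |θ| * Real.exp |θ|) ≤ u) :
    |posteriorMean f S x' y - posteriorMean f S x y| ≤ 24 * τ * u := by
  have hn0 : 0 < n := by omega
  have hτ0 : 0 ≤ τ := by
    have := (abs_nonneg _).trans (hl 0)
    simpa using this
  have hu0 : 0 ≤ u := (post_nonneg hf S x y fun θ => by positivity).trans hpost
  set μ := S.belief y with hμ
  set p := likelihood f x with hp
  set q := likelihood f x' with hq
  have hp0 : ∀ θ, 0 < p θ := likelihood_pos hf x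
  have hq0 : ∀ θ, 0 < q θ := likelihood_pos hf x'
  have hZp : 0 < ∫ θ, p θ ∂μ := integral_likelihood_pos hf S hn0 x y
  have hZq : 0 < ∫ θ, q θ ∂μ := integral_likelihood_pos hf S hn0 x' y
  have hpi : Integrable p μ := integrable_likelihood hf S hn0 x y
  have hqi : Integrable q μ := integrable_likelihood hf S hn0 x' y
  have hpi1 : Integrable (fun θ => θ * p θ) μ := integrable_id_likelihood hf S hn0 x y
  have hqi1 : Integrable (fun θ => θ * q θ) μ := integrable_id_likelihood hf S hn0 x' y
  have hui : Integrable (fun θ => |θ| * Real.exp |θ| * p θ) μ :=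
    integrable_abs_mul_exp_likelihood hf S hn x y
  have hU : ∫ θ, |θ| * Real.exp |θ| * p θ ∂μ ≤ u * ∫ θ, p θ ∂μ := (div_le_iff₀ hZp).1 hpost
  have hdiff : ∀ θ, |q θ - p θ| ≤ 4 * τ * Real.exp |θ| * p θ := fun θ => by
    have h1 : q θ = p θ * Real.exp (Real.log (q θ) - Real.log (p θ)) := by
      rw [Real.exp_sub, Real.exp_log (hq0 θ), Real.exp_log (hp0 θ),
        mul_div_cancel₀ _ (hp0 θ).ne']
    have h2 := abs_exp_sub_one_le hτ (abs_nonneg θ) (hl θ)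
    rw [h1, show ∀ e : ℝ, p θ * e - p θ = (e - 1) * p θ by intro e; ring, abs_mul,
      abs_of_pos (hp0 θ)]
    exact mul_le_mul_of_nonneg_right h2 (hp0 θ).le
  have hZ : |(∫ θ, q θ ∂μ) - ∫ θ, p θ ∂μ| ≤ 8 * τ * ∫ θ, p θ ∂μ := by
    rw [← integral_sub hqi hpi]
    refine abs_integral_le_integral_abs.trans ?_
    have h1 : ∫ θ, |q θ - p θ| ∂μ ≤ ∫ θ, 4 * τ * (p θ + |θ| * Real.exp |θ| * p θ) ∂μ := by
      refine integral_mono (hqi.sub hpi).abs ((hpi.add hui).const_mul _) fun θ => ?_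
      refine (hdiff θ).trans ?_
      have h2 : Real.exp |θ| ≤ 1 + |θ| * Real.exp |θ| := by
        have h3 := Real.add_one_le_exp (-|θ|)
        have h4 : Real.exp (-|θ|) * Real.exp |θ| = 1 := by rw [← Real.exp_add]; simp
        nlinarith [Real.exp_pos |θ|]
      have h5 := mul_le_mul_of_nonneg_right h2 (hp0 θ).le
      have h6 := mul_le_mul_of_nonneg_left h5 (by positivity : 0 ≤ 4 * τ)
      calc 4 * τ * Real.exp |θ| * p θ = 4 * τ * (Real.exp |θ| * p θ) := by ring
        _ ≤ _ := h6
        _ = _ := by ring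
    rw [integral_const_mul, integral_add hpi hui] at h1
    refine h1.trans ?_
    have h2 : u * ∫ θ, p θ ∂μ ≤ ∫ θ, p θ ∂μ := mul_le_of_le_one_left hZp.le hu
    nlinarith
  have hN : |(∫ θ, θ * q θ ∂μ) - ∫ θ, θ * p θ ∂μ| ≤ 4 * τ * u * ∫ θ, p θ ∂μ := by
    rw [← integral_sub hqi1 hpi1]
    refine abs_integral_le_integral_abs.trans ?_
    have h1 : ∫ θ, |θ * q θ - θ * p θ| ∂μ ≤ ∫ θ, 4 * τ * (|θ| * Real.exp |θ| * p θ) ∂μ := by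
      refine integral_mono (hqi1.sub hpi1).abs (hui.const_mul _) fun θ => ?_
      simp only
      rw [← mul_sub, abs_mul]
      calc |θ| * |q θ - p θ| ≤ |θ| * (4 * τ * Real.exp |θ| * p θ) :=
            mul_le_mul_of_nonneg_left (hdiff θ) (abs_nonneg θ)
        _ = _ := by ring
    rw [integral_const_mul] at h1
    refine h1.trans ?_
    rw [mul_assoc (4 * τ)]
    exact mul_le_mul_of_nonneg_left hU (by positivity)
  have hT : |posteriorMean f S x y| ≤ u := (abs_posteriorMean_le hf S hn x y).trans hpost
  have hTx : posteriorMean f S x y = (∫ θ, θ * p θ ∂μ) / ∫ θ, p θ ∂μ := rfl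
  have hTx' : posteriorMean f S x' y = (∫ θ, θ * q θ ∂μ) / ∫ θ, q θ ∂μ := rfl
  set T := posteriorMean f S x y
  have hNp : ∫ θ, θ * p θ ∂μ = T * ∫ θ, p θ ∂μ := by rw [hTx, div_mul_cancel₀ _ hZp.ne']
  have h1 : posteriorMean f S x' y - T =
      (((∫ θ, θ * q θ ∂μ) - ∫ θ, θ * p θ ∂μ) - T * ((∫ θ, q θ ∂μ) - ∫ θ, p θ ∂μ)) /
        ∫ θ, q θ ∂μ := by
    rw [hTx', hNp, eq_div_iff hZq.ne', sub_mul, div_mul_cancel₀ _ hZq.ne']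
    ring
  rw [h1, abs_div, abs_of_pos hZq, div_le_iff₀ hZq]
  have h2 : |T * ((∫ θ, q θ ∂μ) - ∫ θ, p θ ∂μ)| ≤ u * (8 * τ * ∫ θ, p θ ∂μ) := by
    rw [abs_mul]
    exact mul_le_mul hT hZ (abs_nonneg _) hu0
  have h3 := abs_sub ((∫ θ, θ * q θ ∂μ) - ∫ θ, θ * p θ ∂μ) (T * ((∫ θ, q θ ∂μ) - ∫ θ, p θ ∂μ))
  have h4 : (∫ θ, p θ ∂μ) ≤ 2 * ∫ θ, q θ ∂μ := by
    have := (abs_le.1 hZ).1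
    nlinarith
  have h5 : 12 * τ * u * (∫ θ, p θ ∂μ) ≤ 12 * τ * u * (2 * ∫ θ, q θ ∂μ) :=
    mul_le_mul_of_nonneg_left h4 (by positivity)
  linarith

omit hf in
/-- The number of anecdotes in a set. -/
def count (C : Set ℝ) (x : Fin n → ℝ) : ℕ := by
  classical exact (Finset.univ.filter fun i => x i ∈ C).card

omit hf in
/-- Move all anecdotes in `C` to the point `c`. -/
def collapse (C : Set ℝ) (c : ℝ) (x : Fin n → ℝ) : Fin n → ℝ := by
  classical exact fun i => if x i ∈ C then c else x i

/-- Only anecdotes in the window contribute, each by less than its width times a Lipschitz constant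
of order 1 + |θ|. The bound `X` on the location of the window makes the constant uniform. -/
theorem exists_abs_log_likelihood_collapse_le (X : ℝ) : ∃ B : ℝ, 0 < B ∧
    ∀ (n : ℕ) (x : Fin n → ℝ) (c w θ : ℝ), |c| + w ≤ X →
      |Real.log (likelihood f (collapse (Metric.ball c w) c x) θ) - Real.log (likelihood f x θ)| ≤
        B * count (Metric.ball c w) x * w * (1 + |θ|) := by
  classical
  obtain ⟨B, hB, h⟩ := hf.exists_log_lipschitz
  refine ⟨B * (1 + |X|), by positivity, fun n x c w θ hX => ?_⟩
  unfold likelihood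
  rw [Real.log_prod (fun i _ => (hf.pos _).ne'), Real.log_prod (fun i _ => (hf.pos _).ne'),
    ← Finset.sum_sub_distrib]
  refine (Finset.abs_sum_le_sum_abs _ _).trans ?_
  have h1 : ∀ i, |Real.log (f (collapse (Metric.ball c w) c x i - θ)) - Real.log (f (x i - θ))| ≤
      if x i ∈ Metric.ball c w then B * (1 + |X|) * w * (1 + |θ|) else 0 := fun i => by
    unfold collapse
    split_ifs with hi
    · have hd : |c - x i| < w := by rwa [← Real.dist_eq, dist_comm]
      have hm : max |c - θ| |x i - θ| ≤ |X| + |θ| := by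
        have h2 := abs_sub c θ
        have h3 := abs_sub (x i) θ
        have h4 := abs_sub_abs_le_abs_sub (x i) c
        rw [abs_sub_comm] at h4
        have h5 := le_abs_self X
        refine max_le ?_ ?_ <;> linarith [abs_nonneg (c - x i)]
      refine (h _ _).trans ?_
      rw [sub_sub_sub_cancel_right]
      calc B * (1 + max |c - θ| |x i - θ|) * |c - x i| ≤ B * ((1 + |X|) * (1 + |θ|)) * w := by
            refine mul_le_mul (mul_le_mul_of_nonneg_left ?_ hB.le) hd.le (abs_nonneg _)
              (by positivity)
            nlinarith [abs_nonneg X, abs_nonneg θ]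
        _ = _ := by ring
    · simp
  refine (Finset.sum_le_sum fun i _ => h1 i).trans_eq ?_
  rw [← Finset.sum_filter, Finset.sum_const, nsmul_eq_mul, count]
  ring

end Sensitivity

/-! ### Concentration of the posterior -/

section Concentration

variable {f : ℝ → ℝ} (hf : WellBehaved f) (S : SideInfo) {n : ℕ}
include hf

/-- In state 0 the likelihood of 0 is the joint density of the anecdotes; this lets Bayes' rule be
written as a change of variables for Lebesgue measure on ℝⁿ. -/
theorem pi_noiseLaw_eq_withDensity : Measure.pi (fun _ : Fin n => noiseLaw f) =
    volume.withDensity fun x => ENNReal.ofReal (likelihood f x 0) := by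
  have := hf.isProbabilityMeasure
  refine Measure.pi_eq fun s hs => ?_
  have hbox : MeasurableSet (Set.univ.pi s) := MeasurableSet.univ_pi hs
  rw [withDensity_apply _ hbox, ← lintegral_indicator hbox]
  have h1 : ∀ x : Fin n → ℝ, (Set.univ.pi s).indicator
      (fun x => ENNReal.ofReal (likelihood f x 0)) x =
      ENNReal.ofReal (∏ i, (s i).indicator f (x i)) := fun x => by
    by_cases hx : x ∈ Set.univ.pi s
    · rw [Set.indicator_of_mem hx, likelihood]
      congr 1
      refine Finset.prod_congr rfl fun i _ => ?_
      rw [Set.indicator_of_mem (hx i trivial), sub_zero]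
    · rw [Set.indicator_of_notMem hx]
      obtain ⟨i, hi⟩ : ∃ i, x i ∉ s i := by simpa [Set.mem_univ_pi] using hx
      rw [Finset.prod_eq_zero (Finset.mem_univ i) (Set.indicator_of_notMem hi f),
        ENNReal.ofReal_zero]
  simp only [h1]
  have hi : ∀ i, Integrable ((s i).indicator f) := fun i => hf.integrable.indicator (hs i)
  have hnn : ∀ i x, 0 ≤ (s i).indicator f x := fun i => Set.indicator_nonneg fun x _ => hf.nonneg x
  have hprod : Integrable fun x : Fin n → ℝ => ∏ i, (s i).indicator f (x i) :=
    Integrable.fintype_prod hi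
  rw [← ofReal_integral_eq_lintegral_ofReal hprod
    (ae_of_all _ fun x => Finset.prod_nonneg fun i _ => hnn i _),
    integral_fintype_prod_volume_eq_prod,
    ENNReal.ofReal_prod_of_nonneg fun i _ => integral_nonneg (hnn i)]
  refine Finset.prod_congr rfl fun i _ => ?_
  rw [integral_indicator (hs i), ← hf.noiseLaw_real (hs i), ofReal_measureReal]

omit hf in
/-- The weight of the state `θ` given `x`, as an extended real number. -/
def weight (f : ℝ → ℝ) (x : Fin n → ℝ) (θ : ℝ) : ENNReal := ENNReal.ofReal (likelihood f x θ)

omit hf in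
/-- The normalization of the posterior. -/
def weightSum (f : ℝ → ℝ) (S : SideInfo) (x : Fin n → ℝ) (y : ℝ) : ENNReal :=
  ∫⁻ γ, weight f x (y - γ) ∂S.base

omit hf in
theorem weight_add (x : Fin n → ℝ) (t θ : ℝ) :
    weight f (x + fun _ => t) θ = weight f x (θ - t) := by
  unfold weight
  rw [← likelihood_add]
  rfl

omit hf in
theorem weightSum_add (x : Fin n → ℝ) (y t : ℝ) :
    weightSum f S (x + fun _ => t) y = weightSum f S x (y - t) := by
  simp only [weightSum, weight_add, sub_right_comm]

theorem measurable_weight : Measurable fun p : (Fin n → ℝ) × ℝ => weight f p.1 p.2 :=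
  (measurable_likelihood hf.continuous.measurable n).ennreal_ofReal

theorem measurable_weightSum : Measurable fun p : (Fin n → ℝ) × ℝ => weightSum f S p.1 p.2 := by
  have h : Measurable fun q : ((Fin n → ℝ) × ℝ) × ℝ => weight f q.1.1 (q.1.2 - q.2) :=
    (measurable_weight hf).comp (by fun_prop : Measurable
      fun q : ((Fin n → ℝ) × ℝ) × ℝ => (q.1.1, q.1.2 - q.2))
  exact h.lintegral_prod_right'

/-- The total mass of a normalized weight. With a diffuse signal the normalization does not depend
on y; otherwise exchanging the integrals makes the inner one equal to the normalization, which
cancels. Asking only for ≤ avoids excluding normalizations 0 and ∞. -/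
theorem lintegral_weight_div_weightSum_le (x : Fin n → ℝ) :
    ∫⁻ γ, ∫⁻ γ', weight f x (γ' - γ) * (weightSum f S x γ')⁻¹ ∂S.base ∂S.law ≤ 1 := by
  have hw : Measurable fun θ => weight f x θ := (measurable_weight hf).of_uncurry_left
  have hZ : Measurable fun y => weightSum f S x y := (measurable_weightSum hf S).of_uncurry_left
  cases S with
  | diffuse =>
    have h1 : ∀ y, weightSum f SideInfo.diffuse x y = ∫⁻ γ, weight f x γ := fun y =>
      lintegral_sub_left_eq_self (μ := volume) (fun γ => weight f x γ) y
    simp only [SideInfo.law, lintegral_dirac, sub_zero, h1, SideInfo.base]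
    rw [lintegral_mul_const _ hw]
    exact ENNReal.mul_inv_le_one _
  | signal G =>
    simp only [SideInfo.law, SideInfo.base] at hZ ⊢
    rw [lintegral_lintegral_swap]
    · have h1 : ∀ γ', ∫⁻ γ, weight f x (γ' - γ) * (weightSum f (SideInfo.signal G) x γ')⁻¹
          ∂(G : Measure ℝ) ≤ 1 := fun γ' => by
        have hw' : Measurable fun γ => weight f x (γ' - γ) := hw.comp (by fun_prop)
        rw [lintegral_mul_const _ hw']
        exact ENNReal.mul_inv_le_one _
      refine (lintegral_mono h1).trans ?_
      simp
    · refine Measurable.aemeasurable ?_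
      exact (hw.comp (by fun_prop : Measurable fun p : ℝ × ℝ => p.2 - p.1)).mul
        (hZ.comp measurable_snd).inv

omit hf in
-- Translating the anecdotes by γ - γ' exchanges the roles of the true state 0 and the posterior
-- draw γ - γ', while the signal noise becomes γ'. Lebesgue measure on ℝⁿ does not notice.
theorem lintegral_shift_eq {β : Measure ℝ} [SFinite β] {Ψ : (Fin n → ℝ) → ENNReal}
    {w Z : (Fin n → ℝ) → ℝ → ENNReal} (hΨ : Measurable Ψ)
    (hw : Measurable fun p : (Fin n → ℝ) × ℝ => w p.1 p.2)
    (hZ : Measurable fun p : (Fin n → ℝ) × ℝ => Z p.1 p.2)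
    (hws : ∀ x t θ, w (x + fun _ => t) θ = w x (θ - t))
    (hZs : ∀ x y t, Z (x + fun _ => t) y = Z x (y - t)) (γ : ℝ) :
    ∫⁻ x, w x 0 * ((∫⁻ γ', Ψ (x - fun _ => γ - γ') * w x (γ - γ') ∂β) * (Z x γ)⁻¹) =
      ∫⁻ x, w x 0 * Ψ x * ∫⁻ γ', w x (γ' - γ) * (Z x γ')⁻¹ ∂β := by
  have m1 : Measurable fun q : (Fin n → ℝ) × ℝ => Ψ (q.1 - fun _ => γ - q.2) :=
    hΨ.comp (by fun_prop : Measurable fun q : (Fin n → ℝ) × ℝ => q.1 - fun _ => γ - q.2)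
  have m2 : Measurable fun q : (Fin n → ℝ) × ℝ => w q.1 (γ - q.2) :=
    hw.comp (by fun_prop : Measurable fun q : (Fin n → ℝ) × ℝ => (q.1, γ - q.2))
  have m3 : Measurable fun q : (Fin n → ℝ) × ℝ => Z q.1 γ :=
    hZ.comp (by fun_prop : Measurable fun q : (Fin n → ℝ) × ℝ => (q.1, γ))
  have m4 : Measurable fun q : (Fin n → ℝ) × ℝ => w q.1 0 :=
    hw.comp (by fun_prop : Measurable fun q : (Fin n → ℝ) × ℝ => (q.1, (0 : ℝ)))
  have m5 : Measurable fun q : (Fin n → ℝ) × ℝ => w q.1 (q.2 - γ) :=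
    hw.comp (by fun_prop : Measurable fun q : (Fin n → ℝ) × ℝ => (q.1, q.2 - γ))
  have m6 : Measurable fun q : (Fin n → ℝ) × ℝ => Ψ q.1 := hΨ.comp measurable_fst
  have m7 : Measurable fun q : (Fin n → ℝ) × ℝ => w q.1 0 * (Ψ (q.1 - fun _ => γ - q.2) *
      w q.1 (γ - q.2) * (Z q.1 γ)⁻¹) := m4.mul ((m1.mul m2).mul m3.inv)
  have m8 : Measurable fun q : (Fin n → ℝ) × ℝ => w q.1 (q.2 - γ) * (Z q.1 q.2)⁻¹ :=
    m5.mul hZ.inv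
  have m9 : Measurable fun q : (Fin n → ℝ) × ℝ =>
      w q.1 0 * Ψ q.1 * (w q.1 (q.2 - γ) * (Z q.1 q.2)⁻¹) := (m4.mul m6).mul m8
  have e1 : ∀ x : Fin n → ℝ,
      w x 0 * ((∫⁻ γ', Ψ (x - fun _ => γ - γ') * w x (γ - γ') ∂β) * (Z x γ)⁻¹) =
      ∫⁻ γ', w x 0 * (Ψ (x - fun _ => γ - γ') * w x (γ - γ') * (Z x γ)⁻¹) ∂β := fun x => by
    have n1 : Measurable fun γ' : ℝ => Ψ (x - fun _ => γ - γ') * w x (γ - γ') :=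
      (m1.mul m2).comp measurable_prodMk_left
    rw [← lintegral_mul_const _ n1, ← lintegral_const_mul _ (n1.mul_const _)]
  have e2 : ∀ γ', ∫⁻ x : Fin n → ℝ, w x 0 * (Ψ (x - fun _ => γ - γ') * w x (γ - γ') * (Z x γ)⁻¹) =
      ∫⁻ x : Fin n → ℝ, w x 0 * Ψ x * (w x (γ' - γ) * (Z x γ')⁻¹) := fun γ' => by
    rw [← lintegral_add_right_eq_self _ (fun _ : Fin n => γ - γ')]
    refine lintegral_congr fun x => ?_
    rw [hws, hws, hZs, add_sub_cancel_right, sub_self, zero_sub, neg_sub, sub_sub_cancel]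
    ring
  rw [lintegral_congr e1, lintegral_lintegral_swap m7.aemeasurable, lintegral_congr e2,
    ← lintegral_lintegral_swap (f := fun x γ' => w x 0 * Ψ x * (w x (γ' - γ) * (Z x γ')⁻¹))
      m9.aemeasurable]
  refine lintegral_congr fun x => ?_
  rw [lintegral_const_mul]
  exact m8.comp measurable_prodMk_left

/-- Drawing a state from the posterior and centering the anecdotes at it reproduces their law. -/
theorem lintegral_posterior_shift_le {Ψ : (Fin n → ℝ) → ENNReal} (hΨ : Measurable Ψ) :
    ∫⁻ p, (∫⁻ γ, Ψ (p.1 - fun _ => p.2 - γ) * weight f p.1 (p.2 - γ) ∂S.base) *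
      (weightSum f S p.1 p.2)⁻¹ ∂noise f S n ≤
      ∫⁻ x, Ψ x ∂Measure.pi fun _ : Fin n => noiseLaw f := by
  have := hf.isProbabilityMeasure
  have hw := measurable_weight (n := n) hf
  have hZ := measurable_weightSum (n := n) hf S
  have hw0 : Measurable fun x : Fin n → ℝ => weight f x 0 :=
    hw.comp (by fun_prop : Measurable fun x : Fin n → ℝ => (x, (0 : ℝ)))
  have hΨs : Measurable fun q : ((Fin n → ℝ) × ℝ) × ℝ => Ψ (q.1.1 - fun _ => q.1.2 - q.2) :=
    hΨ.comp (by fun_prop)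
  have hws : Measurable fun q : ((Fin n → ℝ) × ℝ) × ℝ => weight f q.1.1 (q.1.2 - q.2) :=
    hw.comp (by fun_prop : Measurable fun q : ((Fin n → ℝ) × ℝ) × ℝ => (q.1.1, q.1.2 - q.2))
  have hin : Measurable fun p : (Fin n → ℝ) × ℝ =>
      ∫⁻ γ, Ψ (p.1 - fun _ => p.2 - γ) * weight f p.1 (p.2 - γ) ∂S.base :=
    (hΨs.mul hws).lintegral_prod_right' (ν := S.base)
  have hall : Measurable fun p : (Fin n → ℝ) × ℝ =>
      (∫⁻ γ, Ψ (p.1 - fun _ => p.2 - γ) * weight f p.1 (p.2 - γ) ∂S.base) *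
        (weightSum f S p.1 p.2)⁻¹ := hin.mul hZ.inv
  rw [noise, lintegral_prod_symm' _ hall]
  have hpi : ∀ φ : (Fin n → ℝ) → ENNReal, Measurable φ →
      ∫⁻ x, φ x ∂Measure.pi (fun _ : Fin n => noiseLaw f) = ∫⁻ x, weight f x 0 * φ x := fun φ hφ => by
    rw [pi_noiseLaw_eq_withDensity hf]
    exact lintegral_withDensity_eq_lintegral_mul _ hw0 hφ
  have step : ∀ γ, ∫⁻ x, (∫⁻ γ', Ψ (x - fun _ => γ - γ') * weight f x (γ - γ') ∂S.base) *
      (weightSum f S x γ)⁻¹ ∂Measure.pi (fun _ : Fin n => noiseLaw f) =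
      ∫⁻ x, weight f x 0 * Ψ x * ∫⁻ γ', weight f x (γ' - γ) * (weightSum f S x γ')⁻¹ ∂S.base :=
    fun γ => by
      have hm : Measurable fun x : Fin n → ℝ => (x, γ) := by fun_prop
      refine (hpi _ (hall.comp hm)).trans ?_
      exact lintegral_shift_eq hΨ hw hZ weight_add (weightSum_add S) γ
  simp only [step]
  rw [lintegral_lintegral_swap]
  · rw [hpi Ψ hΨ]
    refine lintegral_mono fun x => ?_
    simp only
    rw [lintegral_const_mul]
    · exact mul_le_of_le_one_right' (lintegral_weight_div_weightSum_le hf S x)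
    · have h : Measurable fun q : ℝ × ℝ => weight f x (q.2 - q.1) * (weightSum f S x q.2)⁻¹ :=
        (hw.comp (by fun_prop : Measurable fun q : ℝ × ℝ => (x, q.2 - q.1))).mul
          (hZ.comp (by fun_prop : Measurable fun q : ℝ × ℝ => (x, q.2))).inv
      exact h.lintegral_prod_right'
  · refine Measurable.aemeasurable ?_
    have h : Measurable fun q : (ℝ × (Fin n → ℝ)) × ℝ =>
        weight f q.1.2 (q.2 - q.1.1) * (weightSum f S q.1.2 q.2)⁻¹ :=
      (hw.comp (by fun_prop : Measurable
        fun q : (ℝ × (Fin n → ℝ)) × ℝ => (q.1.2, q.2 - q.1.1))).mul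
        (hZ.comp (by fun_prop : Measurable fun q : (ℝ × (Fin n → ℝ)) × ℝ => (q.1.2, q.2))).inv
    exact ((hw0.comp measurable_snd).mul (hΨ.comp measurable_snd)).mul
      (h.lintegral_prod_right' (ν := S.base))

/-- The exponential rate per anecdote is l = 2√n/n, with n l² = 4, so the quadratic bound on the
logarithm of the moment generating function gives exp(4K) for every n. For n ≥ 16 this rate is at
most 1/2, and the absolute value costs a factor 2. -/
theorem lintegral_exp_mean_le : ∃ C : ℝ, 0 < C ∧ ∀ n : ℕ, 16 ≤ n →
    ∫⁻ x, ENNReal.ofReal (Real.exp (2 * √n * |(∑ i, x i) / n|))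
      ∂Measure.pi (fun _ : Fin n => noiseLaw f) ≤ ENNReal.ofReal C := by
  have := hf.isProbabilityMeasure
  obtain ⟨K, hK, hmgf⟩ := hf.exists_mgf_le
  refine ⟨2 * Real.exp (4 * K), by positivity, fun n hn => ?_⟩
  have hn0 : (0 : ℝ) < n := by exact_mod_cast (by omega : 0 < n)
  have hs : 4 ≤ √(n : ℝ) := Real.le_sqrt_of_sq_le (by norm_num; exact_mod_cast hn)
  have hss : √(n : ℝ) * √n = n := Real.mul_self_sqrt hn0.le
  set l : ℝ := 2 * √n / n with hl
  have hl2 : n * l ^ 2 = 4 := by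
    rw [hl, div_pow, mul_pow, sq √(n : ℝ), hss]; field_simp; norm_num
  have hl1 : |l| ≤ 1 / 2 := by
    rw [hl, abs_of_nonneg (by positivity), div_le_iff₀ hn0]; nlinarith
  have hI : ∀ a : ℝ, |a| ≤ 1 / 2 → Integrable (fun x : Fin n → ℝ => ∏ i, Real.exp (a * x i))
      (Measure.pi fun _ : Fin n => noiseLaw f) := fun a ha =>
    Integrable.fintype_prod fun _ => hf.integrable_exp_mul ha
  have hM : ∀ a : ℝ, |a| ≤ 1 / 2 → a ^ 2 = l ^ 2 → ∫ x : Fin n → ℝ, ∏ i, Real.exp (a * x i)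
      ∂(Measure.pi fun _ : Fin n => noiseLaw f) ≤ Real.exp (4 * K) := fun a ha ha2 => by
    rw [integral_fintype_prod_eq_pow (fun z => Real.exp (a * z)), Fintype.card_fin]
    refine (pow_le_pow_left₀ (integral_nonneg fun z => (Real.exp_pos _).le) (hmgf a ha) n).trans ?_
    rw [← Real.exp_nat_mul, ha2, Real.exp_le_exp]
    linear_combination K * hl2
  have hl' : |-l| ≤ 1 / 2 := by rwa [abs_neg]
  have hle : ∀ x : Fin n → ℝ, Real.exp (2 * √n * |(∑ i, x i) / n|) ≤
      (∏ i, Real.exp (l * x i)) + ∏ i, Real.exp (-l * x i) := fun x => by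
    rw [← Real.exp_sum, ← Real.exp_sum, ← Finset.mul_sum, ← Finset.mul_sum]
    have e : 2 * √n * |(∑ i, x i) / n| = |l * ∑ i, x i| := by
      rw [hl, abs_mul, abs_div, abs_of_nonneg hn0.le, abs_of_nonneg (by positivity : 0 ≤ 2 * √(n : ℝ) / n)]; ring
    rw [e, neg_mul]
    rcases abs_choice (l * ∑ i, x i) with h | h <;> rw [h]
    · linarith [Real.exp_pos (-(l * ∑ i, x i))]
    · linarith [Real.exp_pos (l * ∑ i, x i)]
  refine (lintegral_mono fun x => ENNReal.ofReal_le_ofReal (hle x)).trans ?_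
  have hsum : Integrable (fun x : Fin n → ℝ => (∏ i, Real.exp (l * x i)) +
      ∏ i, Real.exp (-l * x i)) (Measure.pi fun _ : Fin n => noiseLaw f) :=
    (hI l hl1).add (hI (-l) hl')
  rw [← ofReal_integral_eq_lintegral_ofReal hsum
    (ae_of_all _ fun x => by positivity)]
  refine ENNReal.ofReal_le_ofReal ?_
  rw [integral_add (hI l hl1) (hI (-l) hl')]
  linarith [hM l hl1 rfl, hM (-l) hl' (neg_sq l)]

/-- The posterior spread is of order `1 / √n`, with exponential tails. -/
theorem lintegral_post_exp_le : ∃ C : ℝ, 0 < C ∧ ∀ (S : SideInfo) (n : ℕ), 16 ≤ n →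
    ∫⁻ p, ENNReal.ofReal (post f S p.1 p.2 fun θ => Real.exp (√n * |θ|)) ∂noise f S n ≤
      ENNReal.ofReal C := by
  have := hf.isProbabilityMeasure
  obtain ⟨C, hC, hmean⟩ := lintegral_exp_mean_le hf
  refine ⟨C, hC, fun S n hn => ?_⟩
  have hn0 : 0 < n := by omega
  have hn0' : (0 : ℝ) < n := by exact_mod_cast hn0
  have hk : √(n : ℝ) < n := by
    rw [Real.sqrt_lt' hn0']
    have : (1 : ℝ) < n := by exact_mod_cast (by omega : 1 < n)
    nlinarith
  set Ψ : (Fin n → ℝ) → ENNReal := fun x =>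
    ENNReal.ofReal (Real.exp (2 * √n * |(∑ i, x i) / n|)) with hΨ
  have hΨm : Measurable Ψ := by
    refine Measurable.ennreal_ofReal ?_
    fun_prop
  -- With m the sample mean, |θ| ≤ |m| + |m - θ|, and AM–GM separates the two exponentials at double
  -- the rate. The deviation m - θ is the sample mean of the anecdotes centred at θ, so its
  -- posterior expectation is controlled by the shift inequality.
  have hpt : ∀ p : (Fin n → ℝ) × ℝ,
      ENNReal.ofReal (post f S p.1 p.2 fun θ => Real.exp (√n * |θ|)) ≤
        ENNReal.ofReal (1 / 2) * Ψ p.1 + ENNReal.ofReal (1 / 2) *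
          ((∫⁻ γ, Ψ (p.1 - fun _ => p.2 - γ) * weight f p.1 (p.2 - γ) ∂S.base) *
            (weightSum f S p.1 p.2)⁻¹) := by
    rintro ⟨x, y⟩
    have hw : Measurable fun γ => weight f x (y - γ) :=
      (measurable_weight hf).comp (by fun_prop : Measurable fun γ : ℝ => (x, y - γ))
    have hΨs : Measurable fun γ : ℝ => Ψ (x - fun _ => y - γ) := hΨm.comp (by fun_prop)
    rw [post, ENNReal.ofReal_div_of_pos (integral_likelihood_pos hf S hn0 x y),
      ofReal_integral_eq_lintegral_ofReal (integrable_exp_likelihood hf S x y hk)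
        (ae_of_all _ fun θ => mul_nonneg (Real.exp_pos _).le (likelihood_pos hf x θ).le),
      ofReal_integral_eq_lintegral_ofReal (integrable_likelihood hf S hn0 x y)
        (ae_of_all _ fun θ => (likelihood_pos hf x θ).le), S.lintegral_belief, S.lintegral_belief,
      ENNReal.div_eq_inv_mul, mul_comm]
    have h1 : ∀ γ, ENNReal.ofReal (Real.exp (√n * |y - γ|) * likelihood f x (y - γ)) ≤
        ENNReal.ofReal (1 / 2) * (Ψ x * weight f x (y - γ)) +
          ENNReal.ofReal (1 / 2) * (Ψ (x - fun _ => y - γ) * weight f x (y - γ)) := fun γ => by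
      simp only [hΨ, weight, Pi.sub_apply]
      rw [← ENNReal.ofReal_mul (Real.exp_pos _).le, ← ENNReal.ofReal_mul (Real.exp_pos _).le,
        ← ENNReal.ofReal_mul (by norm_num), ← ENNReal.ofReal_mul (by norm_num),
        ← ENNReal.ofReal_add (by have := likelihood_pos hf x (y - γ); positivity)
          (by have := likelihood_pos hf x (y - γ); positivity)]
      refine ENNReal.ofReal_le_ofReal ?_
      have e1 : (∑ i, (x i - (y - γ))) / n = (∑ i, x i) / n - (y - γ) := by
        rw [Finset.sum_sub_distrib, Finset.sum_const, Finset.card_univ, Fintype.card_fin,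
          nsmul_eq_mul]
        field_simp
      rw [e1]
      set m := (∑ i, x i) / n
      have h2 : Real.exp (√n * |y - γ|) ≤ 1 / 2 * Real.exp (2 * √n * |m|) +
          1 / 2 * Real.exp (2 * √n * |m - (y - γ)|) := by
        have h3 : |y - γ| ≤ |m| + |m - (y - γ)| := by
          have := abs_sub m (m - (y - γ))
          simpa using this
        have h4 : Real.exp (√n * |y - γ|) ≤
            Real.exp (√n * |m|) * Real.exp (√n * |m - (y - γ)|) := by
          rw [← Real.exp_add, Real.exp_le_exp, ← mul_add]
          exact mul_le_mul_of_nonneg_left h3 (Real.sqrt_nonneg _)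
        have e2 : ∀ a : ℝ, Real.exp (2 * √n * a) = Real.exp (√n * a) ^ 2 := fun a => by
          rw [← Real.exp_nat_mul]; congr 1; push_cast; ring
        rw [e2, e2]
        nlinarith [sq_nonneg (Real.exp (√n * |m|) - Real.exp (√n * |m - (y - γ)|))]
      have h5 := mul_le_mul_of_nonneg_right h2 (likelihood_pos hf x (y - γ)).le
      linarith
    have hΨw : Measurable fun γ : ℝ => Ψ (x - fun _ => y - γ) * weight f x (y - γ) := hΨs.mul hw
    refine (mul_le_mul_left (lintegral_mono h1) _).trans ?_
    rw [lintegral_add_left ((hw.const_mul _).const_mul _), lintegral_const_mul _ (hw.const_mul _),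
      lintegral_const_mul _ hw, lintegral_const_mul _ hΨw, add_mul]
    refine add_le_add ?_ (le_of_eq ?_)
    · rw [mul_assoc, mul_assoc]
      refine mul_le_mul_right (mul_le_of_le_one_right' ?_) _
      exact ENNReal.mul_inv_le_one _
    · rw [mul_assoc]; rfl
  refine (lintegral_mono hpt).trans ?_
  have hΨf : Measurable fun p : (Fin n → ℝ) × ℝ => Ψ p.1 := hΨm.comp measurable_fst
  rw [lintegral_add_left (hΨf.const_mul _), lintegral_const_mul _ hΨf,
    lintegral_const_mul' _ _ ENNReal.ofReal_ne_top]
  have h1 : ∫⁻ p : (Fin n → ℝ) × ℝ, Ψ p.1 ∂noise f S n ≤ ENNReal.ofReal C := by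
    rw [noise, lintegral_prod _ hΨf.aemeasurable]
    simpa using hmean n hn
  have h2 := (lintegral_posterior_shift_le hf S hΨm).trans (hmean n hn)
  refine (add_le_add (mul_le_mul_right h1 _) (mul_le_mul_right h2 _)).trans_eq ?_
  rw [← add_mul, ← ENNReal.ofReal_add (by norm_num) (by norm_num)]
  norm_num

end Concentration

/-! ### Resampling the anecdotes in a window -/

/-- Replace `x` by `u` if both lie in `C`. -/
def resample (C : Set ℝ) (x u : ℝ) : ℝ := by
  classical exact if x ∈ C ∧ u ∈ C then u else x

section Resample

variable {C : Set ℝ}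

theorem resample_mem_iff (x u : ℝ) : resample C x u ∈ C ↔ x ∈ C := by
  unfold resample
  split_ifs with h <;> simp [*]

theorem resample_of_notMem {x : ℝ} (hx : x ∉ C) (u : ℝ) : resample C x u = x := by
  simp [resample, hx]

theorem resample_of_mem {x u : ℝ} (hx : x ∈ C) (hu : u ∈ C) : resample C x u = u := by
  simp [resample, hx, hu]

theorem measurable_resample (hC : MeasurableSet C) :
    Measurable fun q : ℝ × ℝ => resample C q.1 q.2 := by
  classical
  unfold resample
  exact Measurable.ite ((measurable_fst hC).inter (measurable_snd hC)) measurable_snd measurable_fst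

/-- Redrawing a point of C from the conditional law on C replaces the part of `P` on C by itself.
The test `u ∈ C` in `resample` is redundant almost surely, but makes membership in C invariant for
every outcome, so counts and collapsed configurations are preserved exactly. -/
theorem measurePreserving_resample {P : Measure ℝ} [IsProbabilityMeasure P] (hC : MeasurableSet C)
    (hPC : P C ≠ 0) : MeasurePreserving (fun q : ℝ × ℝ => resample C q.1 q.2)
      (P.prod (ProbabilityTheory.cond P C)) P := by
  have := ProbabilityTheory.cond_isProbabilityMeasure hPC
  refine ⟨measurable_resample hC, Measure.ext fun E hE => ?_⟩
  rw [Measure.map_apply (measurable_resample hC) hE,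
    Measure.prod_apply (measurable_resample hC hE)]
  have hCC : ProbabilityTheory.cond P C C = 1 := by
    rw [ProbabilityTheory.cond_apply hC, Set.inter_self, ENNReal.inv_mul_cancel hPC
      (measure_ne_top _ _)]
  have hae : ∀ᵐ u ∂ProbabilityTheory.cond P C, u ∈ C := by
    exact (mem_ae_iff_prob_eq_one hC).2 hCC
  have h1 : ∀ x, ProbabilityTheory.cond P C
      (Prod.mk x ⁻¹' ((fun q : ℝ × ℝ => resample C q.1 q.2) ⁻¹' E)) =
      C.indicator (fun _ => ProbabilityTheory.cond P C E) x + (Cᶜ ∩ E).indicator 1 x := by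
    intro x
    by_cases hx : x ∈ C
    · rw [Set.indicator_of_mem hx, Set.indicator_of_notMem (fun h => h.1 hx), add_zero]
      refine measure_congr ?_
      filter_upwards [hae] with u hu
      refine propext ?_
      change resample C x u ∈ E ↔ u ∈ E
      rw [resample_of_mem hx hu]
    · rw [Set.indicator_of_notMem hx, zero_add]
      have h2 : Prod.mk x ⁻¹' ((fun q : ℝ × ℝ => resample C q.1 q.2) ⁻¹' E) = {_u | x ∈ E} := by
        ext u
        simp only [Set.mem_preimage, resample_of_notMem hx, Set.mem_ofPred_eq]
      rw [h2]
      by_cases hxE : x ∈ E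
      · simp [hx, hxE]
      · simp [hxE]
  simp only [h1]
  rw [lintegral_add_left (measurable_const.indicator hC), lintegral_indicator_const hC,
    lintegral_indicator_one (hC.compl.inter hE), ProbabilityTheory.cond_apply hC,
    mul_right_comm, ENNReal.inv_mul_cancel hPC (measure_ne_top _ _), one_mul, Set.inter_comm C E,
    Set.inter_comm Cᶜ E]
  exact measure_inter_add_sdiff E hC

variable {n : ℕ}

theorem measurePreserving_resample_pi {P : Measure ℝ} [IsProbabilityMeasure P]
    (hC : MeasurableSet C) (hPC : P C ≠ 0) :
    MeasurePreserving (fun (q : (Fin n → ℝ) × (Fin n → ℝ)) i => resample C (q.1 i) (q.2 i))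
      ((Measure.pi fun _ => P).prod (Measure.pi fun _ => ProbabilityTheory.cond P C))
      (Measure.pi fun _ => P) := by
  have := ProbabilityTheory.cond_isProbabilityMeasure hPC
  exact (measurePreserving_pi (fun _ : Fin n => P.prod (ProbabilityTheory.cond P C)) (fun _ => P)
    fun _ => measurePreserving_resample hC hPC).comp
      (measurePreserving_arrowProdEquivProdArrow ℝ ℝ (Fin n) (fun _ => P)
        fun _ => ProbabilityTheory.cond P C).symm

theorem count_resample (x u : Fin n → ℝ) :
    count C (fun i => resample C (x i) (u i)) = count C x := by
  classical
  simp only [count, resample_mem_iff]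

theorem collapse_resample (c : ℝ) (x u : Fin n → ℝ) :
    collapse C c (fun i => resample C (x i) (u i)) = collapse C c x := by
  classical
  funext i
  by_cases hx : x i ∈ C
  · simp only [collapse, resample_mem_iff, hx, if_true]
  · simp only [collapse, hx, if_false, resample_of_notMem hx]

theorem measurable_count (hC : MeasurableSet C) : Measurable fun x : Fin n → ℝ => count C x := by
  classical
  simp only [count, Finset.card_filter]
  exact Finset.measurable_sum _ fun i _ =>
    Measurable.ite (measurable_pi_apply i hC) measurable_const measurable_const

theorem pi_forall_mem_eq {ν : Measure ℝ} [IsProbabilityMeasure ν] (x : Fin n → ℝ) (B : Set ℝ) :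
    Measure.pi (fun _ : Fin n => ν) {u | ∀ i, x i ∈ C → u i ∈ B} = ν B ^ count C x := by
  classical
  have h : {u : Fin n → ℝ | ∀ i, x i ∈ C → u i ∈ B} =
      Set.univ.pi fun i => if x i ∈ C then B else Set.univ := by
    ext u
    simp only [Set.mem_ofPred_eq, Set.mem_univ_pi]
    refine forall_congr' fun i => ?_
    split_ifs with hi <;> simp [hi]
  rw [h, Measure.pi_pi]
  have h2 : ∀ i, ν (if x i ∈ C then B else Set.univ) = if x i ∈ C then ν B else 1 := fun i => by
    split_ifs <;> simp
  simp only [h2]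
  rw [Finset.prod_ite, Finset.prod_const, Finset.prod_const_one, mul_one, count]

/-- The outcomes at which no anecdote is within `t` of the target `A`. -/
def gapSet (A : (Fin n → ℝ) → ℝ) (t : ℝ) : Set (Fin n → ℝ) := {x | ∀ i, t < |x i - A x|}

theorem measurableSet_gapSet {A : (Fin n → ℝ) → ℝ} (hA : Measurable A) (t : ℝ) :
    MeasurableSet (gapSet A t) := by
  rw [gapSet, Set.ofPred_forall]
  refine MeasurableSet.iInter fun i => measurableSet_lt measurable_const ?_
  exact ((measurable_pi_apply i).sub hA).abs

variable {P : Measure ℝ} [IsProbabilityMeasure P] {A : (Fin n → ℝ) → ℝ} {G : Set (Fin n → ℝ)}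
  {M : Set ℕ} {c h ρ t : ℝ} {e : ENNReal}

/-- Redraw the anecdotes in the window. The target a of the collapsed configuration is unaffected
and within ρ of the actual target, so a gap above t forces every redrawn anecdote out of the ball of
radius t - ρ around a. Given the frozen data, this has probability at most e. The window has radius
2h, while the target is within h of c and t ≤ h, so this ball stays inside the window. -/
theorem pi_gapSet_inter_le (hA : Measurable A) (hG : MeasurableSet G)
    (hP : P (Metric.ball c (2 * h)) ≠ 0) (hth : t ≤ h)
    (hsens : ∀ x ∈ G, count (Metric.ball c (2 * h)) x ∈ M →
      |A x - A (collapse (Metric.ball c (2 * h)) c x)| ≤ ρ)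
    (he : ∀ a, |a - c| < h + ρ → ∀ m ∈ M,
      ProbabilityTheory.cond P (Metric.ball c (2 * h)) (Metric.closedBall a (t - ρ))ᶜ ^ m ≤ e) :
    Measure.pi (fun _ => P) (gapSet A t ∩ {x | |A x - c| < h}) ≤
      e * (Measure.pi (fun _ => P) {x | |A x - c| < h + 2 * ρ} + Measure.pi (fun _ => P) Gᶜ) +
        (Measure.pi (fun _ => P) {x : Fin n → ℝ | count (Metric.ball c (2 * h)) x ∉ M} +
          Measure.pi (fun _ => P) Gᶜ) := by
  set C := Metric.ball c (2 * h) with hCdef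
  have hC : MeasurableSet C := Metric.isOpen_ball.measurableSet
  have := ProbabilityTheory.cond_isProbabilityMeasure hP
  set E := gapSet A t ∩ {x | |A x - c| < h} ∩ ({x | count C x ∈ M} ∩ G) with hE
  have hEm : MeasurableSet E :=
    ((measurableSet_gapSet hA t).inter
      (measurableSet_lt (hA.sub measurable_const).abs measurable_const)).inter
      ((measurable_count hC (MeasurableSet.of_discrete (s := M))).inter hG)
  have hsub : gapSet A t ∩ {x | |A x - c| < h} ⊆ E ∪ ({x | count C x ∉ M} ∪ Gᶜ) := by
    intro x hx
    by_cases h1 : count C x ∈ M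
    · by_cases h2 : x ∈ G
      · exact Or.inl ⟨hx, h1, h2⟩
      · exact Or.inr (Or.inr h2)
    · exact Or.inr (Or.inl h1)
  refine (measure_mono hsub).trans ((measure_union_le _ _).trans
    (add_le_add ?_ (measure_union_le _ _)))
  have hmp := measurePreserving_resample_pi (n := n) hC hP
  rw [← hmp.measure_preimage hEm.nullMeasurableSet, Measure.prod_apply (hmp.measurable hEm)]
  set D : Set (Fin n → ℝ) := {x | |A (collapse C c x) - c| < h + ρ ∧ count C x ∈ M} with hD
  have hpt : ∀ x, Measure.pi (fun _ : Fin n => ProbabilityTheory.cond P C) (Prod.mk x ⁻¹'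
      ((fun (q : (Fin n → ℝ) × (Fin n → ℝ)) i => resample C (q.1 i) (q.2 i)) ⁻¹' E)) ≤
      D.indicator (fun _ => e) x := by
    intro x
    have key : ∀ u : Fin n → ℝ, (fun i => resample C (x i) (u i)) ∈ E → x ∈ D ∧
        ∀ i, x i ∈ C → u i ∈ (Metric.closedBall (A (collapse C c x)) (t - ρ))ᶜ := by
      rintro u ⟨⟨hgap, hc⟩, hm, hg⟩
      have hs := hsens _ hg hm
      rw [collapse_resample] at hs
      simp only [Set.mem_ofPred_eq, count_resample] at hm hc
      set x' : Fin n → ℝ := fun i => resample C (x i) (u i) with hx'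
      have hd : |A (collapse C c x) - c| < h + ρ := by
        have := abs_sub_le (A (collapse C c x)) (A x') c
        rw [abs_sub_comm (A x')] at hs
        linarith
      refine ⟨⟨hd, hm⟩, fun i hi hu => ?_⟩
      rw [Metric.mem_closedBall, Real.dist_eq] at hu
      have hui : u i ∈ C := by
        rw [hCdef, Metric.mem_ball, Real.dist_eq]
        have := abs_sub_le (u i) (A (collapse C c x)) c
        linarith
      have h1 : t < |x' i - A x'| := hgap i
      rw [hx'] at h1
      simp only [resample_of_mem hi hui] at h1
      have := abs_sub_le (u i) (A (collapse C c x)) (A x')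
      rw [abs_sub_comm (A x')] at hs
      linarith
    by_cases hx : x ∈ D
    · rw [Set.indicator_of_mem hx]
      refine (measure_mono (t := {u : Fin n → ℝ | ∀ i, x i ∈ C →
        u i ∈ (Metric.closedBall (A (collapse C c x)) (t - ρ))ᶜ})
        (fun u hu => (key u hu).2)).trans ?_
      rw [pi_forall_mem_eq]
      exact he _ hx.1 _ hx.2
    · rw [Set.indicator_of_notMem hx]
      refine le_of_eq (measure_mono_null (fun u hu => ?_) (measure_empty))
      exact hx (key u hu).1
  refine (lintegral_mono hpt).trans ((lintegral_indicator_const_le _ _).trans ?_)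
  refine mul_le_mul_right ((measure_mono (t := {x | |A x - c| < h + 2 * ρ} ∪ Gᶜ) ?_).trans
    (measure_union_le _ _)) _
  rintro x ⟨hx, hm⟩
  by_cases hg : x ∈ G
  · left
    have h1 := hsens x hg hm
    have h2 := abs_sub_le (A x) (A (collapse C c x)) c
    simp only [Set.mem_ofPred_eq]
    linarith
  · exact Or.inr hg

/-- If the redrawn anecdotes avoid the ball of radius t + ρ around the collapsed target, the gap
exceeds t: anecdotes outside the window are farther than h ≥ t from a target within h of c. Starting
from the smaller window h - 2ρ guarantees that the target is still within h of c after redrawing. -/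
theorem le_pi_gapSet_inter (hA : Measurable A) (hG : MeasurableSet G)
    (hP : P (Metric.ball c (2 * h)) ≠ 0) (hth : t ≤ h) (he1 : e ≤ 1)
    (hsens : ∀ x ∈ G, count (Metric.ball c (2 * h)) x ∈ M →
      |A x - A (collapse (Metric.ball c (2 * h)) c x)| ≤ ρ)
    (he : ∀ a, |a - c| < h → ∀ m ∈ M, e ≤
      ProbabilityTheory.cond P (Metric.ball c (2 * h)) (Metric.closedBall a (t + ρ))ᶜ ^ m) :
    e * Measure.pi (fun _ => P) ({x | |A x - c| < h - 2 * ρ} ∩ G) ≤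
      Measure.pi (fun _ => P) (gapSet A t ∩ {x | |A x - c| < h}) +
        (Measure.pi (fun _ => P) {x : Fin n → ℝ | count (Metric.ball c (2 * h)) x ∉ M} +
          Measure.pi (fun _ => P) Gᶜ) := by
  set C := Metric.ball c (2 * h) with hCdef
  have hC : MeasurableSet C := Metric.isOpen_ball.measurableSet
  have := ProbabilityTheory.cond_isProbabilityMeasure hP
  have hCM : MeasurableSet {x : Fin n → ℝ | count C x ∈ M} :=
    measurable_count hC (MeasurableSet.of_discrete (s := M))
  have hE1 : MeasurableSet (gapSet A t ∩ {x | |A x - c| < h}) :=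
    (measurableSet_gapSet hA t).inter
      (measurableSet_lt (hA.sub measurable_const).abs measurable_const)
  set D : Set (Fin n → ℝ) := {x | |A x - c| < h - 2 * ρ} ∩ G ∩ {x | count C x ∈ M} with hD
  have hDm : MeasurableSet D :=
    ((measurableSet_lt (hA.sub measurable_const).abs measurable_const).inter hG).inter hCM
  have main : e * Measure.pi (fun _ => P) D ≤
      Measure.pi (fun _ => P) (gapSet A t ∩ {x | |A x - c| < h} ∪ Gᶜ) := by
    have hmp := measurePreserving_resample_pi (n := n) hC hP
    rw [← hmp.measure_preimage (hE1.union hG.compl).nullMeasurableSet,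
      Measure.prod_apply (hmp.measurable (hE1.union hG.compl)), ← lintegral_indicator_const hDm]
    refine lintegral_mono fun x => ?_
    by_cases hx : x ∈ D
    swap
    · rw [Set.indicator_of_notMem hx]; exact zero_le
    rw [Set.indicator_of_mem hx]
    obtain ⟨⟨hxc, hxg⟩, hxm⟩ := hx
    have hs := hsens x hxg hxm
    set a := A (collapse C c x) with ha
    have hac : |a - c| < h - ρ := by
      have h1 := abs_sub_le a (A x) c
      rw [abs_sub_comm] at hs
      have hxc' : |A x - c| < h - 2 * ρ := hxc
      linarith
    have hρ : 0 ≤ ρ := (abs_nonneg _).trans hs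
    have h1 : e ≤ Measure.pi (fun _ : Fin n => ProbabilityTheory.cond P C)
        {u | ∀ i, x i ∈ C → u i ∈ C ∩ (Metric.closedBall a (t + ρ))ᶜ} := by
      rw [pi_forall_mem_eq, ProbabilityTheory.cond_inter_self hC]
      exact he a (by linarith) _ hxm
    refine h1.trans (measure_mono fun u hu => ?_)
    change (fun i => resample C (x i) (u i)) ∈ gapSet A t ∩ {x | |A x - c| < h} ∪ Gᶜ
    set x' : Fin n → ℝ := fun i => resample C (x i) (u i) with hx'
    by_cases hg : x' ∈ G
    swap
    · exact Or.inr hg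
    left
    have hs' := hsens x' hg (by rw [hx', count_resample]; exact hxm)
    have hcol : collapse C c x' = collapse C c x := collapse_resample c x u
    rw [hcol, ← ha] at hs'
    have hxc' : |A x' - c| < h := by
      have := abs_sub_le (A x') a c
      linarith
    refine ⟨fun i => ?_, hxc'⟩
    by_cases hi : x i ∈ C
    · obtain ⟨hu1, hu2⟩ := hu i hi
      have e1 : x' i = u i := resample_of_mem hi hu1
      rw [Set.mem_compl_iff, Metric.mem_closedBall, Real.dist_eq, not_le] at hu2
      have := abs_sub_le (u i) (A x') a
      rw [e1]
      linarith
    · have e1 : x' i = x i := resample_of_notMem hi _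
      rw [hCdef, Metric.mem_ball, Real.dist_eq, not_lt] at hi
      have := abs_sub_le (x i) (A x') c
      rw [e1]
      linarith
  have hle : Measure.pi (fun _ => P) ({x | |A x - c| < h - 2 * ρ} ∩ G) ≤
      Measure.pi (fun _ => P) D + Measure.pi (fun _ => P) {x : Fin n → ℝ | count C x ∉ M} := by
    refine (measure_mono fun x hx => ?_).trans (measure_union_le _ _)
    by_cases hm : count C x ∈ M
    · exact Or.inl ⟨hx, hm⟩
    · exact Or.inr hm
  calc e * Measure.pi (fun _ => P) ({x | |A x - c| < h - 2 * ρ} ∩ G)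
      ≤ e * Measure.pi (fun _ => P) D +
        e * Measure.pi (fun _ => P) {x : Fin n → ℝ | count C x ∉ M} := by
          rw [← mul_add]; exact mul_le_mul_right hle _
    _ ≤ (Measure.pi (fun _ => P) (gapSet A t ∩ {x | |A x - c| < h}) +
        Measure.pi (fun _ => P) Gᶜ) +
        1 * Measure.pi (fun _ => P) {x : Fin n → ℝ | count C x ∉ M} :=
          add_le_add (main.trans (measure_union_le _ _)) (mul_le_mul_left he1 _)
    _ = _ := by rw [one_mul]; ring

end Resample

/-! ### Chernoff bounds for the number of anecdotes in a window, and the resulting void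
probabilities. -/

section Counting

variable {P : Measure ℝ} [IsProbabilityMeasure P] {C : Set ℝ} {n : ℕ}

/-- Exponential Markov inequality with exp l ≤ 1 + l + l² for |l| ≤ 1; letting l have either sign
covers both tails. -/
theorem pi_le_mul_count_le (hC : MeasurableSet C) {l K : ℝ} (hl : |l| ≤ 1) :
    (Measure.pi fun _ : Fin n => P).real {x | K ≤ l * count C x} ≤
      Real.exp (n * P.real C * (l + l ^ 2) - K) := by
  classical
  set φ : ℝ → ℝ := fun z => Real.exp (l * C.indicator 1 z) with hφ
  have hφi : Integrable φ P := by
    refine (integrable_const (Real.exp |l|)).mono' ?_ (ae_of_all _ fun z => ?_)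
    · exact (((measurable_one.indicator hC).const_mul l).exp).aestronglyMeasurable
    · rw [Real.norm_eq_abs, Real.abs_exp, Real.exp_le_exp]
      by_cases hz : z ∈ C
      · simp [hz, le_abs_self]
      · simp [hz]
  have hcount : ∀ x : Fin n → ℝ, ∏ i, φ (x i) = Real.exp (l * count C x) := fun x => by
    rw [← Real.exp_sum, ← Finset.mul_sum, count, Finset.card_filter]
    push_cast
    simp [Set.indicator_apply]
  have hint : Integrable (fun x : Fin n → ℝ => ∏ i, φ (x i)) (Measure.pi fun _ => P) :=
    Integrable.fintype_prod fun _ => hφi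
  have hone : ∫ z, φ z ∂P ≤ Real.exp (P.real C * (l + l ^ 2)) := by
    have h1 : ∀ z, φ z = 1 + C.indicator (fun _ => Real.exp l - 1) z := fun z => by
      by_cases hz : z ∈ C <;> simp [hφ, hz]
    have h2 : Integrable (C.indicator fun _ => Real.exp l - 1) P :=
      (integrable_const _).indicator hC
    simp only [h1]
    rw [integral_add (integrable_const _) h2, integral_indicator_const _ hC]
    simp only [integral_const, probReal_univ, smul_eq_mul, one_mul]
    have h3 := (abs_le.1 (Real.abs_exp_sub_one_sub_id_le hl)).2
    have h4 : P.real C * (Real.exp l - 1) ≤ P.real C * (l + l ^ 2) :=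
      mul_le_mul_of_nonneg_left (by linarith) measureReal_nonneg
    rw [add_comm]
    exact (add_le_add_left h4 1).trans (Real.add_one_le_exp _)
  have h1 := mul_meas_ge_le_integral_of_nonneg (ae_of_all _ fun x : Fin n → ℝ =>
    Finset.prod_nonneg fun i _ => (Real.exp_pos (l * C.indicator 1 (x i))).le) hint (Real.exp K)
  rw [integral_fintype_prod_eq_pow φ, Fintype.card_fin] at h1
  have h2 := pow_le_pow_left₀ (integral_nonneg fun z => (Real.exp_pos _).le) hone n
  rw [← Real.exp_nat_mul] at h2
  have h3 : {x : Fin n → ℝ | K ≤ l * count C x} ⊆ {x | Real.exp K ≤ ∏ i, φ (x i)} := fun x hx => by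
    simp only [Set.mem_ofPred_eq, hcount, Real.exp_le_exp]
    exact hx
  have h4 := measureReal_mono (μ := Measure.pi fun _ : Fin n => P) h3
  rw [Real.exp_sub, le_div_iff₀ (Real.exp_pos _), mul_comm]
  refine (mul_le_mul_of_nonneg_left h4 (Real.exp_pos _).le).trans (h1.trans (h2.trans_eq ?_))
  congr 1; ring

/-- The counts within a factor `1 ± η` of the expected one. -/
def typicalCounts (P : Measure ℝ) (C : Set ℝ) (η : ℝ) (n : ℕ) : Set ℕ :=
  {m | (1 - η) * (n * P.real C) ≤ m ∧ m ≤ (1 + η) * (n * P.real C)}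

theorem pi_count_notMem_typicalCounts_le (hC : MeasurableSet C) {η : ℝ} (hη : 0 < η) (hη1 : η ≤ 1) :
    Measure.pi (fun _ : Fin n => P) {x | count C x ∉ typicalCounts P C η n} ≤
      ENNReal.ofReal (2 * Real.exp (-(n * P.real C * η ^ 2 / 4))) := by
  -- The choices l = ±η/2 minimize l² ∓ ηl, which gives the exponent -η²/4 per expected point.
  have h1 := pi_le_mul_count_le (n := n) (P := P) hC (l := η / 2)
    (K := η / 2 * ((1 + η) * (n * P.real C))) (by rw [abs_of_pos] <;> linarith)
  have h2 := pi_le_mul_count_le (n := n) (P := P) hC (l := -(η / 2))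
    (K := -(η / 2) * ((1 - η) * (n * P.real C))) (by rw [abs_neg, abs_of_pos] <;> linarith)
  have hsub : {x : Fin n → ℝ | count C x ∉ typicalCounts P C η n} ⊆
      {x | η / 2 * ((1 + η) * (n * P.real C)) ≤ η / 2 * count C x} ∪
        {x | -(η / 2) * ((1 - η) * (n * P.real C)) ≤ -(η / 2) * count C x} := by
    intro x hx
    by_contra h
    simp only [Set.mem_union, Set.mem_ofPred_eq, not_or, not_le] at h
    refine hx ⟨?_, ?_⟩ <;> nlinarith
  rw [← ofReal_measureReal]
  refine ENNReal.ofReal_le_ofReal ((measureReal_mono hsub).trans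
    ((measureReal_union_le _ _).trans ((add_le_add h1 h2).trans_eq ?_)))
  rw [two_mul]
  congr 2 <;> ring

omit [IsProbabilityMeasure P] in
theorem cond_real_eq (hC : MeasurableSet C) (J : Set ℝ) :
    (ProbabilityTheory.cond P C).real J = P.real (C ∩ J) / P.real C := by
  rw [Measure.real, ProbabilityTheory.cond_apply hC, ENNReal.toReal_mul, ENNReal.toReal_inv,
    inv_mul_eq_div]
  rfl

/-- Here (1 - q)^m ≤ exp(-mq) with q = P(J)/P(C). A typical m is at least (1 - η) n P(C), so the
window probability cancels. -/
theorem cond_compl_pow_le (hC : MeasurableSet C) (hPC : P C ≠ 0) {J : Set ℝ} (hJ : MeasurableSet J)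
    (hJC : J ⊆ C) {η b : ℝ} (hη1 : η ≤ 1) (hb : b ≤ P.real J) {m : ℕ}
    (hm : m ∈ typicalCounts P C η n) :
    ProbabilityTheory.cond P C Jᶜ ^ m ≤ ENNReal.ofReal (Real.exp (-((1 - η) * n * b))) := by
  have := ProbabilityTheory.cond_isProbabilityMeasure hPC
  have hpc : 0 < P.real C := ENNReal.toReal_pos hPC (measure_ne_top _ _)
  have hq : (ProbabilityTheory.cond P C).real J = P.real J / P.real C := by
    rw [cond_real_eq hC, Set.inter_eq_right.2 hJC]
  rw [← ofReal_measureReal, probReal_compl_eq_one_sub hJ, hq, ← ENNReal.ofReal_pow]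
  · refine ENNReal.ofReal_le_ofReal ?_
    have h1 : 1 - P.real J / P.real C ≤ Real.exp (-(P.real J / P.real C)) := by
      have := Real.add_one_le_exp (-(P.real J / P.real C)); linarith
    have h0 : 0 ≤ 1 - P.real J / P.real C := by
      rw [← hq]; linarith [measureReal_le_one (μ := ProbabilityTheory.cond P C) (s := J)]
    refine (pow_le_pow_left₀ h0 h1 m).trans ?_
    rw [← Real.exp_nat_mul, Real.exp_le_exp]
    have h2 : (1 - η) * (n * P.real C) * (P.real J / P.real C) ≤ m * (P.real J / P.real C) :=
      mul_le_mul_of_nonneg_right hm.1 (by positivity)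
    have h3 : (1 - η) * (n * P.real C) * (P.real J / P.real C) = (1 - η) * n * P.real J := by
      field_simp
    have h4 : (1 - η) * n * b ≤ (1 - η) * n * P.real J :=
      mul_le_mul_of_nonneg_left hb (mul_nonneg (by linarith) (by positivity))
    linarith
  · rw [← hq]; linarith [measureReal_le_one (μ := ProbabilityTheory.cond P C) (s := J)]

/-- The reverse estimate uses log(1 - q) ≥ -q/(1 - q). As J fills at most a fraction η of the
window, the loss is a factor 1/(1 - η) in the exponent. -/
theorem le_cond_compl_pow (hC : MeasurableSet C) (hPC : P C ≠ 0) {J : Set ℝ} (hJ : MeasurableSet J)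
    {η b : ℝ} (hη : 0 < η) (hη1 : η < 1) (hb : P.real J ≤ b) (hbC : b ≤ η * P.real C) {m : ℕ}
    (hm : m ∈ typicalCounts P C η n) :
    ENNReal.ofReal (Real.exp (-((1 + η) / (1 - η) * n * b))) ≤
      ProbabilityTheory.cond P C Jᶜ ^ m := by
  have := ProbabilityTheory.cond_isProbabilityMeasure hPC
  have hpc : 0 < P.real C := ENNReal.toReal_pos hPC (measure_ne_top _ _)
  have hb0 : 0 ≤ b := measureReal_nonneg.trans hb
  set q := (ProbabilityTheory.cond P C).real J with hqdef
  have hq : q ≤ b / P.real C := by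
    rw [hqdef, cond_real_eq hC]
    exact div_le_div_of_nonneg_right ((measureReal_mono Set.inter_subset_right).trans hb) hpc.le
  have hbη : b / P.real C ≤ η := (div_le_iff₀ hpc).2 hbC
  have hη' : 0 < 1 - η := by linarith
  have h1q : 1 - η ≤ 1 - q := by linarith
  rw [← ofReal_measureReal, probReal_compl_eq_one_sub hJ, ← hqdef,
    ← ENNReal.ofReal_pow (by linarith)]
  refine ENNReal.ofReal_le_ofReal ?_
  have hlog : -(b / P.real C / (1 - η)) ≤ Real.log (1 - q) := by
    have h1 := Real.one_sub_inv_le_log_of_pos (x := 1 - q) (by linarith)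
    have h2 : 1 - (1 - q)⁻¹ = -(q / (1 - q)) := by
      have : (1 - q) ≠ 0 := by linarith
      field_simp; ring
    have h3 : q / (1 - q) ≤ b / P.real C / (1 - η) :=
      div_le_div₀ (by positivity) hq hη' h1q
    linarith
  rw [← Real.exp_log (by linarith : 0 < 1 - q), ← Real.exp_nat_mul, Real.exp_le_exp]
  have h1 : (m : ℝ) * -(b / P.real C / (1 - η)) ≤ m * Real.log (1 - q) :=
    mul_le_mul_of_nonneg_left hlog (by positivity)
  have h2 : (m : ℝ) * (b / P.real C / (1 - η)) ≤
      (1 + η) * (n * P.real C) * (b / P.real C / (1 - η)) :=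
    mul_le_mul_of_nonneg_right hm.2 (by positivity)
  have h3 : (1 + η) * (n * P.real C) * (b / P.real C / (1 - η)) = (1 + η) / (1 - η) * n * b := by
    field_simp
  linarith

end Counting

/-! ### Averaging over windows -/

section Windows

variable {Ω : Type*} [MeasurableSpace Ω] {Q : Measure Ω} [IsProbabilityMeasure Q] {A : Ω → ℝ}
  {E G : Set Ω} {δ r h ρ : ℝ} {e b : ENNReal}

/-- Fubini: an outcome belongs to the windows whose centre is within h of its target, a set of
length 2h. Using all centres instead of a partition lets windows of radii h and h ± 2ρ be compared
by their lengths alone, whatever the law of the target. -/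
theorem lintegral_window_eq (hA : Measurable A) (hE : MeasurableSet E) (I : Set ℝ) (h : ℝ) :
    ∫⁻ c in I, Q (E ∩ {x | |A x - c| < h}) =
      ∫⁻ x in E, volume.restrict I (Metric.ball (A x) h) ∂Q := by
  have hS : MeasurableSet {q : ℝ × Ω | q.2 ∈ E ∧ |A q.2 - q.1| < h} :=
    (measurable_snd hE).inter (measurableSet_lt
      ((hA.comp measurable_snd).sub measurable_fst).abs measurable_const)
  have h1 := Measure.prod_apply (μ := volume.restrict I) (ν := Q) hS
  have h2 := Measure.prod_apply_symm (μ := volume.restrict I) (ν := Q) hS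
  rw [h1] at h2
  refine h2.trans ?_
  rw [← lintegral_indicator hE]
  refine lintegral_congr fun x => ?_
  by_cases hx : x ∈ E
  · rw [Set.indicator_of_mem hx]
    congr 1
    ext c
    simp [hx, Real.dist_eq, abs_sub_comm]
  · rw [Set.indicator_of_notMem hx]
    convert measure_empty (μ := volume.restrict I)
    ext c
    simp [hx]

theorem lintegral_window_le (hA : Measurable A) (hE : MeasurableSet E) (I : Set ℝ) (h : ℝ) :
    ∫⁻ c in I, Q (E ∩ {x | |A x - c| < h}) ≤ ENNReal.ofReal (2 * h) * Q E := by
  rw [lintegral_window_eq hA hE]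
  refine (lintegral_mono fun x => (Measure.restrict_apply_le I _)).trans ?_
  simp [Real.volume_ball]

theorem le_lintegral_window (hA : Measurable A) (hE : MeasurableSet E)
    (hEA : ∀ x ∈ E, |A x - δ| ≤ r - h) :
    ENNReal.ofReal (2 * h) * Q E ≤
      ∫⁻ c in Set.Icc (δ - r) (δ + r), Q (E ∩ {x | |A x - c| < h}) := by
  rw [lintegral_window_eq hA hE, ← setLIntegral_const]
  refine setLIntegral_mono' hE fun x hx => ?_
  rw [Measure.restrict_apply Metric.isOpen_ball.measurableSet, Set.inter_eq_left.2, Real.volume_ball]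
  intro c hc
  rw [Metric.mem_ball, Real.dist_eq] at hc
  have h1 := abs_lt.1 hc
  have h2 := abs_le.1 (hEA x hx)
  constructor <;> linarith

theorem lintegral_Icc_const (k : ENNReal) :
    ∫⁻ _ in Set.Icc (δ - r) (δ + r), k = ENNReal.ofReal (2 * r) * k := by
  rw [setLIntegral_const, Real.volume_Icc, mul_comm]
  congr 2; ring

/-- An upper bound that holds in every window holds, up to small terms, globally. -/
theorem measure_le_of_windows (hA : Measurable A) (hE : MeasurableSet E) (hG : MeasurableSet G)
    (hh : 0 < h) (hr : 0 ≤ r) (hρ : 0 ≤ ρ) (he : e ≤ 2) (hGA : ∀ x ∈ G, |A x - δ| ≤ r - h)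
    (hwin : ∀ c ∈ Set.Icc (δ - r) (δ + r), Q (E ∩ {x | |A x - c| < h}) ≤
      e * (Q {x | |A x - c| < h + 2 * ρ} + Q Gᶜ) + (b + Q Gᶜ)) :
    Q E ≤ e * ENNReal.ofReal (1 + 2 * ρ / h) + ENNReal.ofReal (r / h) * b +
      ENNReal.ofReal (3 * r / h + 1) * Q Gᶜ := by
  have hmul : ∀ a : ℝ, 0 ≤ a → ENNReal.ofReal (2 * h) * ENNReal.ofReal (a / h) =
      ENNReal.ofReal (2 * a) := fun a ha => by
    rw [← ENNReal.ofReal_mul (by positivity)]; congr 1; field_simp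
  have hpos : ENNReal.ofReal (2 * h) ≠ 0 := by simp [hh]
  have h1 : ENNReal.ofReal (2 * h) * Q (E ∩ G) ≤
      e * (ENNReal.ofReal (2 * (h + 2 * ρ)) + ENNReal.ofReal (2 * r) * Q Gᶜ) +
        ENNReal.ofReal (2 * r) * (b + Q Gᶜ) := by
    calc ENNReal.ofReal (2 * h) * Q (E ∩ G)
        ≤ ∫⁻ c in Set.Icc (δ - r) (δ + r), Q (E ∩ G ∩ {x | |A x - c| < h}) :=
          le_lintegral_window hA (hE.inter hG) fun x hx => hGA x hx.2
      _ ≤ ∫⁻ c in Set.Icc (δ - r) (δ + r),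
          (e * (Q {x | |A x - c| < h + 2 * ρ} + Q Gᶜ) + (b + Q Gᶜ)) := by
          refine setLIntegral_mono' measurableSet_Icc fun c hc => ?_
          exact (measure_mono (Set.inter_subset_inter_left _ Set.inter_subset_left)).trans
            (hwin c hc)
      _ = e * ((∫⁻ c in Set.Icc (δ - r) (δ + r), Q {x | |A x - c| < h + 2 * ρ}) +
          ENNReal.ofReal (2 * r) * Q Gᶜ) + ENNReal.ofReal (2 * r) * (b + Q Gᶜ) := by
          rw [lintegral_add_right _ measurable_const, lintegral_const_mul' _ _ (ne_top_of_le_ne_top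
            (by simp) he), lintegral_add_right _ measurable_const, lintegral_Icc_const,
            lintegral_Icc_const]
      -- The enlarged windows have total weight at most 2(h + 2ρ); after division by 2h this is the
      -- factor 1 + 2ρ/h.
      _ ≤ _ := by
          gcongr
          have := lintegral_window_le (Q := Q) hA MeasurableSet.univ (Set.Icc (δ - r) (δ + r))
            (h + 2 * ρ)
          simpa using this
  have h2 : ENNReal.ofReal (2 * h) * Q (E ∩ G) ≤ ENNReal.ofReal (2 * h) *
      (e * ENNReal.ofReal ((h + 2 * ρ) / h) + ENNReal.ofReal (r / h) * b +
        ENNReal.ofReal (3 * r / h) * Q Gᶜ) := by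
    refine h1.trans ?_
    have e1 : ENNReal.ofReal (2 * h) *
      (e * ENNReal.ofReal ((h + 2 * ρ) / h) + ENNReal.ofReal (r / h) * b +
        ENNReal.ofReal (3 * r / h) * Q Gᶜ) =
        e * (ENNReal.ofReal (2 * h) * ENNReal.ofReal ((h + 2 * ρ) / h)) +
        (ENNReal.ofReal (2 * h) * ENNReal.ofReal (r / h)) * b +
        (ENNReal.ofReal (2 * h) * ENNReal.ofReal (3 * r / h)) * Q Gᶜ := by ring
    rw [e1, hmul _ (by positivity), hmul _ hr, hmul _ (by positivity)]
    -- Two shares of the exceptional event come from the term with e ≤ 2, the third from the error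
    -- in each window.
    have e2 : ENNReal.ofReal (2 * (3 * r)) = 2 * ENNReal.ofReal (2 * r) + ENNReal.ofReal (2 * r) := by
      rw [show 2 * (3 * r) = 2 * (2 * r) + 2 * r by ring, ENNReal.ofReal_add (by positivity)
        (by positivity), ENNReal.ofReal_mul (p := 2) (q := 2 * r) (by norm_num)]
      norm_num
    rw [e2]
    calc _ ≤ e * ENNReal.ofReal (2 * (h + 2 * ρ)) + 2 * (ENNReal.ofReal (2 * r) * Q Gᶜ) +
          ENNReal.ofReal (2 * r) * (b + Q Gᶜ) := by
            rw [mul_add]; gcongr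
      _ = _ := by ring
  have h3 := (ENNReal.mul_le_mul_iff_right hpos ENNReal.ofReal_ne_top).1 h2
  have h4 : Q E ≤ Q (E ∩ G) + Q Gᶜ := by
    refine (measure_mono fun x hx => ?_).trans (measure_union_le _ _)
    by_cases hg : x ∈ G
    · exact Or.inl ⟨hx, hg⟩
    · exact Or.inr hg
  refine h4.trans ((add_le_add_left h3 _).trans_eq ?_)
  rw [ENNReal.ofReal_add (by positivity) zero_le_one, ENNReal.ofReal_one, add_div, div_self hh.ne']
  ring

/-- A lower bound that holds in every window holds, up to small terms, globally. -/
theorem le_measure_of_windows (hA : Measurable A) (hE : MeasurableSet E) (hG : MeasurableSet G)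
    (hh : 0 < h) (hr : 0 ≤ r) (hρ : 0 ≤ ρ) (hρh : 2 * ρ ≤ h) (he : e ≤ 1)
    (hGA : ∀ x ∈ G, |A x - δ| ≤ r - h)
    (hwin : ∀ c ∈ Set.Icc (δ - r) (δ + r), e * Q ({x | |A x - c| < h - 2 * ρ} ∩ G) ≤
      Q (E ∩ {x | |A x - c| < h}) + (b + Q Gᶜ)) :
    e * ENNReal.ofReal (1 - 2 * ρ / h) ≤ Q E + ENNReal.ofReal (r / h) * b +
      ENNReal.ofReal (3 * r / h + 1) * Q Gᶜ := by
  have hmul : ∀ a : ℝ, 0 ≤ a → ENNReal.ofReal (2 * h) * ENNReal.ofReal (a / h) =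
      ENNReal.ofReal (2 * a) := fun a ha => by
    rw [← ENNReal.ofReal_mul (by positivity)]; congr 1; field_simp
  have hpos : ENNReal.ofReal (2 * h) ≠ 0 := by simp [hh]
  have h1 : e * (ENNReal.ofReal (2 * (h - 2 * ρ)) * Q G) ≤
      ENNReal.ofReal (2 * h) * Q E + ENNReal.ofReal (2 * r) * (b + Q Gᶜ) := by
    calc e * (ENNReal.ofReal (2 * (h - 2 * ρ)) * Q G)
        ≤ e * ∫⁻ c in Set.Icc (δ - r) (δ + r), Q (G ∩ {x | |A x - c| < h - 2 * ρ}) := by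
          gcongr
          exact le_lintegral_window hA hG fun x hx => (hGA x hx).trans (by linarith)
      _ = ∫⁻ c in Set.Icc (δ - r) (δ + r), e * Q ({x | |A x - c| < h - 2 * ρ} ∩ G) := by
          rw [lintegral_const_mul' _ _ (ne_top_of_le_ne_top (by simp) he)]
          simp only [Set.inter_comm]
      _ ≤ ∫⁻ c in Set.Icc (δ - r) (δ + r), (Q (E ∩ {x | |A x - c| < h}) + (b + Q Gᶜ)) :=
          setLIntegral_mono' measurableSet_Icc hwin
      _ ≤ _ := by
          rw [lintegral_add_right _ measurable_const, lintegral_Icc_const]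
          gcongr
          exact lintegral_window_le hA hE _ _
  have hGG : (1 : ENNReal) = Q G + Q Gᶜ := by rw [measure_add_measure_compl hG, measure_univ]
  have h2 : ENNReal.ofReal (2 * h) * (e * ENNReal.ofReal ((h - 2 * ρ) / h)) ≤
      ENNReal.ofReal (2 * h) * (Q E + ENNReal.ofReal (r / h) * b +
        ENNReal.ofReal (3 * r / h + 1) * Q Gᶜ) := by
    have e1 : ENNReal.ofReal (2 * h) * (e * ENNReal.ofReal ((h - 2 * ρ) / h)) =
        e * (ENNReal.ofReal (2 * (h - 2 * ρ)) * Q G) +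
          e * (ENNReal.ofReal (2 * (h - 2 * ρ)) * Q Gᶜ) := by
      rw [← mul_add, ← mul_add, ← hGG, mul_one, ← hmul (h - 2 * ρ) (by linarith)]; ring
    have e2 : ENNReal.ofReal (2 * h) * (Q E + ENNReal.ofReal (r / h) * b +
        ENNReal.ofReal (3 * r / h + 1) * Q Gᶜ) = ENNReal.ofReal (2 * h) * Q E +
        ENNReal.ofReal (2 * r) * b + ENNReal.ofReal (2 * (3 * r + h)) * Q Gᶜ := by
      rw [← hmul r hr, ← hmul (3 * r + h) (by positivity), add_div _ h h, div_self hh.ne']; ring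
    rw [e1, e2]
    calc _ ≤ (ENNReal.ofReal (2 * h) * Q E + ENNReal.ofReal (2 * r) * (b + Q Gᶜ)) +
          1 * (ENNReal.ofReal (2 * h) * Q Gᶜ) := by
            gcongr
            linarith
      _ = ENNReal.ofReal (2 * h) * Q E + ENNReal.ofReal (2 * r) * b +
          (ENNReal.ofReal (2 * r) + ENNReal.ofReal (2 * h)) * Q Gᶜ := by ring
      _ ≤ _ := by
          gcongr
          rw [← ENNReal.ofReal_add (by positivity) (by positivity)]
          exact ENNReal.ofReal_le_ofReal (by linarith)
  have h3 := (ENNReal.mul_le_mul_iff_right hpos ENNReal.ofReal_ne_top).1 h2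
  rwa [sub_div, div_self hh.ne'] at h3

end Windows

/-! ### The distance from the target to the closest anecdote -/

/-- The target of the sender, given a bias `δ`. -/
def target (f : ℝ → ℝ) (S : SideInfo) (δ : ℝ) {n : ℕ} (p : (Fin n → ℝ) × ℝ) : ℝ :=
  posteriorMean f S p.1 p.2 + δ

/-- The posterior spread around the true state `0`. -/
def spread (f : ℝ → ℝ) (S : SideInfo) {n : ℕ} (p : (Fin n → ℝ) × ℝ) : ℝ :=
  post f S p.1 p.2 fun θ => |θ| * Real.exp |θ|

theorem abs_sub_le_of_mem_ball {c z δ r h : ℝ} (hc : |c - δ| ≤ r)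
    (hz : z ∈ Metric.ball c (2 * h)) : |z - δ| ≤ r + 2 * h := by
  rw [Metric.mem_ball, Real.dist_eq] at hz
  linarith [abs_sub_le z c δ]

section Gap

variable {f : ℝ → ℝ} (hf : WellBehaved f) (S : SideInfo) {n : ℕ}
include hf

theorem WellBehaved.le_noiseLaw_real {s : Set ℝ} (hs : MeasurableSet s) (hv : volume s ≠ ⊤) {a : ℝ}
    (h : ∀ z ∈ s, a ≤ f z) : a * volume.real s ≤ (noiseLaw f).real s := by
  rw [hf.noiseLaw_real hs, mul_comm, ← smul_eq_mul, ← setIntegral_const]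
  exact setIntegral_mono_on (integrableOn_const hv) hf.integrable.integrableOn hs h

theorem WellBehaved.noiseLaw_real_le {s : Set ℝ} (hs : MeasurableSet s) (hv : volume s ≠ ⊤) {a : ℝ}
    (h : ∀ z ∈ s, f z ≤ a) : (noiseLaw f).real s ≤ a * volume.real s := by
  rw [hf.noiseLaw_real hs, mul_comm, ← smul_eq_mul, ← setIntegral_const]
  exact setIntegral_mono_on hf.integrable.integrableOn (integrableOn_const hv) hs h

theorem measurable_posteriorMean :
    Measurable fun p : (Fin n → ℝ) × ℝ => posteriorMean f S p.1 p.2 :=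
  measurable_post hf.continuous.measurable S n measurable_id

theorem measurable_target (δ : ℝ) :
    Measurable fun p : (Fin n → ℝ) × ℝ => target f S δ p :=
  (measurable_posteriorMean hf S).add_const δ

theorem measurable_spread : Measurable fun p : (Fin n → ℝ) × ℝ => spread f S p :=
  measurable_post hf.continuous.measurable S n (by fun_prop)

/-- The conditions on the parameters of the window argument: `h` is the width of the windows around
points within `r` of `δ`, `u` bounds the posterior spread, `ρ` the motion of the target. -/
structure WindowScale (f : ℝ → ℝ) (n : ℕ) (δ η r h u ρ B : ℝ) : Prop where
  eta_pos : 0 < η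
  eta_le : η ≤ 1 / 4
  h_pos : 0 < h
  u_le_one : u ≤ 1
  u_le : u ≤ r - h
  u_nonneg : 0 ≤ u
  rho_le : 2 * ρ ≤ h
  lower : ∀ z, |z - δ| ≤ r + 2 * h → (1 - η) * f δ ≤ f z
  upper : ∀ z, |z - δ| ≤ r + 2 * h → f z ≤ (1 + η) * f δ
  collapse_le : ∀ (x : Fin n → ℝ) (c θ : ℝ), |c - δ| ≤ r →
    |Real.log (likelihood f (collapse (Metric.ball c (2 * h)) c x) θ) -
      Real.log (likelihood f x θ)| ≤ B * count (Metric.ball c (2 * h)) x * (2 * h) * (1 + |θ|)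
  B_nonneg : 0 ≤ B
  -- The perturbation of the log-likelihood: at most 8 n h f(0) anecdotes lie in a typical window,
  -- each moved by less than 2h.
  tau_le : B * (16 * n * h ^ 2 * f 0) ≤ 1 / 16
  rho_eq : ρ = 24 * (B * (16 * n * h ^ 2 * f 0)) * u
  -- The motion of the target must not matter on the scale 1/n of the gap.
  n_rho_le : 2 * n * ρ * f 0 ≤ 1 / 2

variable {S} {δ η r h u ρ B : ℝ}

namespace WindowScale

variable (w : WindowScale f n δ η r h u ρ B)
include w

theorem rho_nonneg : 0 ≤ ρ := by
  have := w.B_nonneg; have := w.u_nonneg; have := hf.pos 0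
  rw [w.rho_eq]; positivity

omit hf in
theorem r_nonneg : 0 ≤ r := by linarith [w.u_le, w.u_nonneg, w.h_pos]

theorem le_window {c : ℝ} (hc : |c - δ| ≤ r) :
    (1 - η) * f δ * (4 * h) ≤ (noiseLaw f).real (Metric.ball c (2 * h)) := by
  have h1 := hf.le_noiseLaw_real (s := Metric.ball c (2 * h)) Metric.isOpen_ball.measurableSet
    measure_ball_lt_top.ne fun z hz => w.lower z (abs_sub_le_of_mem_ball hc hz)
  rw [Real.volume_real_ball (by linarith [w.h_pos])] at h1
  linarith

theorem window_le {c : ℝ} (hc : |c - δ| ≤ r) :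
    (noiseLaw f).real (Metric.ball c (2 * h)) ≤ (1 + η) * f δ * (4 * h) := by
  have h1 := hf.noiseLaw_real_le (s := Metric.ball c (2 * h)) Metric.isOpen_ball.measurableSet
    measure_ball_lt_top.ne fun z hz => w.upper z (abs_sub_le_of_mem_ball hc hz)
  rw [Real.volume_real_ball (by linarith [w.h_pos])] at h1
  linarith

theorem window_ne_zero {c : ℝ} (hc : |c - δ| ≤ r) : noiseLaw f (Metric.ball c (2 * h)) ≠ 0 := by
  intro h0
  have h1 := w.le_window hf hc
  rw [Measure.real, h0, ENNReal.toReal_zero] at h1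
  have := hf.pos δ
  have := w.h_pos
  have : 0 < 1 - η := by linarith [w.eta_le]
  have : 0 < (1 - η) * f δ * (4 * h) := by positivity
  linarith

theorem abs_target_sub_le (hn : 2 < n) {c : ℝ} (hc : |c - δ| ≤ r) (x : Fin n → ℝ) (y : ℝ)
    (hx : spread f S (x, y) ≤ u)
    (hm : count (Metric.ball c (2 * h)) x ∈
      typicalCounts (noiseLaw f) (Metric.ball c (2 * h)) η n) :
    |target f S δ (x, y) - target f S δ (collapse (Metric.ball c (2 * h)) c x, y)| ≤ ρ := by
  have hB := w.B_nonneg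
  have hh := w.h_pos
  have hη := w.eta_pos
  have hη' := w.eta_le
  have hδ := hf.pos δ
  have h0 := hf.le_zero δ
  have hcount : (count (Metric.ball c (2 * h)) x : ℝ) ≤ 8 * n * h * f 0 := by
    refine hm.2.trans ?_
    have h1 := w.window_le hf hc
    have h2 : (1 + η) * f δ * (4 * h) ≤ (1 + η) * f 0 * (4 * h) := by gcongr
    have h3 : (1 + η) * (n * (noiseLaw f).real (Metric.ball c (2 * h))) ≤
        (1 + η) * (n * ((1 + η) * f 0 * (4 * h))) := by
      gcongr
      exact h1.trans h2
    refine h3.trans ?_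
    have h4 : (1 + η) * (1 + η) ≤ 2 := by nlinarith
    have h5 : 0 ≤ n * f 0 * (4 * h) := by have := hf.pos 0; positivity
    nlinarith
  have hτ : B * count (Metric.ball c (2 * h)) x * (2 * h) ≤ B * (16 * n * h ^ 2 * f 0) := by
    have : B * count (Metric.ball c (2 * h)) x * (2 * h) ≤ B * (8 * n * h * f 0) * (2 * h) := by
      gcongr
    linarith
  have key := abs_posteriorMean_sub_le hf S hn x (collapse (Metric.ball c (2 * h)) c x) y
    (τ := B * (16 * n * h ^ 2 * f 0)) (u := u) w.tau_le w.u_le_one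
    (fun θ => (w.collapse_le x c θ hc).trans
      (mul_le_mul_of_nonneg_right hτ (by positivity))) hx
  rw [abs_sub_comm, w.rho_eq]
  simpa [target] using key

/-- The bound for the probability of an atypical number of anecdotes in a window. -/
theorem pi_count_le {c : ℝ} (hc : |c - δ| ≤ r) :
    Measure.pi (fun _ : Fin n => noiseLaw f) {x | count (Metric.ball c (2 * h)) x ∉
      typicalCounts (noiseLaw f) (Metric.ball c (2 * h)) η n} ≤
      ENNReal.ofReal (2 * Real.exp (-(n * h * f δ * η ^ 2 / 2))) := by
  have := hf.isProbabilityMeasure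
  refine (pi_count_notMem_typicalCounts_le Metric.isOpen_ball.measurableSet w.eta_pos
    (by linarith [w.eta_le])).trans (ENNReal.ofReal_le_ofReal ?_)
  have h1 := w.le_window hf hc
  have h2 : 2 * h * f δ ≤ (1 - η) * f δ * (4 * h) := by
    have : 0 ≤ h * f δ := mul_nonneg w.h_pos.le (hf.nonneg _)
    nlinarith [w.eta_le]
  have h3 : n * h * f δ * η ^ 2 / 2 ≤
      n * (noiseLaw f).real (Metric.ball c (2 * h)) * η ^ 2 / 4 := by
    have : n * (2 * h * f δ) * η ^ 2 / 4 ≤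
        n * (noiseLaw f).real (Metric.ball c (2 * h)) * η ^ 2 / 4 := by
      gcongr
      exact h2.trans h1
    linarith
  gcongr

theorem pi_gapSet_le (hn : 2 < n) (y : ℝ) {t : ℝ} (ht : 0 ≤ t) (hth : t ≤ h) :
    Measure.pi (fun _ : Fin n => noiseLaw f) (gapSet (fun x => target f S δ (x, y)) t) ≤
      ENNReal.ofReal (Real.exp (-((1 - η) * n * ((1 - η) * f δ * (2 * (t - ρ)))))) *
        ENNReal.ofReal (1 + 2 * ρ / h) +
      ENNReal.ofReal (r / h) * ENNReal.ofReal (2 * Real.exp (-(n * h * f δ * η ^ 2 / 2))) +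
      ENNReal.ofReal (3 * r / h + 1) * Measure.pi (fun _ : Fin n => noiseLaw f)
        {x | spread f S (x, y) ≤ u}ᶜ := by
  have := hf.isProbabilityMeasure
  have hA : Measurable fun x : Fin n → ℝ => target f S δ (x, y) :=
    (measurable_target hf S δ).comp measurable_prodMk_right
  have hG : MeasurableSet {x : Fin n → ℝ | spread f S (x, y) ≤ u} :=
    measurableSet_le ((measurable_spread hf S).comp measurable_prodMk_right) measurable_const
  have hρ := w.rho_nonneg hf
  have hη := w.eta_pos
  have hη' := w.eta_le
  have hδ := hf.pos δ
  refine measure_le_of_windows (δ := δ) (r := r) (h := h) hA (measurableSet_gapSet hA t) hG w.h_pos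
    w.r_nonneg hρ ?_ ?_ fun c hc => ?_
  -- For t < ρ the exponent is positive, but at most 2nρ f(0) ≤ 1/2, and exp(1/2) ≤ 2.
  · have h1 : -((1 - η) * n * ((1 - η) * f δ * (2 * (t - ρ)))) ≤ 1 / 2 := by
      have h2 : (1 - η) * (1 - η) * (n * f δ * (2 * (ρ - t))) ≤ 2 * n * ρ * f 0 := by
        have h3 : n * f δ * (2 * (ρ - t)) ≤ n * f 0 * (2 * ρ) := by
          have h4 : n * f δ * (2 * (ρ - t)) ≤ n * f δ * (2 * ρ) := by gcongr; linarith
          have h5 : n * f δ * (2 * ρ) ≤ n * f 0 * (2 * ρ) := by gcongr; exact hf.le_zero δ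
          exact h4.trans h5
        have h6 : (1 - η) * (1 - η) ≤ 1 := by nlinarith
        have h7 : 0 ≤ n * f 0 * (2 * ρ) := by have := hf.pos 0; positivity
        have h8 : 0 ≤ (1 - η) * (1 - η) := mul_self_nonneg _
        nlinarith
      linarith [w.n_rho_le]
    have h3 : Real.exp (1 / 2) ≤ 2 := by
      have := Real.exp_bound_div_one_sub_of_interval (x := 1 / 2) (by norm_num) (by norm_num)
      norm_num at this ⊢
      exact this
    refine (ENNReal.ofReal_le_ofReal ((Real.exp_le_exp.2 h1).trans h3)).trans ?_
    simp
  · intro x hx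
    have h1 := (abs_posteriorMean_le hf S hn x y).trans hx
    simp only [target, add_sub_cancel_right]
    exact h1.trans w.u_le
  · have hc' : |c - δ| ≤ r := by rw [abs_le]; constructor <;> linarith [hc.1, hc.2]
    refine (pi_gapSet_inter_le (A := fun x => target f S δ (x, y))
      (M := typicalCounts (noiseLaw f) (Metric.ball c (2 * h)) η n) hA hG
      (w.window_ne_zero hf hc') hth (fun x hx hm => w.abs_target_sub_le hf hn hc' x y hx hm)
      fun a ha m hm => ?_).trans (add_le_add le_rfl (add_le_add (w.pi_count_le hf hc') le_rfl))
    have hJC : Metric.closedBall a (t - ρ) ⊆ Metric.ball c (2 * h) := by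
      intro z hz
      rw [Metric.mem_closedBall, Real.dist_eq] at hz
      rw [Metric.mem_ball, Real.dist_eq]
      linarith [abs_sub_le z a c]
    refine cond_compl_pow_le Metric.isOpen_ball.measurableSet (w.window_ne_zero hf hc')
      Metric.isClosed_closedBall.measurableSet hJC (by linarith) ?_ hm
    -- For t < ρ the claimed lower bound on the mass of the ball is negative.
    rcases le_or_gt 0 (t - ρ) with htρ | htρ
    · have h1 := hf.le_noiseLaw_real (s := Metric.closedBall a (t - ρ))
        Metric.isClosed_closedBall.measurableSet measure_closedBall_lt_top.ne
        fun z hz => w.lower z (abs_sub_le_of_mem_ball hc' (hJC hz))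
      rwa [Real.volume_real_closedBall htρ] at h1
    · have : 0 < (1 - η) * f δ := mul_pos (by linarith) hδ
      exact le_trans (mul_nonpos_of_nonneg_of_nonpos this.le (by linarith)) measureReal_nonneg

theorem le_pi_gapSet (hn : 2 < n) (y : ℝ) {t : ℝ} (ht : 0 ≤ t) (hth : t + ρ ≤ η * h) :
    ENNReal.ofReal (Real.exp (-((1 + η) / (1 - η) * n * ((1 + η) * f δ * (2 * (t + ρ)))))) *
        ENNReal.ofReal (1 - 2 * ρ / h) ≤
      Measure.pi (fun _ : Fin n => noiseLaw f) (gapSet (fun x => target f S δ (x, y)) t) +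
      ENNReal.ofReal (r / h) * ENNReal.ofReal (2 * Real.exp (-(n * h * f δ * η ^ 2 / 2))) +
      ENNReal.ofReal (3 * r / h + 1) * Measure.pi (fun _ : Fin n => noiseLaw f)
        {x | spread f S (x, y) ≤ u}ᶜ := by
  have := hf.isProbabilityMeasure
  have hA : Measurable fun x : Fin n → ℝ => target f S δ (x, y) :=
    (measurable_target hf S δ).comp measurable_prodMk_right
  have hG : MeasurableSet {x : Fin n → ℝ | spread f S (x, y) ≤ u} :=
    measurableSet_le ((measurable_spread hf S).comp measurable_prodMk_right) measurable_const
  have hρ := w.rho_nonneg hf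
  have hη := w.eta_pos
  have hη' := w.eta_le
  have hh := w.h_pos
  have hδ := hf.pos δ
  have hth' : t + ρ ≤ h := hth.trans (by nlinarith)
  have he1 : ENNReal.ofReal
      (Real.exp (-((1 + η) / (1 - η) * n * ((1 + η) * f δ * (2 * (t + ρ)))))) ≤ 1 := by
    rw [ENNReal.ofReal_le_one, Real.exp_le_one_iff, neg_nonpos]
    have : 0 < 1 - η := by linarith
    positivity
  refine le_measure_of_windows (δ := δ) (r := r) (h := h) hA (measurableSet_gapSet hA t) hG hh
    w.r_nonneg hρ w.rho_le he1 ?_ fun c hc => ?_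
  · intro x hx
    have h1 := (abs_posteriorMean_le hf S hn x y).trans hx
    simp only [target, add_sub_cancel_right]
    exact h1.trans w.u_le
  · have hc' : |c - δ| ≤ r := by rw [abs_le]; constructor <;> linarith [hc.1, hc.2]
    refine (le_pi_gapSet_inter (A := fun x => target f S δ (x, y))
      (M := typicalCounts (noiseLaw f) (Metric.ball c (2 * h)) η n) hA hG
      (w.window_ne_zero hf hc') (by linarith) he1
      (fun x hx hm => w.abs_target_sub_le hf hn hc' x y hx hm)
      fun a ha m hm => ?_).trans (add_le_add le_rfl (add_le_add (w.pi_count_le hf hc') le_rfl))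
    have hJC : Metric.closedBall a (t + ρ) ⊆ Metric.ball c (2 * h) := by
      intro z hz
      rw [Metric.mem_closedBall, Real.dist_eq] at hz
      rw [Metric.mem_ball, Real.dist_eq]
      linarith [abs_sub_le z a c]
    refine le_cond_compl_pow Metric.isOpen_ball.measurableSet (w.window_ne_zero hf hc')
      Metric.isClosed_closedBall.measurableSet hη (by linarith) ?_ ?_ hm
    · have h1 := hf.noiseLaw_real_le (s := Metric.closedBall a (t + ρ))
        Metric.isClosed_closedBall.measurableSet measure_closedBall_lt_top.ne
        fun z hz => w.upper z (abs_sub_le_of_mem_ball hc' (hJC hz))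
      rwa [Real.volume_real_closedBall (by linarith)] at h1
    · have h1 := w.le_window hf hc'
      have h2 : η * ((1 - η) * f δ * (4 * h)) ≤
          η * (noiseLaw f).real (Metric.ball c (2 * h)) := by gcongr
      refine le_trans ?_ h2
      -- Since η ≤ 1/4 gives 1 + η ≤ 2(1 - η), the condition t + ρ ≤ ηh keeps the ball below a
      -- fraction η of the window mass.
      have h3 : (1 + η) * (t + ρ) ≤ 2 * (1 - η) * (η * h) :=
        mul_le_mul (by linarith) hth (by linarith) (by linarith)
      nlinarith

end WindowScale

end Gap

/-! ### Integrating out the side signal. -/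

section Survival

variable {f : ℝ → ℝ} (hf : WellBehaved f) (S : SideInfo) {n : ℕ}

/-- The event that no anecdote is within `t` of the target. -/
def gapEvent (f : ℝ → ℝ) (S : SideInfo) (n : ℕ) (δ t : ℝ) : Set ((Fin n → ℝ) × ℝ) :=
  {p | ∀ i, t < |p.1 i - target f S δ p|}

include hf

/-- Markov's inequality for the posterior exponential moment of rate √n. The near part of the spread
is at most a exp a ≤ 3a, so a spread above 4a leaves at least a to the far part. -/
theorem noise_spread_gt_le : ∃ C : ℝ, 0 < C ∧ ∀ (S : SideInfo) (n : ℕ), 16 ≤ n → ∀ a : ℝ, 0 < a →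
    a ≤ 1 → noise f S n {p | spread f S p ≤ 4 * a}ᶜ ≤
      ENNReal.ofReal (C / a * Real.exp (-((√n - 2) * a))) := by
  obtain ⟨C, hC, h⟩ := lintegral_post_exp_le hf
  refine ⟨C, hC, fun S n hn a ha ha1 => ?_⟩
  have hn0' : (0 : ℝ) < n := by exact_mod_cast (by omega : 0 < n)
  have hs : 4 ≤ √(n : ℝ) := Real.le_sqrt_of_sq_le (by norm_num; exact_mod_cast hn)
  have hk : √(n : ℝ) < n := by
    have := Real.mul_self_sqrt hn0'.le
    nlinarith
  have hexp : Real.exp a ≤ 3 := by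
    have := Real.exp_one_lt_three
    have := Real.exp_le_exp.2 ha1
    linarith
  have hsub : {p : (Fin n → ℝ) × ℝ | spread f S p ≤ 4 * a}ᶜ ⊆
      {p | ENNReal.ofReal (a * Real.exp ((√n - 2) * a)) ≤
        ENNReal.ofReal (post f S p.1 p.2 fun θ => Real.exp (√n * |θ|))} := by
    intro p hp
    have hp' : 4 * a < spread f S p := not_le.1 hp
    have h1 := post_abs_mul_exp_le hf S (by omega) p.1 p.2 ha.le (by linarith : 2 ≤ √(n : ℝ)) hk
    change spread f S p ≤ _ at h1
    refine ENNReal.ofReal_le_ofReal ?_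
    set W := post f S p.1 p.2 fun θ => Real.exp (√n * |θ|)
    have h2 : a ≤ Real.exp (-((√n - 2) * a)) * W := by nlinarith
    rw [Real.exp_neg, inv_mul_eq_div, le_div_iff₀ (Real.exp_pos _)] at h2
    exact h2
  refine (measure_mono hsub).trans ?_
  have hpos : 0 < a * Real.exp ((√n - 2) * a) := by positivity
  refine (meas_ge_le_lintegral_div ?_ (by simpa using hpos) ENNReal.ofReal_ne_top).trans ?_
  · exact (measurable_post hf.continuous.measurable S n (by fun_prop)).ennreal_ofReal.aemeasurable
  · rw [show C / a * Real.exp (-((√n - 2) * a)) = C / (a * Real.exp ((√n - 2) * a)) by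
      rw [Real.exp_neg]; field_simp, ENNReal.ofReal_div_of_pos hpos]
    exact ENNReal.div_le_div_right (h S n hn) _

theorem measurableSet_gapEvent (δ t : ℝ) : MeasurableSet (gapEvent f S n δ t) := by
  rw [gapEvent, Set.ofPred_forall]
  exact MeasurableSet.iInter fun i => measurableSet_lt measurable_const
    (((measurable_pi_apply i).comp measurable_fst).sub (measurable_target hf S δ)).abs

theorem isProbabilityMeasure_noise : IsProbabilityMeasure (noise f S n) := by
  have := hf.isProbabilityMeasure
  unfold noise; infer_instance

omit hf in
theorem noise_apply [IsProbabilityMeasure (noiseLaw f)] {E : Set ((Fin n → ℝ) × ℝ)}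
    (hE : MeasurableSet E) : noise f S n E =
      ∫⁻ y, Measure.pi (fun _ : Fin n => noiseLaw f) {x | (x, y) ∈ E} ∂S.law :=
  Measure.prod_apply_symm hE

variable {S} {δ η r h u ρ B : ℝ}

theorem measurableSet_spread_le (u : ℝ) :
    MeasurableSet {p : (Fin n → ℝ) × ℝ | spread f S p ≤ u} :=
  measurableSet_le (measurable_spread hf S) measurable_const

theorem WindowScale.noise_gapEvent_le (w : WindowScale f n δ η r h u ρ B) (hn : 2 < n) {t : ℝ}
    (ht : 0 ≤ t) (hth : t ≤ h) :
    noise f S n (gapEvent f S n δ t) ≤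
      ENNReal.ofReal (Real.exp (-((1 - η) * n * ((1 - η) * f δ * (2 * (t - ρ)))))) *
        ENNReal.ofReal (1 + 2 * ρ / h) +
      ENNReal.ofReal (r / h) * ENNReal.ofReal (2 * Real.exp (-(n * h * f δ * η ^ 2 / 2))) +
      ENNReal.ofReal (3 * r / h + 1) * noise f S n {p | spread f S p ≤ u}ᶜ := by
  have := hf.isProbabilityMeasure
  rw [noise_apply S (measurableSet_gapEvent hf S δ t),
    noise_apply S (measurableSet_spread_le hf u).compl,
    ← lintegral_const_mul' _ _ ENNReal.ofReal_ne_top]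
  refine (lintegral_mono fun y => w.pi_gapSet_le hf hn y ht hth).trans ?_
  rw [lintegral_add_left measurable_const]
  simp only [lintegral_const, measure_univ, mul_one]
  rfl

theorem WindowScale.le_noise_gapEvent (w : WindowScale f n δ η r h u ρ B) (hn : 2 < n) {t : ℝ}
    (ht : 0 ≤ t) (hth : t + ρ ≤ η * h) :
    ENNReal.ofReal (Real.exp (-((1 + η) / (1 - η) * n * ((1 + η) * f δ * (2 * (t + ρ)))))) *
        ENNReal.ofReal (1 - 2 * ρ / h) ≤ noise f S n (gapEvent f S n δ t) +
      ENNReal.ofReal (r / h) * ENNReal.ofReal (2 * Real.exp (-(n * h * f δ * η ^ 2 / 2))) +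
      ENNReal.ofReal (3 * r / h + 1) * noise f S n {p | spread f S p ≤ u}ᶜ := by
  have := hf.isProbabilityMeasure
  have hm : Measurable fun y =>
      Measure.pi (fun _ : Fin n => noiseLaw f) (gapSet (fun x => target f S δ (x, y)) t) :=
    measurable_measure_prodMk_right (measurableSet_gapEvent hf S δ t)
  have hm' : Measurable fun y =>
      Measure.pi (fun _ : Fin n => noiseLaw f) (gapSet (fun x => target f S δ (x, y)) t) +
        ENNReal.ofReal (r / h) * ENNReal.ofReal (2 * Real.exp (-(n * h * f δ * η ^ 2 / 2))) :=
    hm.add_const _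
  rw [noise_apply S (measurableSet_gapEvent hf S δ t),
    noise_apply S (measurableSet_spread_le hf u).compl,
    ← lintegral_const_mul' _ _ ENNReal.ofReal_ne_top]
  have h1 := lintegral_mono (μ := S.law) fun y => w.le_pi_gapSet (S := S) hf hn y ht hth
  rw [lintegral_add_left hm', lintegral_add_left hm] at h1
  simp only [lintegral_const, measure_univ, mul_one] at h1
  exact h1

end Survival

open Filter Topology

/-! ### Choice of scales and the asymptotic law of the gap. -/

section Asymptotics

variable {f : ℝ → ℝ} (hf : WellBehaved f)
include hf

/-- The density is nearly constant near every point of a bounded set. -/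
theorem WellBehaved.exists_radius {η : ℝ} (hη : 0 < η) (D : ℝ) : ∃ r : ℝ, 0 < r ∧ r ≤ 1 ∧
    ∀ δ, |δ| ≤ D → ∀ z, |z - δ| ≤ 2 * r → (1 - η) * f δ ≤ f z ∧ f z ≤ (1 + η) * f δ := by
  have hu := (isCompact_closedBall (0 : ℝ) (|D| + 2)).uniformContinuousOn_of_continuous
    hf.continuous.continuousOn
  rw [Metric.uniformContinuousOn_iff] at hu
  obtain ⟨r, hr, h⟩ := hu (η * f D) (mul_pos hη (hf.pos D))
  refine ⟨min (r / 3) 1, by positivity, min_le_right _ _, fun δ hδ z hz => ?_⟩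
  have h1 : min (r / 3) 1 ≤ r / 3 := min_le_left _ _
  have h2 : min (r / 3) 1 ≤ 1 := min_le_right _ _
  have hD : |δ| ≤ |D| := hδ.trans (le_abs_self D)
  have hzm : z ∈ Metric.closedBall (0 : ℝ) (|D| + 2) := by
    rw [Metric.mem_closedBall, Real.dist_eq, sub_zero]
    have := abs_sub_abs_le_abs_sub z δ
    linarith
  have hδm : δ ∈ Metric.closedBall (0 : ℝ) (|D| + 2) := by
    rw [Metric.mem_closedBall, Real.dist_eq, sub_zero]; linarith
  have h3 := h z hzm δ hδm (by rw [Real.dist_eq]; linarith)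
  rw [Real.dist_eq, abs_lt] at h3
  have h4 : η * f D ≤ η * f δ := mul_le_mul_of_nonneg_left (hf.antitone_abs hD) hη.le
  constructor <;> linarith

omit hf in
theorem eventually_mul_pow_le {a b : ℝ} (hb : 0 < b) {k : ℕ} (hk : k ≠ 0) :
    ∀ᶠ v : ℝ in 𝓝[>] 0, a * v ^ k ≤ b := by
  have h : Tendsto (fun v : ℝ => a * v ^ k) (𝓝[>] 0) (𝓝 (a * 0 ^ k)) :=
    ((continuous_const.mul (continuous_pow k)).tendsto 0).mono_left nhdsWithin_le_nhds
  rw [zero_pow hk, mul_zero] at h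
  exact (h.eventually_lt_const hb).mono fun v hv => hv.le

omit hf in
theorem eventually_exp_le_pow {κ ε : ℝ} (hκ : 0 < κ) (hε : 0 < ε) (k : ℕ) :
    ∀ᶠ v : ℝ in 𝓝[>] 0, Real.exp (-(κ / v)) ≤ ε * v ^ k := by
  have h := (tendsto_rpow_mul_exp_neg_mul_atTop_nhds_zero k κ hκ).comp
    (tendsto_inv_nhdsGT_zero (𝕜 := ℝ))
  filter_upwards [h.eventually_lt_const hε, self_mem_nhdsWithin] with v hv hv0
  have hv0' : 0 < v := hv0
  simp only [Function.comp_apply, Real.rpow_natCast] at hv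
  rw [inv_pow, inv_mul_lt_iff₀ (by positivity)] at hv
  rw [div_eq_mul_inv, ← neg_mul, mul_comm ε]
  exact hv.le

/-- With n = v⁻¹², the typical spread 1/√n is v⁶ and the gap scale 1/n is v¹². The bound u = 4v³ is
far above the former, so it rarely fails. The width h = v¹¹ is far above the latter, so a window
holds about nh = 1/v anecdotes; yet τ is of order nh² = v¹⁰, and the target moves by τu, of order
v¹³, which is negligible against 1/n. -/
theorem exists_windowScale {η : ℝ} (hη : 0 < η) (hη' : η ≤ 1 / 4) (D : ℝ) :
    ∃ r B K : ℝ, 0 < r ∧ 0 ≤ K ∧ ∀ᶠ v : ℝ in 𝓝[>] 0, ∀ n : ℕ, n * v ^ 12 = 1 → ∀ δ, |δ| ≤ D →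
      WindowScale f n δ η r (v ^ 11) (4 * v ^ 3) (K * v ^ 13) B := by
  obtain ⟨r, hr, hr1, hfr⟩ := hf.exists_radius hη D
  obtain ⟨B, hB, hcol⟩ := exists_abs_log_likelihood_collapse_le hf (|D| + 3)
  have h0 := hf.pos 0
  -- 1536 = 24 · 16 · 4, from the sensitivity bound, from τ and from u.
  refine ⟨r, B, 1536 * B * f 0, hr, by positivity, ?_⟩
  filter_upwards [self_mem_nhdsWithin,
    eventually_mul_pow_le (a := 1) (b := 1) one_pos (k := 1) one_ne_zero,
    eventually_mul_pow_le (a := 4) (b := 1) one_pos (k := 3) (by norm_num),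
    eventually_mul_pow_le (a := 4) (b := r / 2) (by positivity) (k := 3) (by norm_num),
    eventually_mul_pow_le (a := 1) (b := r / 2) (by positivity) (k := 11) (by norm_num),
    eventually_mul_pow_le (a := 2 * (1536 * B * f 0)) (b := 1) one_pos (k := 2) (by norm_num),
    eventually_mul_pow_le (a := B * 16 * f 0) (b := 1 / 16) (by norm_num) (k := 10) (by norm_num),
    eventually_mul_pow_le (a := 2 * (1536 * B * f 0) * f 0) (b := 1 / 2) (by norm_num) (k := 1)
      (by norm_num)] with v hv e1 e2 e3 e4 e5 e6 e7 n hn δ hδ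
  have hv0 : 0 < v := hv
  have hnh : (n : ℝ) * (v ^ 11) ^ 2 = v ^ 10 := by linear_combination v ^ 10 * hn
  refine ⟨hη, hη', by positivity, e2, by linarith, by positivity, ?_, fun z hz => ?_, fun z hz => ?_,
    fun x c θ hc => ?_, hB.le, ?_, ?_, ?_⟩
  · have : 2 * (1536 * B * f 0) * v ^ 2 * v ^ 11 ≤ 1 * v ^ 11 := by gcongr
    linarith
  · exact (hfr δ hδ z (by linarith)).1
  · exact (hfr δ hδ z (by linarith)).2
  · refine hcol n x c (2 * v ^ 11) θ ?_
    have h1 := abs_sub_abs_le_abs_sub c δ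
    have h2 := le_abs_self D
    linarith
  · linear_combination e6 + B * 16 * f 0 * hnh
  · linear_combination -(1536 * B * f 0 * v ^ 3) * hnh
  · linear_combination e7 + 2 * (1536 * B * f 0) * f 0 * v * hn

/-- The natural small parameter: `n⁻¹` to the power `1 / 12`. -/
def scale (n : ℕ) : ℝ := (n : ℝ) ^ (-(1 / 12) : ℝ)

omit hf in
theorem scale_pow {n : ℕ} (hn : 0 < n) : n * scale n ^ 12 = 1 := by
  have hn' : (0 : ℝ) < n := by exact_mod_cast hn
  rw [scale, ← Real.rpow_natCast, ← Real.rpow_mul hn'.le]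
  norm_num
  rw [Real.rpow_neg_one, mul_inv_cancel₀ hn'.ne']

omit hf in
theorem tendsto_scale : Tendsto scale atTop (𝓝[>] 0) := by
  refine tendsto_nhdsWithin_iff.2 ⟨?_, ?_⟩
  · exact (tendsto_rpow_neg_atTop (by norm_num : (0 : ℝ) < 1 / 12)).comp
      tendsto_natCast_atTop_atTop
  · filter_upwards [eventually_gt_atTop 0] with n hn
    exact Real.rpow_pos_of_pos (by exact_mod_cast hn) _

omit hf in
-- Atypical counts cost exp(-κ/v) because nh = 1/v, and a large spread costs at most a multiple of
-- exp(-1/v) because √n v³ = v⁻³. Both beat every power of v; v⁹⁶ = n⁻⁸ is ample for what follows.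
theorem window_error_le {n : ℕ} {v r C κ κ' : ℝ} (hv0 : 0 < v) (hv1 : v ≤ 1) (hvn : n * v ^ 12 = 1)
    (hr : 0 < r) (hC : 0 < C) (hκ : κ ≤ κ')
    (c3 : Real.exp (-(κ / v)) ≤ 1 / (4 * r) * v ^ 107)
    (c4 : Real.exp (-(1 / v)) ≤ 1 / (2 * ((3 * r + 1) * (C * Real.exp 2))) * v ^ 110) :
    r / v ^ 11 * (2 * Real.exp (-(n * v ^ 11 * κ'))) + (3 * r / v ^ 11 + 1) *
      (C / v ^ 3 * Real.exp (-((√n - 2) * v ^ 3))) ≤ v ^ 96 := by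
  have hsqrt : √(n : ℝ) = 1 / v ^ 6 := by
    rw [Real.sqrt_eq_iff_mul_self_eq (by positivity) (by positivity)]
    field_simp
    linear_combination hvn
  have hb : r / v ^ 11 * (2 * Real.exp (-(n * v ^ 11 * κ'))) ≤ v ^ 96 / 2 := by
    have e1 : Real.exp (-(n * v ^ 11 * κ')) ≤ Real.exp (-(κ / v)) := by
      rw [Real.exp_le_exp, neg_le_neg_iff]
      have e2 : n * v ^ 11 = 1 / v := by field_simp; linear_combination hvn
      rw [e2, one_div_mul_eq_div]
      gcongr
    calc r / v ^ 11 * (2 * Real.exp (-(n * v ^ 11 * κ')))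
        ≤ r / v ^ 11 * (2 * (1 / (4 * r) * v ^ 107)) := by
          gcongr; exact e1.trans c3
      _ = v ^ 96 / 2 := by field_simp; ring
  have hβ' : (3 * r / v ^ 11 + 1) * (C / v ^ 3 * Real.exp (-((√n - 2) * v ^ 3))) ≤ v ^ 96 / 2 := by
    have e1 : Real.exp (-((√n - 2) * v ^ 3)) ≤ Real.exp 2 * Real.exp (-(1 / v)) := by
      rw [← Real.exp_add, Real.exp_le_exp, hsqrt]
      have e2 : (1 / v ^ 6 - 2) * v ^ 3 = 1 / v ^ 3 - 2 * v ^ 3 := by field_simp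
      have e3 : 1 / v ≤ 1 / v ^ 3 := by
        apply one_div_le_one_div_of_le (by positivity)
        exact pow_le_of_le_one hv0.le hv1 (by norm_num)
      rw [e2]
      linarith [pow_le_one₀ (n := 3) hv0.le hv1]
    have e4 : 3 * r / v ^ 11 + 1 ≤ (3 * r + 1) / v ^ 11 := by
      rw [add_div]
      have : (1 : ℝ) ≤ 1 / v ^ 11 := by
        rw [le_div_iff₀ (by positivity), one_mul]; exact pow_le_one₀ hv0.le hv1
      linarith
    calc (3 * r / v ^ 11 + 1) * (C / v ^ 3 * Real.exp (-((√n - 2) * v ^ 3))) ≤ (3 * r + 1) / v ^ 11 * (C / v ^ 3 * (Real.exp 2 *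
          (1 / (2 * ((3 * r + 1) * (C * Real.exp 2))) * v ^ 110))) := by
          refine mul_le_mul e4 ?_ (by positivity) (by positivity)
          refine mul_le_mul_of_nonneg_left (e1.trans ?_) (by positivity)
          exact mul_le_mul_of_nonneg_left c4 (Real.exp_pos _).le
      _ = v ^ 96 / 2 := by field_simp
  linarith

omit hf in
-- Here a and b stand for f(δ) and f(0). Shifting t by ρ costs at most a factor exp(2b nρ) with nρ =
-- Kv, and enlarging the windows costs 1 + 2Kv²; together these are within 1 + η.
theorem upper_rate_le {n : ℕ} {v K η a b t : ℝ} (hv0 : 0 < v) (hvn : n * v ^ 12 = 1)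
    (hK : 0 ≤ K) (hη : 0 < η) (hη' : η ≤ 1 / 4) (hδp : 0 < a) (hδ0 : a ≤ b)
    (c1 : Real.exp (2 * b * (K * v)) * (1 + 2 * (K * v ^ 2)) ≤ 1 + η) :
 Real.exp (-((1 - η) * n * ((1 - η) * a * (2 * (t - K * v ^ 13))))) *
      (1 + 2 * (K * v ^ 13) / v ^ 11) ≤
      (1 + η) * Real.exp (-(2 * (1 - η) ^ 2 * n * a * t)) := by
  have hρh : K * v ^ 13 / v ^ 11 = K * v ^ 2 := by field_simp
  have hnρ : n * (K * v ^ 13) = K * v := by linear_combination K * v * hvn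
  have e1 : Real.exp (-((1 - η) * n * ((1 - η) * a * (2 * (t - K * v ^ 13))))) ≤
      Real.exp (-(2 * (1 - η) ^ 2 * n * a * t)) * Real.exp (2 * b * (K * v)) := by
    rw [← Real.exp_add, Real.exp_le_exp]
    have e2 : -((1 - η) * n * ((1 - η) * a * (2 * (t - K * v ^ 13)))) =
        -(2 * (1 - η) ^ 2 * n * a * t) + 2 * (1 - η) ^ 2 * a * (K * v) := by
      linear_combination 2 * (1 - η) ^ 2 * a * hnρ
    have e3 : (1 - η) ^ 2 * a ≤ 1 * b :=
      mul_le_mul (by nlinarith) hδ0 hδp.le zero_le_one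
    have e4 : 0 ≤ K * v := by positivity
    rw [e2]
    nlinarith
  rw [mul_div_assoc 2 (K * v ^ 13), hρh]
  calc _ ≤ Real.exp (-(2 * (1 - η) ^ 2 * n * a * t)) * Real.exp (2 * b * (K * v)) *
        (1 + 2 * (K * v ^ 2)) := mul_le_mul_of_nonneg_right e1 (by positivity)
    _ ≤ Real.exp (-(2 * (1 - η) ^ 2 * n * a * t)) * (1 + η) := by
        rw [mul_assoc]; exact mul_le_mul_of_nonneg_left c1 (Real.exp_pos _).le
    _ = _ := mul_comm _ _

omit hf in
theorem le_lower_rate {n : ℕ} {v K η a b t : ℝ} (hv0 : 0 < v) (hvn : n * v ^ 12 = 1)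
    (hK : 0 ≤ K) (hη : 0 < η) (hη' : η ≤ 1 / 4) (hδp : 0 < a) (hδ0 : a ≤ b)
    (c2 : 1 - η ≤ Real.exp (-(8 * b * (K * v))) * (1 - 2 * (K * v ^ 2)))
    (c5 : 2 * K * v ^ 2 ≤ η) :
 (1 - η) * Real.exp (-(2 * (1 + η) ^ 2 / (1 - η) * n * a * t)) ≤
      Real.exp (-((1 + η) / (1 - η) * n * ((1 + η) * a * (2 * (t + K * v ^ 13))))) *
      (1 - 2 * (K * v ^ 13) / v ^ 11) := by
  have hρh : K * v ^ 13 / v ^ 11 = K * v ^ 2 := by field_simp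
  have hnρ : n * (K * v ^ 13) = K * v := by linear_combination K * v * hvn
  have e1 : Real.exp (-(2 * (1 + η) ^ 2 / (1 - η) * n * a * t)) *
      Real.exp (-(8 * b * (K * v))) ≤
      Real.exp (-((1 + η) / (1 - η) * n * ((1 + η) * a * (2 * (t + K * v ^ 13))))) := by
    rw [← Real.exp_add, Real.exp_le_exp]
    have e2 : -((1 + η) / (1 - η) * n * ((1 + η) * a * (2 * (t + K * v ^ 13)))) =
        -(2 * (1 + η) ^ 2 / (1 - η) * n * a * t) -
          2 * ((1 + η) ^ 2 / (1 - η)) * a * (K * v) := by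
      linear_combination -(2 * ((1 + η) ^ 2 / (1 - η)) * a) * hnρ
    have e3 : (1 + η) ^ 2 / (1 - η) ≤ 4 := by
      rw [div_le_iff₀ (by linarith)]; nlinarith
    have e3' : (1 + η) ^ 2 / (1 - η) * a ≤ 4 * b :=
      mul_le_mul e3 hδ0 hδp.le (by norm_num)
    have e4 : 0 ≤ K * v := by positivity
    rw [e2]
    nlinarith
  have e5 : 0 ≤ 1 - 2 * (K * v ^ 2) := by linarith
  rw [mul_div_assoc 2 (K * v ^ 13), hρh]
  calc _ ≤ (Real.exp (-(8 * b * (K * v))) * (1 - 2 * (K * v ^ 2))) *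
        Real.exp (-(2 * (1 + η) ^ 2 / (1 - η) * n * a * t)) :=
        mul_le_mul_of_nonneg_right c2 (Real.exp_pos _).le
    _ = (Real.exp (-(2 * (1 + η) ^ 2 / (1 - η) * n * a * t)) *
        Real.exp (-(8 * b * (K * v)))) * (1 - 2 * (K * v ^ 2)) := by ring
    _ ≤ _ := mul_le_mul_of_nonneg_right e1 e5

/-- The distance from the target to the closest anecdote is asymptotically exponential. -/
theorem eventually_gapEvent_bounds {η : ℝ} (hη : 0 < η) (hη' : η ≤ 1 / 4) (D : ℝ) :
    ∀ᶠ n : ℕ in atTop, ∀ (S : SideInfo) (δ : ℝ), |δ| ≤ D → ∀ t, 0 ≤ t →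
      t ≤ η / 2 * scale n ^ 11 →
      (noise f S n).real (gapEvent f S n δ t) ≤
          (1 + η) * Real.exp (-(2 * (1 - η) ^ 2 * n * f δ * t)) + scale n ^ 96 ∧
        (1 - η) * Real.exp (-(2 * (1 + η) ^ 2 / (1 - η) * n * f δ * t)) ≤
          (noise f S n).real (gapEvent f S n δ t) + scale n ^ 96 := by
  obtain ⟨r, B, K, hr, hK, hw⟩ := exists_windowScale hf hη hη' D
  obtain ⟨C, hC, hspread⟩ := noise_spread_gt_le hf
  have h0 := hf.pos 0
  have hD := hf.pos D
  have c1 : ∀ᶠ v : ℝ in 𝓝[>] 0,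
      Real.exp (2 * f 0 * (K * v)) * (1 + 2 * (K * v ^ 2)) ≤ 1 + η := by
    have h : Tendsto (fun v : ℝ => Real.exp (2 * f 0 * (K * v)) * (1 + 2 * (K * v ^ 2))) (𝓝[>] 0)
        (𝓝 (Real.exp (2 * f 0 * (K * 0)) * (1 + 2 * (K * 0 ^ 2)))) :=
      (Continuous.tendsto (by fun_prop) 0).mono_left nhdsWithin_le_nhds
    norm_num at h
    exact (h.eventually_lt_const (by linarith)).mono fun v hv => hv.le
  have c2 : ∀ᶠ v : ℝ in 𝓝[>] 0,
      1 - η ≤ Real.exp (-(8 * f 0 * (K * v))) * (1 - 2 * (K * v ^ 2)) := by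
    have h : Tendsto (fun v : ℝ => Real.exp (-(8 * f 0 * (K * v))) * (1 - 2 * (K * v ^ 2))) (𝓝[>] 0)
        (𝓝 (Real.exp (-(8 * f 0 * (K * 0))) * (1 - 2 * (K * 0 ^ 2)))) :=
      (Continuous.tendsto (by fun_prop) 0).mono_left nhdsWithin_le_nhds
    norm_num at h
    exact (h.eventually_const_lt (by linarith)).mono fun v hv => hv.le
  have hκ : 0 < f D * η ^ 2 / 2 := by positivity
  have c3 := eventually_exp_le_pow hκ (ε := 1 / (4 * r)) (by positivity) 107
  have c4 := eventually_exp_le_pow one_pos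
    (ε := 1 / (2 * ((3 * r + 1) * (C * Real.exp 2)))) (by positivity) 110
  have c5 := eventually_mul_pow_le (a := 2 * K) (b := η) hη (k := 2) (by norm_num)
  have c6 := eventually_mul_pow_le (a := 1) (b := 1) one_pos (k := 1) one_ne_zero
  filter_upwards [tendsto_scale.eventually hw, tendsto_scale.eventually c1,
    tendsto_scale.eventually c2, tendsto_scale.eventually c3, tendsto_scale.eventually c4,
    tendsto_scale.eventually c5, tendsto_scale.eventually c6,
    tendsto_scale.eventually self_mem_nhdsWithin, eventually_ge_atTop 16]
    with n hw c1 c2 c3 c4 c5 c6 hv hn S δ hδ t ht hth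
  have hvn := scale_pow (by omega : 0 < n)
  set v := scale n with hvdef
  have hv0 : 0 < v := hv
  have hv1 : v ≤ 1 := by linarith
  have w := hw n hvn δ hδ
  have := isProbabilityMeasure_noise hf (n := n) S
  have hn2 : 2 < n := by omega
  have hρ := w.rho_nonneg hf
  have hδ0 := hf.le_zero δ
  have hδp := hf.pos δ
  have hδD : f D ≤ f δ := hf.antitone_abs (hδ.trans (le_abs_self D))
  have hpow : v ^ 3 ≤ 1 := pow_le_one₀ hv0.le hv1
  -- The choice a = v³ in the spread estimate is the source of u = 4v³.
  have hβ := hspread S n hn (v ^ 3) (by positivity) hpow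
  set β := C / v ^ 3 * Real.exp (-((√n - 2) * v ^ 3)) with hβdef
  set b := 2 * Real.exp (-(n * v ^ 11 * (f δ * η ^ 2 / 2))) with hbdef
  have herr : r / v ^ 11 * b + (3 * r / v ^ 11 + 1) * β ≤ v ^ 96 :=
    window_error_le hv0 hv1 hvn hr hC (by gcongr) c3 c4
  have hexp1 := upper_rate_le (t := t) hv0 hvn hK hη hη' hδp hδ0 c1
  have hexp2 := le_lower_rate (t := t) hv0 hvn hK hη hη' hδp hδ0 c2 c5
  have hvη : η / 2 * v ^ 11 ≤ v ^ 11 := by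
    have : 0 ≤ v ^ 11 := by positivity
    nlinarith
  have hpos1 : 0 ≤ 1 + 2 * (K * v ^ 13) / v ^ 11 := by positivity
  have hassoc : (n : ℝ) * v ^ 11 * (f δ * η ^ 2 / 2) = n * v ^ 11 * f δ * η ^ 2 / 2 := by ring
  have hβ0 : 0 ≤ β := by positivity
  have hb0 : 0 ≤ b := by positivity
  have hsplit : ENNReal.ofReal (r / v ^ 11 * b + (3 * r / v ^ 11 + 1) * β) =
      ENNReal.ofReal (r / v ^ 11) * ENNReal.ofReal b +
        ENNReal.ofReal (3 * r / v ^ 11 + 1) * ENNReal.ofReal β := by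
    rw [ENNReal.ofReal_add (by positivity) (by positivity),
      ENNReal.ofReal_mul (p := r / v ^ 11) (by positivity),
      ENNReal.ofReal_mul (p := 3 * r / v ^ 11 + 1) (by positivity)]
  constructor
  · have h1 := w.noise_gapEvent_le (S := S) hf hn2 ht (hth.trans hvη)
    refine (ENNReal.toReal_le_of_le_ofReal (by positivity) (h1.trans ?_) :
      (noise f S n).real _ ≤ (1 + η) * Real.exp (-(2 * (1 - η) ^ 2 * n * f δ * t)) +
        (r / v ^ 11 * b + (3 * r / v ^ 11 + 1) * β)).trans (by linarith)
    rw [ENNReal.ofReal_add (p := (1 + η) * Real.exp (-(2 * (1 - η) ^ 2 * n * f δ * t)))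
      (q := r / v ^ 11 * b + (3 * r / v ^ 11 + 1) * β) (by positivity) (by positivity),
      hsplit, ← add_assoc]
    refine add_le_add (add_le_add ?_ ?_) (by gcongr)
    · rw [← ENNReal.ofReal_mul (Real.exp_pos _).le]
      exact ENNReal.ofReal_le_ofReal hexp1
    · rw [hbdef, hassoc]
  · have h1 := w.le_noise_gapEvent (S := S) hf hn2 ht (by
      have : 2 * K * v ^ 2 * v ^ 11 ≤ η * v ^ 11 := by gcongr
      linarith)
    have h2 : ENNReal.ofReal
        (Real.exp (-((1 + η) / (1 - η) * n * ((1 + η) * f δ * (2 * (t + K * v ^ 13))))) *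
          (1 - 2 * (K * v ^ 13) / v ^ 11)) ≤
        ENNReal.ofReal ((noise f S n).real (gapEvent f S n δ t) +
          (r / v ^ 11 * b + (3 * r / v ^ 11 + 1) * β)) := by
      rw [ENNReal.ofReal_mul (Real.exp_pos _).le,
        ENNReal.ofReal_add measureReal_nonneg (by positivity),
        hsplit, ← add_assoc, ofReal_measureReal]
      refine h1.trans ?_
      rw [hbdef, hassoc]
      gcongr
    rw [ENNReal.ofReal_le_ofReal_iff (add_nonneg measureReal_nonneg (by positivity))] at h2
    linarith

end Asymptotics

/-! ### The truncated second moment of a nearly exponential variable -/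

theorem integrableOn_mul_exp_neg {l : ℝ} (hl : 0 < l) :
    IntegrableOn (fun t : ℝ => 2 * t * Real.exp (-(l * t))) (Set.Ioi 0) ∧
      ∫ t in Set.Ioi (0 : ℝ), 2 * t * Real.exp (-(l * t)) = 2 / l ^ 2 := by
  have h := Real.integral_rpow_mul_exp_neg_mul_Ioi (a := 2) two_pos hl
  have h2 : ∫ t in Set.Ioi (0 : ℝ), 2 * t * Real.exp (-(l * t)) = 2 / l ^ 2 := by
    have he : ∀ t : ℝ, 2 * t * Real.exp (-(l * t)) =
        2 * (t ^ ((2 : ℝ) - 1) * Real.exp (-(l * t))) := fun t => by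
      norm_num; ring
    simp_rw [he]
    rw [integral_const_mul, h, Real.Gamma_two]
    norm_num
    ring
  -- A non-integrable function has integral 0 by convention, so the nonzero value yields
  -- integrability.
  exact ⟨Integrable.of_integral_ne_zero (by rw [h2]; positivity), h2⟩

theorem lintegral_mul_exp_neg {l a : ℝ} (hl : 0 < l) (ha : 0 ≤ a) :
    ∫⁻ t in Set.Ioi (0 : ℝ), ENNReal.ofReal (a * Real.exp (-(l * t))) * ENNReal.ofReal (2 * t) =
      ENNReal.ofReal (2 * a / l ^ 2) := by
  obtain ⟨hi, he⟩ := integrableOn_mul_exp_neg hl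
  have h1 : ∫⁻ t in Set.Ioi (0 : ℝ), ENNReal.ofReal (a * Real.exp (-(l * t))) *
      ENNReal.ofReal (2 * t) =
      ∫⁻ t in Set.Ioi (0 : ℝ), ENNReal.ofReal (a * (2 * t * Real.exp (-(l * t)))) := by
    refine lintegral_congr fun t => ?_
    rw [← ENNReal.ofReal_mul (by positivity)]
    congr 1
    ring
  rw [h1, ← ofReal_integral_eq_lintegral_ofReal (hi.const_mul a), integral_const_mul, he]
  · congr 1; ring
  · filter_upwards [self_mem_ae_restrict measurableSet_Ioi] with t ht
    have : (0 : ℝ) < t := ht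
    simp only [Pi.zero_apply]
    positivity

theorem lintegral_indicator_const_mul {T e : ℝ} (hT : 0 ≤ T) (he : 0 ≤ e) :
    ∫⁻ t in Set.Ioi (0 : ℝ), (Set.Iio T).indicator (fun _ => ENNReal.ofReal e) t *
      ENNReal.ofReal (2 * t) = ENNReal.ofReal (e * T ^ 2) := by
  have h1 : ∀ t : ℝ, (Set.Iio T).indicator (fun _ => ENNReal.ofReal e) t *
      ENNReal.ofReal (2 * t) = (Set.Iio T).indicator (fun t => ENNReal.ofReal (e * (2 * t))) t := by
    intro t
    by_cases h : t ∈ Set.Iio T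
    · simp only [Set.indicator_of_mem h]
      rw [ENNReal.ofReal_mul he]
    · simp only [Set.indicator_of_notMem h, zero_mul]
  simp_rw [h1]
  rw [lintegral_indicator measurableSet_Iio, Measure.restrict_restrict measurableSet_Iio,
    Set.Iio_inter_Ioi, ← ofReal_integral_eq_lintegral_ofReal]
  · rw [← integral_Ioc_eq_integral_Ioo, ← intervalIntegral.integral_of_le hT,
      intervalIntegral.integral_const_mul, intervalIntegral.integral_const_mul, integral_id]
    congr 1
    ring
  · exact ((continuous_const.mul (continuous_const.mul continuous_id)).integrableOn_Icc
      (a := 0) (b := T)).mono_set Set.Ioo_subset_Icc_self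
  · filter_upwards [self_mem_ae_restrict measurableSet_Ioo] with t ht
    have : (0 : ℝ) < t := ht.1
    simp only [Pi.zero_apply]
    positivity

section

variable {Ω : Type*} [MeasurableSpace Ω] {μ : Measure Ω} {d : Ω → ℝ} {T : ℝ}

/-- Layer-cake formula. The truncation at T is needed because the tail of the gap is known only up
to a fixed multiple of the window width. -/
theorem lintegral_min_sq (hd : Measurable d) (hd0 : ∀ ω, 0 ≤ d ω) (hT : 0 ≤ T) :
    ∫⁻ ω, ENNReal.ofReal (min (d ω) T ^ 2) ∂μ =
      ∫⁻ t in Set.Ioi (0 : ℝ), (Set.Iio T).indicator (fun t => μ {ω | t < d ω}) t *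
        ENNReal.ofReal (2 * t) := by
  have h := lintegral_comp_eq_lintegral_meas_lt_mul (g := fun t : ℝ => 2 * t) μ
    (f := fun ω => min (d ω) T) (Eventually.of_forall fun ω => le_min (hd0 ω) hT)
    (hd.min measurable_const).aemeasurable
    (fun t _ => (continuous_const.mul continuous_id).intervalIntegrable _ _)
    (by
      filter_upwards [self_mem_ae_restrict measurableSet_Ioi] with t ht
      have : (0 : ℝ) < t := ht
      positivity)
  have h2 : ∀ ω, ∫ t in (0 : ℝ)..min (d ω) T, 2 * t = min (d ω) T ^ 2 := fun ω => by
    rw [intervalIntegral.integral_const_mul, integral_id]; ring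
  simp_rw [h2] at h
  rw [h]
  refine lintegral_congr fun t => ?_
  congr 1
  by_cases ht : t ∈ Set.Iio T
  · rw [Set.indicator_of_mem ht]
    congr 1
    ext ω
    have : t < T := ht
    simp [this]
  · rw [Set.indicator_of_notMem ht]
    have : ¬ t < T := ht
    simp [this]

variable [IsProbabilityMeasure μ]

theorem integrable_min_sq (hd : Measurable d) (hd0 : ∀ ω, 0 ≤ d ω) (hT : 0 ≤ T) :
    Integrable (fun ω => min (d ω) T ^ 2) μ := by
  refine Integrable.of_bound ((hd.min measurable_const).pow_const 2).aestronglyMeasurable (T ^ 2)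
    (Eventually.of_forall fun ω => ?_)
  have : 0 ≤ min (d ω) T := le_min (hd0 ω) hT
  rw [Real.norm_of_nonneg (by positivity)]
  exact pow_le_pow_left₀ this (min_le_right _ _) 2

theorem integral_min_sq_le (hd : Measurable d) (hd0 : ∀ ω, 0 ≤ d ω) (hT : 0 ≤ T) {l a e : ℝ}
    (hl : 0 < l) (ha : 0 ≤ a) (he : 0 ≤ e)
    (h : ∀ t, 0 ≤ t → t ≤ T → μ.real {ω | t < d ω} ≤ a * Real.exp (-(l * t)) + e) :
    ∫ ω, min (d ω) T ^ 2 ∂μ ≤ 2 * a / l ^ 2 + e * T ^ 2 := by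
  rw [integral_eq_lintegral_of_nonneg_ae (Eventually.of_forall fun ω => sq_nonneg _)
    (integrable_min_sq hd hd0 hT).aestronglyMeasurable, lintegral_min_sq hd hd0 hT]
  refine ENNReal.toReal_le_of_le_ofReal (by positivity) ?_
  rw [ENNReal.ofReal_add (by positivity) (by positivity), ← lintegral_mul_exp_neg hl ha,
    ← lintegral_indicator_const_mul hT he, ← lintegral_add_left (by fun_prop)]
  refine setLIntegral_mono' measurableSet_Ioi fun t ht => ?_
  rw [← add_mul]
  gcongr
  by_cases htT : t ∈ Set.Iio T
  · rw [Set.indicator_of_mem htT, Set.indicator_of_mem htT, ← ENNReal.ofReal_add (by positivity) he,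
      ← ofReal_measureReal]
    exact ENNReal.ofReal_le_ofReal (h t (le_of_lt ht) (le_of_lt htT))
  · simp [Set.indicator_of_notMem htT]

/-- The part of the exponential lost beyond T is at most exp(-lT/2) times an exponential of rate
l/2, whose second moment produces the factor 8/l². -/
theorem le_integral_min_sq (hd : Measurable d) (hd0 : ∀ ω, 0 ≤ d ω) (hT : 0 ≤ T) {l a e : ℝ}
    (hl : 0 < l) (ha : 0 ≤ a) (he : 0 ≤ e)
    (h : ∀ t, 0 ≤ t → t ≤ T → a * Real.exp (-(l * t)) ≤ μ.real {ω | t < d ω} + e) :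
    2 * a / l ^ 2 ≤ ∫ ω, min (d ω) T ^ 2 ∂μ + e * T ^ 2 +
      8 * (a * Real.exp (-(l * T / 2))) / l ^ 2 := by
  have hI : 0 ≤ ∫ ω, min (d ω) T ^ 2 ∂μ := integral_nonneg fun ω => sq_nonneg _
  have ha' : 0 ≤ a * Real.exp (-(l * T / 2)) := by positivity
  rw [← ENNReal.ofReal_le_ofReal_iff (by positivity), ENNReal.ofReal_add (by positivity)
    (by positivity), ENNReal.ofReal_add hI (by positivity),
    ofReal_integral_eq_lintegral_ofReal (integrable_min_sq hd hd0 hT)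
      (Eventually.of_forall fun ω => sq_nonneg _), lintegral_min_sq hd hd0 hT,
    ← lintegral_mul_exp_neg hl ha, ← lintegral_indicator_const_mul hT he,
    show 8 * (a * Real.exp (-(l * T / 2))) / l ^ 2 =
      2 * (a * Real.exp (-(l * T / 2))) / (l / 2) ^ 2 by ring,
    ← lintegral_mul_exp_neg (half_pos hl) ha', ← lintegral_add_right _ (by
      refine Measurable.mul ?_ (by fun_prop)
      exact measurable_const.indicator measurableSet_Iio),
    ← lintegral_add_right _ (by fun_prop)]
  refine setLIntegral_mono_ae' measurableSet_Ioi (Eventually.of_forall fun t ht => ?_)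
  have ht0 : (0 : ℝ) < t := ht
  rw [← add_mul, ← add_mul]
  gcongr
  by_cases htT : t ∈ Set.Iio T
  · rw [Set.indicator_of_mem htT, Set.indicator_of_mem htT]
    refine le_trans ?_ le_self_add
    rw [← ofReal_measureReal, ← ENNReal.ofReal_add measureReal_nonneg he]
    exact ENNReal.ofReal_le_ofReal (h t ht0.le (le_of_lt htT))
  · refine le_trans ?_ le_add_self
    have htT' : T ≤ t := not_lt.1 htT
    refine ENNReal.ofReal_le_ofReal ?_
    rw [mul_assoc, ← Real.exp_add]
    gcongr
    nlinarith

end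

/-! ### The mean square of the distance to the closest anecdote -/

/-- The distance between the target and the closest anecdote. -/
def gap (f : ℝ → ℝ) (S : SideInfo) (δ : ℝ) {n : ℕ} (p : (Fin n → ℝ) × ℝ) : ℝ :=
  ⨅ i, |p.1 i - target f S δ p|

section Gap

variable {f : ℝ → ℝ} (hf : WellBehaved f) {S : SideInfo} {n : ℕ}

theorem gap_nonneg (δ : ℝ) (p : (Fin n → ℝ) × ℝ) : 0 ≤ gap f S δ p :=
  Real.iInf_nonneg fun _ => abs_nonneg _

theorem gap_le (δ : ℝ) (p : (Fin n → ℝ) × ℝ) (i : Fin n) :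
    gap f S δ p ≤ |p.1 i - target f S δ p| :=
  ciInf_le (Set.finite_range _).bddBelow i

theorem setOf_lt_gap (hn : 0 < n) (δ t : ℝ) : {p | t < gap f S δ p} = gapEvent f S n δ t := by
  have : Nonempty (Fin n) := ⟨⟨0, hn⟩⟩
  ext p
  refine ⟨fun h i => lt_of_lt_of_le h (gap_le δ p i), fun h => ?_⟩
  obtain ⟨i, hi⟩ := exists_eq_ciInf_of_finite (f := fun i => |p.1 i - target f S δ p|)
  exact lt_of_lt_of_eq (h i) hi

include hf

theorem measurable_gap (S : SideInfo) (δ : ℝ) :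
    Measurable (gap f S δ : (Fin n → ℝ) × ℝ → ℝ) :=
  Measurable.iInf fun i =>
    (((measurable_pi_apply i).comp measurable_fst).sub (measurable_target hf S δ)).abs

set_option maxHeartbeats 400000 in
-- An exponential variable of rate 2 n f(δ) has second moment 1/(2 n² f(δ)²). The gap is sandwiched
-- between exponentials whose rates and prefactors tend to the right ones as η → 0, and the
-- truncation point is far above 1/n. Uniformity in δ comes from f(δ) ≥ f(D).
theorem exists_eventually_integral_gap_sq {ε : ℝ} (hε : 0 < ε) (D : ℝ) :
    ∃ η, 0 < η ∧ η ≤ 1 / 4 ∧ ∀ᶠ n : ℕ in atTop, ∀ (S : SideInfo) (δ : ℝ), |δ| ≤ D →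
      |∫ p, min (gap f S δ p) (η / 2 * scale n ^ 11) ^ 2 ∂noise f S n -
        1 / (2 * (n : ℝ) ^ 2 * f δ ^ 2)| ≤ ε / (n : ℝ) ^ 2 := by
  have hD := hf.pos D
  set M := 1 / (2 * f D ^ 2) with hM
  have hM0 : 0 < M := by positivity
  -- The prefactor 1 + η and the squared rate distortion (1 - η)⁴ combine to this relative error;
  -- the next one is its counterpart for the lower bound.
  have e1 : ∀ᶠ η : ℝ in 𝓝[>] 0, (1 + η) / (1 - η) ^ 4 - 1 < ε / 2 / M := by
    have h : Tendsto (fun η : ℝ => (1 + η) / (1 - η) ^ 4 - 1) (𝓝[>] 0)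
        (𝓝 ((1 + 0) / (1 - 0) ^ 4 - 1)) :=
      (ContinuousAt.tendsto (by fun_prop (disch := norm_num))).mono_left nhdsWithin_le_nhds
    norm_num at h
    exact h.eventually_lt_const (by positivity)
  have e2 : ∀ᶠ η : ℝ in 𝓝[>] 0, 1 - (1 - η) ^ 3 / (1 + η) ^ 4 < ε / 3 / M := by
    have h : Tendsto (fun η : ℝ => 1 - (1 - η) ^ 3 / (1 + η) ^ 4) (𝓝[>] 0)
        (𝓝 (1 - (1 - 0) ^ 3 / (1 + 0) ^ 4)) :=
      (ContinuousAt.tendsto (by fun_prop (disch := norm_num))).mono_left nhdsWithin_le_nhds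
    norm_num at h
    exact h.eventually_lt_const (by positivity)
  have e3 : ∀ᶠ η : ℝ in 𝓝[>] 0, η < 1 / 4 :=
    nhdsWithin_le_nhds (eventually_lt_nhds (by norm_num))
  obtain ⟨η, h1, h2, h3, hη⟩ := (e1.and (e2.and (e3.and self_mem_nhdsWithin))).exists
  have hη : 0 < η := hη
  refine ⟨η, hη, h3.le, ?_⟩
  rw [lt_div_iff₀ hM0] at h1 h2
  have c1 := eventually_exp_le_pow (κ := f D * η / 2) (by positivity)
    (ε := ε / 3 / (4 * M)) (by positivity) 0
  have c2 := eventually_mul_pow_le (a := 1) (b := ε / 3) (by positivity) (k := 72) (by norm_num)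
  have c3 := eventually_mul_pow_le (a := 1) (b := 1) one_pos (k := 1) one_ne_zero
  filter_upwards [eventually_gapEvent_bounds hf hη h3.le D, tendsto_scale.eventually c1,
    tendsto_scale.eventually c2, tendsto_scale.eventually c3,
    tendsto_scale.eventually self_mem_nhdsWithin, eventually_gt_atTop 0]
    with n hb c1 c2 c3 hv hn S δ hδ
  have hvn := scale_pow hn
  set v := scale n
  have hv0 : 0 < v := hv
  have := isProbabilityMeasure_noise hf (n := n) S
  have hn0 : (0 : ℝ) < n := by exact_mod_cast hn
  have hδp := hf.pos δ
  have hδD : f D ≤ f δ := hf.antitone_abs (hδ.trans (le_abs_self D))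
  have hT : 0 ≤ η / 2 * v ^ 11 := by positivity
  have hT1 : (η / 2 * v ^ 11) ^ 2 ≤ 1 := by
    have : v ^ 11 ≤ 1 := pow_le_one₀ hv0.le (by linarith)
    exact pow_le_one₀ hT (by nlinarith)
  have hη1 : 0 < 1 - η := by linarith
  have herr : v ^ 96 * (η / 2 * v ^ 11) ^ 2 ≤ ε / 3 / (n : ℝ) ^ 2 := by
    rw [le_div_iff₀ (by positivity)]
    calc v ^ 96 * (η / 2 * v ^ 11) ^ 2 * (n : ℝ) ^ 2
        ≤ v ^ 96 * 1 * (n : ℝ) ^ 2 := by gcongr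
      _ = (n * v ^ 12) ^ 2 * (1 * v ^ 72) := by ring
      _ ≤ ε / 3 := by rw [hvn]; linarith
  have hm : 1 / (2 * (n : ℝ) ^ 2 * f δ ^ 2) ≤ M / (n : ℝ) ^ 2 := by
    rw [hM, div_div]
    refine one_div_le_one_div_of_le (by positivity) ?_
    have : f D ^ 2 ≤ f δ ^ 2 := by gcongr
    nlinarith [sq_nonneg (n : ℝ)]
  set m := 1 / (2 * (n : ℝ) ^ 2 * f δ ^ 2) with hmdef
  have hm0 : 0 < m := by positivity
  have up := integral_min_sq_le (μ := noise f S n) (T := η / 2 * v ^ 11) (e := v ^ 96)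
    (measurable_gap hf S δ) (gap_nonneg δ) hT (l := 2 * (1 - η) ^ 2 * n * f δ) (a := 1 + η)
    (by positivity) (by positivity) (by positivity) fun t ht ht' => by
      rw [setOf_lt_gap hn]; exact (hb S δ hδ t ht ht').1
  have lo := le_integral_min_sq (μ := noise f S n) (T := η / 2 * v ^ 11) (e := v ^ 96)
    (measurable_gap hf S δ) (gap_nonneg δ) hT (l := 2 * (1 + η) ^ 2 / (1 - η) * n * f δ)
    (a := 1 - η) (by positivity) (by positivity) (by positivity) fun t ht ht' => by
      rw [setOf_lt_gap hn]; exact (hb S δ hδ t ht ht').2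
  have up1 : 2 * (1 + η) / (2 * (1 - η) ^ 2 * n * f δ) ^ 2 = (1 + η) / (1 - η) ^ 4 * m := by
    rw [hmdef]; field_simp
  have lo1 : 2 * (1 - η) / (2 * (1 + η) ^ 2 / (1 - η) * n * f δ) ^ 2 =
      (1 - η) ^ 3 / (1 + η) ^ 4 * m := by
    rw [hmdef]; field_simp
  have hq1 : (1 - η) ^ 3 / (1 + η) ^ 4 ≤ 1 := by
    rw [div_le_one (by positivity)]
    have : (1 - η) ^ 3 ≤ 1 := pow_le_one₀ hη1.le (by linarith)
    have : 1 ≤ (1 + η) ^ 4 := one_le_pow₀ (by linarith)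
    linarith
  have hq2 : 0 ≤ (1 + η) / (1 - η) ^ 4 - 1 := by
    rw [sub_nonneg, one_le_div (by positivity)]
    have : (1 - η) ^ 4 ≤ 1 := pow_le_one₀ hη1.le (by linarith)
    linarith
  -- Rate times truncation point is at least a multiple of n v¹¹ = 1/v, so the lost tail vanishes.
  have hexp : Real.exp (-(2 * (1 + η) ^ 2 / (1 - η) * n * f δ * (η / 2 * v ^ 11) / 2)) ≤
      ε / 3 / (4 * M) := by
    refine le_trans (Real.exp_le_exp.2 (neg_le_neg ?_)) (c1.trans_eq (by ring))
    have hnv : (n : ℝ) * v ^ 11 = 1 / v := by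
      rw [eq_div_iff hv0.ne']; linarith
    have h1 : 1 ≤ (1 + η) ^ 2 / (1 - η) := by
      rw [one_le_div hη1]; nlinarith
    calc f D * η / 2 / v = 1 * f D * (η / 2) * (1 / v) := by ring
      _ ≤ (1 + η) ^ 2 / (1 - η) * f δ * (η / 2) * (1 / v) := by gcongr
      _ = _ := by rw [← hnv]; ring
  have hrem : 8 * ((1 - η) * Real.exp (-(2 * (1 + η) ^ 2 / (1 - η) * n * f δ *
      (η / 2 * v ^ 11) / 2))) / (2 * (1 + η) ^ 2 / (1 - η) * n * f δ) ^ 2 ≤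
      ε / 3 / (n : ℝ) ^ 2 := by
    set E := Real.exp (-(2 * (1 + η) ^ 2 / (1 - η) * n * f δ * (η / 2 * v ^ 11) / 2))
    calc _ = 4 * (2 * (1 - η) / (2 * (1 + η) ^ 2 / (1 - η) * n * f δ) ^ 2) * E := by ring
      _ ≤ 4 * (M / (n : ℝ) ^ 2) * (ε / 3 / (4 * M)) := by
        rw [lo1]
        gcongr
        calc (1 - η) ^ 3 / (1 + η) ^ 4 * m ≤ 1 * m := by gcongr
          _ ≤ _ := by linarith
      _ = _ := by field_simp
  rw [up1] at up
  rw [lo1] at lo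
  have k1 : ((1 + η) / (1 - η) ^ 4 - 1) * m ≤ ε / 2 / (n : ℝ) ^ 2 := by
    calc _ ≤ ((1 + η) / (1 - η) ^ 4 - 1) * (M / (n : ℝ) ^ 2) := by gcongr
      _ = ((1 + η) / (1 - η) ^ 4 - 1) * M / (n : ℝ) ^ 2 := by ring
      _ ≤ _ := by gcongr
  have k2 : (1 - (1 - η) ^ 3 / (1 + η) ^ 4) * m ≤ ε / 3 / (n : ℝ) ^ 2 := by
    have : 0 ≤ 1 - (1 - η) ^ 3 / (1 + η) ^ 4 := by linarith
    calc _ ≤ (1 - (1 - η) ^ 3 / (1 + η) ^ 4) * (M / (n : ℝ) ^ 2) := by gcongr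
      _ = (1 - (1 - η) ^ 3 / (1 + η) ^ 4) * M / (n : ℝ) ^ 2 := by ring
      _ ≤ _ := by gcongr
  have hp : 0 < ε / (n : ℝ) ^ 2 := by positivity
  have hε2 : ε / 2 / (n : ℝ) ^ 2 = 1 / 2 * (ε / (n : ℝ) ^ 2) := by ring
  have hε3 : ε / 3 / (n : ℝ) ^ 2 = 1 / 3 * (ε / (n : ℝ) ^ 2) := by ring
  rw [hε2] at k1
  rw [hε3] at k2 hrem herr
  rw [abs_le]
  constructor <;> linarith

end Gap

/-! ### Moments -/

section Moments

variable {f : ℝ → ℝ} (hf : WellBehaved f) {S : SideInfo} {n : ℕ}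
include hf

theorem exists_integral_exp_abs_posteriorMean_le : ∃ C : ℝ, 0 < C ∧ ∀ (S : SideInfo) (n : ℕ),
    16 ≤ n → Integrable (fun p => Real.exp |posteriorMean f S p.1 p.2|) (noise f S n) ∧
      ∫ p, Real.exp |posteriorMean f S p.1 p.2| ∂noise f S n ≤ C := by
  obtain ⟨C, hC, h⟩ := lintegral_post_exp_le hf
  refine ⟨C, hC, fun S n hn => ?_⟩
  have hn0 : (16 : ℝ) ≤ n := by exact_mod_cast hn
  have hs : 1 ≤ √(n : ℝ) := Real.one_le_sqrt.2 (by linarith)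
  have hk : √(n : ℝ) < n := by
    have := Real.mul_self_sqrt (by linarith : (0 : ℝ) ≤ n)
    have : 4 ≤ √(n : ℝ) := Real.le_sqrt_of_sq_le (by norm_num; exact_mod_cast hn)
    nlinarith
  have hm : Measurable fun p : (Fin n → ℝ) × ℝ => Real.exp |posteriorMean f S p.1 p.2| :=
    (continuous_abs.measurable.comp (measurable_posteriorMean hf S)).exp
  have hle : ∫⁻ p, ENNReal.ofReal (Real.exp |posteriorMean f S p.1 p.2|) ∂noise f S n ≤
      ENNReal.ofReal C := by
    refine (lintegral_mono fun p => ENNReal.ofReal_le_ofReal ?_).trans (h S n hn)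
    refine (exp_abs_posteriorMean_le hf S (by omega) p.1 p.2).trans ?_
    refine post_mono hf S _ _ (integrable_exp_likelihood hf S _ _ (by linarith))
      (integrable_exp_likelihood hf S _ _ hk) fun θ => ?_
    gcongr
  refine ⟨⟨hm.aestronglyMeasurable, ?_⟩, ?_⟩
  · rw [hasFiniteIntegral_iff_ofReal (Eventually.of_forall fun _ => (Real.exp_pos _).le)]
    exact hle.trans_lt ENNReal.ofReal_lt_top
  · rw [integral_eq_lintegral_of_nonneg_ae (Eventually.of_forall fun _ => (Real.exp_pos _).le)
      hm.aestronglyMeasurable]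
    exact ENNReal.toReal_le_of_le_ofReal hC.le hle

theorem measurePreserving_coord (S : SideInfo) (i : Fin n) :
    MeasurePreserving (fun p : (Fin n → ℝ) × ℝ => p.1 i) (noise f S n) (noiseLaw f) := by
  have := hf.isProbabilityMeasure
  exact (measurePreserving_eval (fun _ : Fin n => noiseLaw f) i).comp measurePreserving_fst

theorem integrable_pow_noiseLaw (k : ℕ) : Integrable (fun x => x ^ k) (noiseLaw f) := by
  refine hf.integrable_of_le (a := 1 / 2) (K := 2 ^ k * k.factorial) (by fun_prop) (by norm_num)
    fun x => ?_
  have h := Real.pow_div_factorial_le_exp (1 / 2 * |x|) (by positivity) k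
  rw [div_le_iff₀ (by positivity)] at h
  rw [abs_pow]
  calc |x| ^ k = 2 ^ k * (1 / 2 * |x|) ^ k := by rw [← mul_pow]; congr 1; ring
    _ ≤ 2 ^ k * (Real.exp (1 / 2 * |x|) * k.factorial) := by gcongr
    _ = _ := by ring

theorem integrable_coord_pow (S : SideInfo) (i : Fin n) (k : ℕ) :
    Integrable (fun p : (Fin n → ℝ) × ℝ => p.1 i ^ k) (noise f S n) :=
  (measurePreserving_coord hf S i).integrable_comp_of_integrable (integrable_pow_noiseLaw hf k)

theorem integral_coord_pow (S : SideInfo) (i : Fin n) (k : ℕ) :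
    ∫ p, p.1 i ^ k ∂noise f S n = ∫ x, x ^ k ∂noiseLaw f := by
  have hp := measurePreserving_coord hf S i
  rw [← hp.map_eq, integral_map hp.measurable.aemeasurable
    (by fun_prop : Measurable fun x : ℝ => x ^ k).aestronglyMeasurable]

end Moments

/-! ### The signaling loss in state `0` -/

section Loss

variable {f : ℝ → ℝ} {S : SideInfo} {n : ℕ} {π : (Fin n → ℝ) → ℝ → ℝ}

theorem TranslationInvariant.apply_add (hT : TranslationInvariant π) (θ : ℝ) (x : Fin n → ℝ)
    (y : ℝ) : π (fun i => θ + x i) (θ + y) = π x y + θ := by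
  simp only [add_comm θ]
  exact hT x y θ

/-- Scheme and posterior mean both translate with the state, which is thereby reduced to 0. -/
theorem signalingLoss_eq (hf : WellBehaved f) (hn : 0 < n) (hT : TranslationInvariant π)
    (δ θ : ℝ) : signalingLoss f S π δ θ = ∫ p, (π p.1 p.2 - target f S δ p) ^ 2 ∂noise f S n := by
  unfold signalingLoss
  refine integral_congr_ae (Eventually.of_forall fun p => ?_)
  have h : posteriorMean f S (fun i => θ + p.1 i) (θ + p.2) = posteriorMean f S p.1 p.2 + θ := by
    simp only [add_comm θ]
    exact posteriorMean_add hf S hn p.1 p.2 θ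
  simp only [hT.apply_add, h, target]
  ring

theorem IsScheme.sq_le (hπ : IsScheme S π) (x : Fin n → ℝ) (y : ℝ) : π x y ^ 2 ≤ ∑ i, x i ^ 2 := by
  obtain ⟨i, hi⟩ := hπ.selects x y
  rw [hi]
  exact Finset.single_le_sum (f := fun i => x i ^ 2) (fun j _ => sq_nonneg _) (Finset.mem_univ i)

theorem IsScheme.integrable_loss (hf : WellBehaved f) (hn : 16 ≤ n) (hπ : IsScheme S π) (δ : ℝ) :
    Integrable (fun p => (π p.1 p.2 - target f S δ p) ^ 2) (noise f S n) := by
  have := isProbabilityMeasure_noise hf (n := n) S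
  obtain ⟨C, hC, h⟩ := exists_integral_exp_abs_posteriorMean_le hf
  have hi : Integrable (fun p : (Fin n → ℝ) × ℝ => 3 * (∑ i, p.1 i ^ 2 +
      2 * Real.exp |posteriorMean f S p.1 p.2| + δ ^ 2)) (noise f S n) :=
    (((integrable_finsetSum _ fun i _ => integrable_coord_pow hf S i 2).add
      ((h S n hn).1.const_mul 2)).add (integrable_const _)).const_mul 3
  refine hi.mono' ((hπ.measurable.sub (measurable_target hf S δ)).pow_const 2).aestronglyMeasurable
    (Eventually.of_forall fun p => ?_)
  rw [Real.norm_of_nonneg (sq_nonneg _)]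
  have h1 := hπ.sq_le p.1 p.2
  have h2 := Real.pow_div_factorial_le_exp |posteriorMean f S p.1 p.2| (abs_nonneg _) 2
  rw [sq_abs] at h2
  norm_num [Nat.factorial] at h2
  set T := posteriorMean f S p.1 p.2
  set a := π p.1 p.2
  change (a - (T + δ)) ^ 2 ≤ _
  nlinarith [sq_nonneg (a + T), sq_nonneg (a + δ), sq_nonneg (T - δ)]

/-- Whatever is sent is one of the anecdotes, so its distance to the target is at least the gap;
truncation only lowers the left side. -/
theorem integral_gap_sq_le_signalingLoss (hf : WellBehaved f) (hn : 16 ≤ n) (hπ : IsScheme S π)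
    (hT : TranslationInvariant π) (δ θ : ℝ) {t : ℝ} (ht : 0 ≤ t) :
    ∫ p, min (gap f S δ p) t ^ 2 ∂noise f S n ≤ signalingLoss f S π δ θ := by
  have := isProbabilityMeasure_noise hf (n := n) S
  rw [signalingLoss_eq hf (by omega) hT]
  refine integral_mono (integrable_min_sq (measurable_gap hf S δ) (gap_nonneg δ) ht)
    (hπ.integrable_loss hf hn δ) fun p => ?_
  obtain ⟨i, hi⟩ := hπ.selects p.1 p.2
  simp only [hi]
  rw [← sq_abs (p.1 i - _)]
  exact pow_le_pow_left₀ (le_min (gap_nonneg δ p) ht) ((min_le_left _ _).trans (gap_le δ p i)) 2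

end Loss

/-! ### Lower bound for all schemes and upper bound for targeting. -/

section Bounds

variable {f : ℝ → ℝ} (hf : WellBehaved f)
include hf

/-- The lower bound on the loss of a scheme, uniformly over bounded sets of biases. -/
theorem eventually_le_signalingLoss {ε : ℝ} (hε : 0 < ε) (D : ℝ) :
    ∀ᶠ n : ℕ in atTop, ∀ (S : SideInfo) (δ : ℝ), |δ| ≤ D → ∀ π : (Fin n → ℝ) → ℝ → ℝ,
      IsScheme S π → TranslationInvariant π → ∀ θ,
        1 / (2 * (n : ℝ) ^ 2 * f δ ^ 2) - ε / (n : ℝ) ^ 2 ≤ signalingLoss f S π δ θ := by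
  obtain ⟨η, hη, -, h⟩ := exists_eventually_integral_gap_sq hf hε D
  filter_upwards [h, eventually_ge_atTop 16, tendsto_scale.eventually self_mem_nhdsWithin]
    with n h hn hv S δ hδ π hπ hT θ
  have hv : 0 < scale n := hv
  have h1 := (abs_le.1 (h S δ hδ)).1
  have h2 := integral_gap_sq_le_signalingLoss hf hn hπ hT δ θ
    (by positivity : 0 ≤ η / 2 * scale n ^ 11)
  linarith

/-- The gap is at most the distance to one fixed anecdote. This is crude but bounded uniformly in n,
which suffices on the rare event beyond the truncation. -/
theorem exists_integral_gap_pow_four_le : ∃ C : ℝ, 0 < C ∧ ∀ (S : SideInfo) (n : ℕ), 16 ≤ n →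
    Integrable (fun p => gap f S 0 p ^ 4) (noise f S n) ∧
      ∫ p, gap f S 0 p ^ 4 ∂noise f S n ≤ C := by
  obtain ⟨C, hC, h⟩ := exists_integral_exp_abs_posteriorMean_le hf
  have h4 : 0 ≤ ∫ x, x ^ 4 ∂noiseLaw f := integral_nonneg fun x => by positivity
  refine ⟨8 * (∫ x, x ^ 4 ∂noiseLaw f) + 192 * C, by positivity, fun S n hn => ?_⟩
  obtain ⟨h1, h2⟩ := h S n hn
  let i : Fin n := ⟨0, by omega⟩
  have hi := ((integrable_coord_pow hf S i 4).const_mul 8).add (h1.const_mul 192)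
  have hle : ∀ p : (Fin n → ℝ) × ℝ, gap f S 0 p ^ 4 ≤
      8 * p.1 i ^ 4 + 192 * Real.exp |posteriorMean f S p.1 p.2| := fun p => by
    have k1 : gap f S 0 p ^ 4 ≤ |p.1 i - target f S 0 p| ^ 4 :=
      pow_le_pow_left₀ (gap_nonneg 0 p) (gap_le 0 p i) 4
    have k2 := Real.pow_div_factorial_le_exp |posteriorMean f S p.1 p.2| (abs_nonneg _) 4
    rw [show (4 : ℕ) = 2 * 2 from rfl, pow_mul, sq_abs] at k2
    rw [show (4 : ℕ) = 2 * 2 from rfl, pow_mul |_|, sq_abs, target, add_zero] at k1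
    norm_num [Nat.factorial] at k2
    set T := posteriorMean f S p.1 p.2
    set a := p.1 i
    refine k1.trans ?_
    have k3 : (a - T) ^ 2 ≤ 2 * (a ^ 2 + T ^ 2) := by nlinarith [sq_nonneg (a + T)]
    have k4 : ((a - T) ^ 2) ^ 2 ≤ (2 * (a ^ 2 + T ^ 2)) ^ 2 :=
      pow_le_pow_left₀ (sq_nonneg _) k3 2
    nlinarith [sq_nonneg (a ^ 2 - T ^ 2)]
  have hint : Integrable (fun p => gap f S 0 p ^ 4) (noise f S n) :=
    hi.mono' ((measurable_gap hf S 0).pow_const 4).aestronglyMeasurable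
      (Eventually.of_forall fun p => by
        rw [Real.norm_of_nonneg (pow_nonneg (gap_nonneg 0 p) 4)]
        exact hle p)
  refine ⟨hint, (integral_mono hint hi hle).trans ?_⟩
  simp only [Pi.add_apply]
  rw [integral_add ((integrable_coord_pow hf S i 4).const_mul 8) (h1.const_mul 192),
    integral_const_mul, integral_const_mul, integral_coord_pow hf S i 4]
  linarith

/-- The upper bound on the loss of a targeting scheme, by the truncated distance between the target
and the closest anecdote and a tail term. -/
theorem signalingLoss_le {S : SideInfo} {n : ℕ} (hn : 16 ≤ n) {π : (Fin n → ℝ) → ℝ → ℝ}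
    (hπ : IsScheme S π) (hT : TranslationInvariant π) (htar : IsTargeting f S 0 π) (θ : ℝ) {t : ℝ}
    (ht : 0 ≤ t) (hint : Integrable (fun p => gap f S 0 p ^ 4) (noise f S n)) :
    signalingLoss f S π 0 θ ≤ ∫ p, min (gap f S 0 p) t ^ 2 ∂noise f S n +
      (∫ p, gap f S 0 p ^ 4 ∂noise f S n) / (n : ℝ) ^ 3 +
        (n : ℝ) ^ 3 * (noise f S n).real (gapEvent f S n 0 t) := by
  have := isProbabilityMeasure_noise hf (n := n) S
  have hn0 : (0 : ℝ) < n := by exact_mod_cast (by omega : 0 < n)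
  have : Nonempty (Fin n) := ⟨⟨0, by omega⟩⟩
  have hE := measurableSet_gapEvent hf (S := S) (n := n) 0 t
  have i1 := integrable_min_sq (μ := noise f S n) (measurable_gap hf S 0) (gap_nonneg 0) ht
  have i2 := hint.div_const ((n : ℝ) ^ 3)
  have i3 : Integrable ((gapEvent f S n 0 t).indicator fun _ => (n : ℝ) ^ 3) (noise f S n) :=
    (integrable_const _).indicator hE
  have i12 := i1.add i2
  rw [signalingLoss_eq hf (by omega) hT]
  refine (integral_mono (hπ.integrable_loss hf hn 0) (i12.add i3) fun p => ?_).trans_eq ?_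
  · have h1 : |π p.1 p.2 - target f S 0 p| ≤ gap f S 0 p := le_ciInf fun i => htar p.1 p.2 i
    have h2 : (π p.1 p.2 - target f S 0 p) ^ 2 ≤ gap f S 0 p ^ 2 := by
      rw [← sq_abs]
      exact pow_le_pow_left₀ (abs_nonneg _) h1 2
    refine h2.trans ?_
    simp only [Pi.add_apply]
    set d := gap f S 0 p with hd
    by_cases hp : p ∈ gapEvent f S n 0 t
    · rw [Set.indicator_of_mem hp]
      have h3 : 0 ≤ min d t ^ 2 := sq_nonneg _
      -- AM–GM with weight n³: the fourth moment then costs O(n⁻³), and the rare event is charged n³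
      -- times its probability.
      have h4 : d ^ 2 ≤ d ^ 4 / (n : ℝ) ^ 3 + (n : ℝ) ^ 3 := by
        have hn3 : 0 < (n : ℝ) ^ 3 := by positivity
        rw [← sub_le_iff_le_add, le_div_iff₀ hn3]
        nlinarith [sq_nonneg (d ^ 2 - (n : ℝ) ^ 3), sq_nonneg (d ^ 2), sq_nonneg ((n : ℝ) ^ 3)]
      linarith
    · rw [Set.indicator_of_notMem hp]
      have h3 : d ≤ t := by
        rw [← setOf_lt_gap (by omega)] at hp
        exact not_lt.1 hp
      rw [min_eq_left h3]
      have : 0 ≤ d ^ 4 / (n : ℝ) ^ 3 := by positivity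
      linarith
  · rw [integral_add' i12 i3, integral_add' i1 i2, integral_div,
      integral_indicator_const _ hE, smul_eq_mul, mul_comm ((noise f S n).real _)]

/-- The loss of targeting with offset `0`. -/
theorem eventually_signalingLoss_le {ε : ℝ} (hε : 0 < ε) :
    ∀ᶠ n : ℕ in atTop, ∀ (S : SideInfo) (π : (Fin n → ℝ) → ℝ → ℝ),
      IsScheme S π → TranslationInvariant π → IsTargeting f S 0 π → ∀ θ,
        signalingLoss f S π 0 θ ≤ 1 / (2 * (n : ℝ) ^ 2 * f 0 ^ 2) + ε / (n : ℝ) ^ 2 := by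
  obtain ⟨η, hη, hη', h⟩ := exists_eventually_integral_gap_sq hf (ε := ε / 4) (by positivity) 0
  obtain ⟨C, hC, hgap⟩ := exists_integral_gap_pow_four_le hf
  have h0 := hf.pos 0
  have hη1 : 0 < 1 - η := by linarith
  -- v⁶⁰ = n⁻⁵, which leaves order n⁻² after multiplication by n³.
  have c1 := eventually_exp_le_pow (κ := (1 - η) ^ 2 * f 0 * η) (by positivity) (ε := ε / 8)
    (by positivity) 60
  have c2 := eventually_mul_pow_le (a := 1) (b := ε / 4) (by positivity) (k := 36) (by norm_num)
  filter_upwards [h, eventually_gapEvent_bounds hf hη hη' 0, eventually_ge_atTop 16,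
    tendsto_scale.eventually self_mem_nhdsWithin, tendsto_scale.eventually c1,
    tendsto_scale.eventually c2,
    tendsto_natCast_atTop_atTop.eventually (eventually_ge_atTop (4 * C / ε))]
    with n h hb hn hv c1 c2 c3 S π hπ hT htar θ
  have hv : 0 < scale n := hv
  have hvn := scale_pow (by omega : 0 < n)
  set v := scale n
  have hn0 : (0 : ℝ) < n := by exact_mod_cast (by omega : 0 < n)
  have ht : 0 ≤ η / 2 * v ^ 11 := by positivity
  obtain ⟨hint, hC4⟩ := hgap S n hn
  have h1 := (abs_le.1 (h S 0 (by simp))).2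
  have h2 := signalingLoss_le hf hn hπ hT htar θ ht hint
  have h3 := (hb S 0 (by simp) _ ht le_rfl).1
  have hexp : Real.exp (-(2 * (1 - η) ^ 2 * n * f 0 * (η / 2 * v ^ 11))) ≤ ε / 8 * v ^ 60 := by
    refine le_trans (Real.exp_le_exp.2 (neg_le_neg (le_of_eq ?_))) c1
    rw [div_eq_iff hv.ne']
    linear_combination -((1 - η) ^ 2 * f 0 * η) * hvn
  have e1 : (∫ p, gap f S 0 p ^ 4 ∂noise f S n) / (n : ℝ) ^ 3 ≤ 1 / 4 * (ε / (n : ℝ) ^ 2) := by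
    rw [div_le_iff₀ hε] at c3
    calc _ ≤ C / (n : ℝ) ^ 3 := by gcongr
      _ ≤ _ := by
        rw [div_le_iff₀ (by positivity)]
        have : 1 / 4 * (ε / (n : ℝ) ^ 2) * (n : ℝ) ^ 3 = 1 / 4 * (n * ε) := by field_simp
        linarith
  have e2 : (n : ℝ) ^ 3 * (noise f S n).real (gapEvent f S n 0 (η / 2 * v ^ 11)) ≤
      1 / 2 * (ε / (n : ℝ) ^ 2) := by
    have hPle : (noise f S n).real (gapEvent f S n 0 (η / 2 * v ^ 11)) ≤
        ε / 4 * v ^ 60 + v ^ 96 := by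
      refine h3.trans (add_le_add_left ?_ _)
      calc _ ≤ 2 * (ε / 8 * v ^ 60) := by gcongr; linarith
        _ = _ := by ring
    calc _ ≤ (n : ℝ) ^ 3 * (ε / 4 * v ^ 60 + v ^ 96) := by gcongr
      _ = ((n * v ^ 12) ^ 5 * (ε / 4) + (n * v ^ 12) ^ 5 * (1 * v ^ 36)) / (n : ℝ) ^ 2 := by
        field_simp
      _ ≤ (1 ^ 5 * (ε / 4) + 1 ^ 5 * (ε / 4)) / (n : ℝ) ^ 2 := by rw [hvn]; gcongr
      _ = _ := by ring
  have e3 : ε / 4 / (n : ℝ) ^ 2 = 1 / 4 * (ε / (n : ℝ) ^ 2) := by ring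
  rw [e3] at h1
  linarith

end Bounds

/-! ### Symmetric targeting -/

section Closest

variable {f : ℝ → ℝ} {S : SideInfo} {n : ℕ}

/-- The `i`-th anecdote is a closest one to the posterior mean, and no earlier one is. -/
def IsFirstClosest (f : ℝ → ℝ) (S : SideInfo) {n : ℕ} (x : Fin n → ℝ) (y : ℝ) (i : Fin n) : Prop :=
  (∀ j, |x i - posteriorMean f S x y| ≤ |x j - posteriorMean f S x y|) ∧
    ∀ k < i, ∃ j, |x j - posteriorMean f S x y| < |x k - posteriorMean f S x y|

open Classical in
/-- The first one of the anecdotes that are closest to the posterior mean. -/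
def firstClosest (f : ℝ → ℝ) (S : SideInfo) {n : ℕ} (x : Fin n → ℝ) (y : ℝ) : ℝ :=
  ∑ i, if IsFirstClosest f S x y i then x i else 0

theorem IsFirstClosest.unique {x : Fin n → ℝ} {y : ℝ} {i j : Fin n}
    (hi : IsFirstClosest f S x y i) (hj : IsFirstClosest f S x y j) : i = j := by
  rcases lt_trichotomy i j with h | h | h
  · obtain ⟨k, hk⟩ := hj.2 i h
    exact absurd (hi.1 k) hk.not_ge
  · exact h
  · obtain ⟨k, hk⟩ := hi.2 j h
    exact absurd (hj.1 k) hk.not_ge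

theorem IsFirstClosest.firstClosest_eq {x : Fin n → ℝ} {y : ℝ} {i : Fin n}
    (hi : IsFirstClosest f S x y i) : firstClosest f S x y = x i := by
  rw [firstClosest, Finset.sum_eq_single i, if_pos hi]
  · intro j _ hj
    exact if_neg fun h => hj (h.unique hi)
  · simp

theorem exists_isFirstClosest (hn : 0 < n) (x : Fin n → ℝ) (y : ℝ) :
    ∃ i, IsFirstClosest f S x y i := by
  have : Nonempty (Fin n) := ⟨⟨0, hn⟩⟩
  set s : Set (Fin n) := {i | ∀ j, |x i - posteriorMean f S x y| ≤ |x j - posteriorMean f S x y|}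
  have hs : s.Nonempty := Finite.exists_min fun i => |x i - posteriorMean f S x y|
  obtain ⟨i, hi, hmin⟩ := WellFounded.has_min (wellFounded_lt (α := Fin n)) s hs
  refine ⟨i, hi, fun k hk => ?_⟩
  by_contra! h
  exact hmin k h hk

/-- Breaking ties by the least index makes the selection regions finite Boolean combinations of
inequalities between measurable distances. -/
theorem measurable_firstClosest (hf : WellBehaved f) :
    Measurable fun p : (Fin n → ℝ) × ℝ => firstClosest f S p.1 p.2 := by
  have hm : ∀ i : Fin n, Measurable fun p : (Fin n → ℝ) × ℝ =>
      |p.1 i - posteriorMean f S p.1 p.2| := fun i =>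
    (((measurable_pi_apply i).comp measurable_fst).sub (measurable_posteriorMean hf S)).abs
  refine Finset.measurable_sum _ fun i _ => Measurable.ite ?_
    ((measurable_pi_apply i).comp measurable_fst) measurable_const
  simp only [IsFirstClosest, Set.ofPred_and, Set.ofPred_forall, Set.ofPred_exists]
  exact (MeasurableSet.iInter fun j => measurableSet_le (hm i) (hm j)).inter
    (MeasurableSet.iInter fun k => MeasurableSet.iInter fun _ => MeasurableSet.iUnion fun j =>
      measurableSet_lt (hm j) (hm k))

theorem isScheme_firstClosest (hf : WellBehaved f) (hn : 0 < n) :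
    IsScheme S (firstClosest f S : (Fin n → ℝ) → ℝ → ℝ) where
  measurable := measurable_firstClosest hf
  selects x y := by
    obtain ⟨i, hi⟩ := exists_isFirstClosest (f := f) (S := S) hn x y
    exact ⟨i, hi.firstClosest_eq⟩
  -- The diffuse belief is Lebesgue measure for every y, so the posterior mean ignores y
  -- definitionally.
  ignores_diffuse := by
    rintro rfl x y y'
    rfl

theorem translationInvariant_firstClosest (hf : WellBehaved f) (hn : 0 < n) :
    TranslationInvariant (firstClosest f S : (Fin n → ℝ) → ℝ → ℝ) := by
  intro x y t
  obtain ⟨i, hi⟩ := exists_isFirstClosest (f := f) (S := S) hn x y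
  have hi' : IsFirstClosest f S (fun i => x i + t) (y + t) i := by
    simpa only [IsFirstClosest, posteriorMean_add hf S hn, add_sub_add_right_eq_sub] using hi
  rw [hi.firstClosest_eq, hi'.firstClosest_eq]

/-- Reflection preserves all distances to the posterior mean, hence the selected index. Breaking
ties by index, not by position, is what makes the rule symmetric. -/
theorem reflectionInvariant_firstClosest (hf : WellBehaved f) (hS : S.IsSymmetric) (hn : 0 < n) :
    ReflectionInvariant (firstClosest f S : (Fin n → ℝ) → ℝ → ℝ) := by
  intro x y
  obtain ⟨i, hi⟩ := exists_isFirstClosest (f := f) (S := S) hn x y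
  have h : ∀ a b : ℝ, |-a - -b| = |a - b| := fun a b => by rw [neg_sub_neg, abs_sub_comm]
  have hi' : IsFirstClosest f S (fun i => -x i) (-y) i := by
    simpa only [IsFirstClosest, posteriorMean_neg hf hS, h] using hi
  rw [hi.firstClosest_eq, hi'.firstClosest_eq]

theorem isTargeting_firstClosest (hn : 0 < n) :
    IsTargeting f S 0 (firstClosest f S : (Fin n → ℝ) → ℝ → ℝ) := by
  intro x y j
  obtain ⟨i, hi⟩ := exists_isFirstClosest (f := f) (S := S) hn x y
  rw [hi.firstClosest_eq, add_zero]
  exact hi.1 j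

end Closest

/-! ### Reflection symmetry and zero bias. -/

section Bias

variable {f : ℝ → ℝ} (hf : WellBehaved f) {S : SideInfo} {n : ℕ}
include hf

theorem measurePreserving_neg_noiseLaw :
    MeasurePreserving (fun x : ℝ => -x) (noiseLaw f) (noiseLaw f) := by
  refine ⟨measurable_neg, ?_⟩
  ext s hs
  rw [Measure.map_apply measurable_neg hs, noiseLaw, withDensity_apply _ hs,
    withDensity_apply _ (measurable_neg hs),
    ← (Measure.measurePreserving_neg (volume : Measure ℝ)).setLIntegral_comp_preimage hs
      (hf.continuous.measurable.ennreal_ofReal)]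
  simp only [hf.symmetric]

theorem measurePreserving_neg_noise (hS : S.IsSymmetric) :
    MeasurePreserving (fun p : (Fin n → ℝ) × ℝ => ((fun i => -p.1 i), -p.2))
      (noise f S n) (noise f S n) := by
  have := hf.isProbabilityMeasure
  exact (measurePreserving_pi (fun _ => noiseLaw f) (fun _ => noiseLaw f)
    fun _ => measurePreserving_neg_noiseLaw hf).prod ⟨measurable_neg, SideInfo.map_neg_law hS⟩

theorem IsScheme.integrable {π : (Fin n → ℝ) → ℝ → ℝ} (hπ : IsScheme S π) :
    Integrable (fun p => π p.1 p.2) (noise f S n) := by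
  have := isProbabilityMeasure_noise hf (n := n) S
  refine ((integrable_finsetSum Finset.univ fun i _ => integrable_coord_pow hf S i 2).add
    (integrable_const 1)).mono' hπ.measurable.aestronglyMeasurable (Eventually.of_forall fun p => ?_)
  have h := hπ.sq_le p.1 p.2
  simp only [Pi.add_apply, Real.norm_eq_abs]
  rw [← sq_abs] at h
  nlinarith [sq_nonneg (|π p.1 p.2| - 1)]

/-- The noise law is reflection invariant and the scheme is odd, so the mean equals its own
negative. -/
theorem hasBias_zero (hS : S.IsSymmetric) {π : (Fin n → ℝ) → ℝ → ℝ} (hπ : IsScheme S π)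
    (hT : TranslationInvariant π) (hR : ReflectionInvariant π) : HasBias f S π 0 := by
  intro θ
  simp only [hT.apply_add, add_sub_cancel_right]
  refine ⟨hπ.integrable hf, ?_⟩
  have hp := measurePreserving_neg_noise hf (n := n) hS
  have h : ∫ p, π (fun i => -p.1 i) (-p.2) ∂noise f S n = ∫ p, π p.1 p.2 ∂noise f S n := by
    conv_rhs => rw [← hp.map_eq]
    exact (integral_map hp.measurable.aemeasurable hπ.measurable.aestronglyMeasurable).symm
  simp only [hR _ _] at h
  rw [integral_neg] at h
  linarith

end Bias

end Anecdotes

end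

/-! ### The proposition. -/

theorem mainTheorem6 (f : ℝ → ℝ) (hf : Anecdotes.WellBehaved f) (S : Anecdotes.SideInfo) :
    -- with a symmetric side signal, targeting with offset `0` (ties broken symmetrically) has bias 0
    (S.IsSymmetric → ∀ n : ℕ, 1 ≤ n →
      (∃ π : (Fin n → ℝ) → ℝ → ℝ, Anecdotes.IsScheme S π ∧ Anecdotes.TranslationInvariant π ∧
        Anecdotes.IsTargeting f S 0 π ∧ Anecdotes.ReflectionInvariant π) ∧
      ∀ π : (Fin n → ℝ) → ℝ → ℝ, Anecdotes.IsScheme S π → Anecdotes.TranslationInvariant π →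
        Anecdotes.IsTargeting f S 0 π → Anecdotes.ReflectionInvariant π →
        Anecdotes.HasBias f S π 0) ∧
    -- the loss of the unbiased targeting scheme is `1 / (2 n² f(0)²) + o(1 / n²)`
    (∀ ε : ℝ, 0 < ε → ∃ N : ℕ, ∀ n : ℕ, N ≤ n → ∀ π : (Fin n → ℝ) → ℝ → ℝ,
      Anecdotes.IsScheme S π → Anecdotes.TranslationInvariant π →
      Anecdotes.IsTargeting f S 0 π → Anecdotes.HasBias f S π 0 →
      ∀ θ : ℝ, |Anecdotes.signalingLoss f S π 0 θ - 1 / (2 * (n : ℝ) ^ 2 * f 0 ^ 2)| ≤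
        ε / (n : ℝ) ^ 2) ∧
    -- the loss of every scheme with bias `δ` is at least `1 / (2 n² f(δ)²) - o(1 / n²)`
    (∀ D ε : ℝ, 0 < ε → ∃ N : ℕ, ∀ n : ℕ, N ≤ n → ∀ δ : ℝ, |δ| ≤ D →
      ∀ π : (Fin n → ℝ) → ℝ → ℝ,
      Anecdotes.IsScheme S π → Anecdotes.TranslationInvariant π → Anecdotes.HasBias f S π δ →
      ∀ θ : ℝ, 1 / (2 * (n : ℝ) ^ 2 * f δ ^ 2) - ε / (n : ℝ) ^ 2 ≤
        Anecdotes.signalingLoss f S π δ θ) := by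
  refine ⟨fun hS n hn => ⟨⟨Anecdotes.firstClosest f S, Anecdotes.isScheme_firstClosest hf hn,
    Anecdotes.translationInvariant_firstClosest hf hn, Anecdotes.isTargeting_firstClosest hn,
    Anecdotes.reflectionInvariant_firstClosest hf hS hn⟩,
    fun π hπ hT _ hR => Anecdotes.hasBias_zero hf hS hπ hT hR⟩, fun ε hε => ?_, fun D ε hε => ?_⟩
  -- The lower half of the expansion is the general lower bound at δ = 0, the only bias allowed by D
  -- = 0.
  · obtain ⟨N, hN⟩ := Filter.eventually_atTop.1
      ((Anecdotes.eventually_signalingLoss_le hf hε).and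
        (Anecdotes.eventually_le_signalingLoss hf hε 0))
    refine ⟨N, fun n hn π hπ hT htar _ θ => ?_⟩
    have h1 := (hN n hn).1 S π hπ hT htar θ
    have h2 := (hN n hn).2 S 0 (by simp) π hπ hT θ
    rw [abs_le]
    constructor <;> linarith
  · obtain ⟨N, hN⟩ := Filter.eventually_atTop.1 (Anecdotes.eventually_le_signalingLoss hf hε D)
    exact ⟨N, fun n hn δ hδ π hπ hT _ θ => hN n hn S δ hδ π hπ hT θ⟩
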